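/- Let $d\ge 1$. For $a\in\mathbb{R}^d$ and $L>0$ let $\Lambda=\Lambda_L(a)=\{y\in\mathbb{R}^d:\ |y-a|_\infty<\tfrac L2\}$ be the open box of side $L$ centered at $a$. Let $\Delta_\Lambda$ be the Laplacian on the complex Hilbert space $\mathrm{L}^2(\Lambda)$ with either Dirichlet or periodic boundary condition, let $V$ be a real-valued potential in $\mathrm{L}^\infty(\Lambda)$, and let $H_\Lambda=-\Delta_\Lambda+V$, with domain $\mathcal{D}(\Delta_\Lambda)$. For $\psi\in \mathrm{L}^2(\Lambda)$ and measurable $A\subset\mathbb{R}^d$ let $\psi_A=\psi\,\chi_{A\cap\Lambda}$, let $B(x,\delta)=\{y\in\mathbb{R}^d:\ |y-x|<\delta\}$ (Euclidean norm), and let $\|\cdot\|_2$ be the norm of $\mathrm{L}^2(\Lambda)$. There is a constant $m>0$, depending only on $d$, such that the following holds for each of the two boundary conditions, all $a\in\mathbb{R}^d$, $L>0$, $K<\infty$, and all $V$ with $\|V\|_\infty\le K$. Let $\psi\in\mathcal{D}(\Delta_\Lambda)$, let $\Theta\subset\Lambda$ be a (bounded) measurable set with $\|\psi_\Theta\|_2>0$,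 and let $x_0\in\Lambda\setminus\overline{\Theta}$ be such that $$Q:=\sup_{y\in\Theta}|y-x_0|\ \ge\ 1 .$$ Then, for every $\delta$ with $$0<\delta\le\min\{\operatorname{dist}(x_0,\Theta),\tfrac1{24}\}\qquad\text{and}\qquad B(x_0,\delta)\subset\Lambda,$$ we have $$\Big(\frac{\delta}{Q}\Big)^{m\,(1+K^{2/3})\,\big(Q^{4/3}+\log\frac{\|\psi\|_2}{\|\psi_\Theta\|_2}\big)}\ \|\psi_\Theta\|_2^2\ \le\ \|\psi_{B(x_0,\delta)}\|_2^2+\delta^2\,\|H_\Lambda\psi\|_2^2 .$$ -/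

import Mathlib

open MeasureTheory Set
open scoped ENNReal ContDiff InnerProductSpace

noncomputable section

namespace BoxSchrodinger

/-- The Euclidean space `ℝᵈ`. -/
abbrev Rd (d : ℕ) : Type := EuclideanSpace ℝ (Fin d)

/-- The open box of side `L` centred at `a`: the points `y` with `|y - a|_∞ < L / 2`. -/
def box {d : ℕ} (a : Rd d) (L : ℝ) : Set (Rd d) :=
  {y | ∀ i, |y i - a i| < L / 2}

/-- Lebesgue measure on the box. -/
abbrev boxMeasure {d : ℕ} (a : Rd d) (L : ℝ) : Measure (Rd d) :=
  volume.restrict (box a L)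

/-- The complex Hilbert space `L²(Λ)` of the box. -/
abbrev L2 {d : ℕ} (a : Rd d) (L : ℝ) : Type :=
  Lp ℂ 2 (boxMeasure a L)

/-- The two boundary conditions. -/
inductive BoundaryCondition : Type
  | dirichlet
  | periodic

/-- The `i`-th partial derivative. -/
def partialDeriv {d : ℕ} (i : Fin d) (φ : Rd d → ℂ) (x : Rd d) : ℂ :=
  fderiv ℝ φ x (EuclideanSpace.single i 1)

/-- The smooth functions that satisfy the boundary condition: the test functions on the box
(Dirichlet), or the smooth functions on `ℝᵈ` with period `L` in every coordinate (periodic). -/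
def core {d : ℕ} (bc : BoundaryCondition) (a : Rd d) (L : ℝ) :
    Submodule ℂ (Rd d → ℂ) where
  carrier := {φ | ContDiff ℝ ∞ φ ∧
    match bc with
    | .dirichlet => HasCompactSupport φ ∧ tsupport φ ⊆ box a L
    | .periodic => ∀ (i : Fin d) (x : Rd d), φ (x + EuclideanSpace.single i L) = φ x}
  zero_mem' := by
    refine ⟨contDiff_const, ?_⟩
    cases bc
    · refine ⟨HasCompactSupport.zero, ?_⟩
      simp [tsupport]
    · intro i x
      rfl
  add_mem' := by
    rintro φ χ ⟨hφ, hφ'⟩ ⟨hχ, hχ'⟩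
    refine ⟨hφ.add hχ, ?_⟩
    cases bc
    · exact ⟨hφ'.1.add hχ'.1, (tsupport_add φ χ).trans (union_subset hφ'.2 hχ'.2)⟩
    · intro i x
      simp only [Pi.add_apply, hφ' i x, hχ' i x]
  smul_mem' := by
    rintro c φ ⟨hφ, hφ'⟩
    refine ⟨hφ.const_smul c, ?_⟩
    cases bc
    · exact ⟨hφ'.1.smul_left (f := fun _ => c), (tsupport_smul_subset_right (fun _ => c) φ).trans hφ'.2⟩
    · intro i x
      simp only [Pi.smul_apply, hφ' i x]

/-- The pairs `(φ, ∇φ)` in `L²(Λ) × L²(Λ)ᵈ`, where `φ` is in the core. -/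
def coreGraph {d : ℕ} (bc : BoundaryCondition) (a : Rd d) (L : ℝ) :
    Submodule ℂ (L2 a L × (Fin d → L2 a L)) where
  carrier := {p | ∃ φ ∈ core bc a L, p.1 =ᵐ[boxMeasure a L] φ ∧
    ∀ i, p.2 i =ᵐ[boxMeasure a L] partialDeriv i φ}
  zero_mem' := by
    refine ⟨0, zero_mem _, Lp.coeFn_zero _ _ _, fun i => ?_⟩
    filter_upwards [Lp.coeFn_zero ℂ 2 (boxMeasure a L)] with x hx
    have h0 : fderiv ℝ (0 : Rd d → ℂ) x = 0 := by
      rw [fderiv_zero]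
      rfl
    rw [partialDeriv, h0]
    exact hx
  add_mem' := by
    rintro p q ⟨φ, hφ, hp, hp'⟩ ⟨χ, hχ, hq, hq'⟩
    refine ⟨φ + χ, add_mem hφ hχ, ?_, fun i => ?_⟩
    · filter_upwards [Lp.coeFn_add p.1 q.1, hp, hq] with x h1 h2 h3
      simp only [Prod.fst_add, h1, Pi.add_apply, h2, h3]
    · filter_upwards [Lp.coeFn_add (p.2 i) (q.2 i), hp' i, hq' i] with x h1 h2 h3
      have hd : fderiv ℝ (φ + χ) x = fderiv ℝ φ x + fderiv ℝ χ x :=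
        fderiv_add (hφ.1.differentiable (by simp) x) (hχ.1.differentiable (by simp) x)
      simp only [Prod.snd_add, h1, Pi.add_apply, h2, h3, partialDeriv, hd,
        add_apply]
  smul_mem' := by
    rintro c p ⟨φ, hφ, hp, hp'⟩
    refine ⟨c • φ, Submodule.smul_mem _ c hφ, ?_, fun i => ?_⟩
    · filter_upwards [Lp.coeFn_smul c p.1, hp] with x h1 h2
      simp only [Prod.smul_fst, h1, Pi.smul_apply, h2]
    · filter_upwards [Lp.coeFn_smul c (p.2 i), hp' i] with x h1 h2
      have hd : fderiv ℝ (c • φ) x = c • fderiv ℝ φ x :=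
        fderiv_const_smul (hφ.1.differentiable (by simp) x) c
      simp only [Prod.smul_snd, h1, Pi.smul_apply, h2, partialDeriv, hd,
        smul_apply]

/-- The form domain, as the set of pairs `(ψ, ∇ψ)`: the closure of the core in the `H¹` norm.
It is `H¹₀(Λ)` (Dirichlet), or the periodic Sobolev space `H¹_per(Λ)` (periodic). -/
def formGraph {d : ℕ} (bc : BoundaryCondition) (a : Rd d) (L : ℝ) :
    Submodule ℂ (L2 a L × (Fin d → L2 a L)) :=
  (coreGraph bc a L).topologicalClosure

/-- The graph of the Laplacian, as the operator associated with the closed quadratic form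
`∑ i, ‖∂ᵢψ‖²` on the form domain: `(ψ, f)` is in the graph if `ψ` is in the form domain, and
`⟨∇φ, ∇ψ⟩ = -⟨φ, f⟩` for all `φ` in the core (hence for all `φ` in the form domain). -/
def laplacianGraph {d : ℕ} (bc : BoundaryCondition) (a : Rd d) (L : ℝ) :
    Submodule ℂ (L2 a L × L2 a L) where
  carrier := {p | ∃ G : Fin d → L2 a L, (p.1, G) ∈ formGraph bc a L ∧
    ∀ q ∈ coreGraph bc a L, ∑ i, ⟪q.2 i, G i⟫_ℂ = -⟪q.1, p.2⟫_ℂ}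
  zero_mem' := ⟨0, zero_mem _, by simp⟩
  add_mem' := by
    rintro p p' ⟨G, hG, h⟩ ⟨G', hG', h'⟩
    refine ⟨G + G', add_mem hG hG', fun q hq => ?_⟩
    simp only [Pi.add_apply, inner_add_right, Finset.sum_add_distrib, h q hq, h' q hq,
      Prod.snd_add, neg_add]
  smul_mem' := by
    rintro c p ⟨G, hG, h⟩
    refine ⟨c • G, Submodule.smul_mem _ c hG, fun q hq => ?_⟩
    simp only [Pi.smul_apply, inner_smul_right, ← Finset.mul_sum, h q hq, Prod.smul_snd,
      mul_neg]

/-- The Laplacian `Δ_Λ` with the given boundary condition, an unbounded operator on `L²(Λ)`. -/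
def laplacian {d : ℕ} (bc : BoundaryCondition) (a : Rd d) (L : ℝ) :
    L2 a L →ₗ.[ℂ] L2 a L :=
  (laplacianGraph bc a L).toLinearPMap

/-- Multiplication by a real bounded potential, as an operator on `L²(Λ)`. -/
def potential {d : ℕ} {a : Rd d} {L : ℝ} (V : Lp ℝ ∞ (boxMeasure a L)) :
    L2 a L →ₗ[ℂ] L2 a L where
  toFun ψ := V • ψ
  map_add' ψ χ := Lp.add_smul V ψ χ
  map_smul' c ψ := by
    rw [RingHom.id_apply]
    apply Lp.ext
    filter_upwards [Lp.coeFn_lpSMul (r := 2) V (c • ψ), Lp.coeFn_lpSMul (r := 2) V ψ,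
      Lp.coeFn_smul c ψ, Lp.coeFn_smul c (V • ψ : L2 a L)] with x h1 h2 h3 h4
    rw [h1, h4]
    simp only [Pi.smul_apply', Pi.smul_apply, h2, h3]
    exact smul_comm _ _ _

/-- The Schrödinger operator `H_Λ = -Δ_Λ + V` on `L²(Λ)`, with domain `D(Δ_Λ)`. -/
def schrodinger {d : ℕ} (bc : BoundaryCondition) (a : Rd d) (L : ℝ)
    (V : Lp ℝ ∞ (boxMeasure a L)) : L2 a L →ₗ.[ℂ] L2 a L where
  domain := (laplacian bc a L).domain
  toFun := -(laplacian bc a L).toFun + (potential V).domRestrict _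

/-- `‖ψ_A‖₂`, where `ψ_A = ψ χ_A` and the norm is that of `L²(Λ)`. -/
def localNorm {d : ℕ} {a : Rd d} {L : ℝ} (ψ : L2 a L) (A : Set (Rd d)) : ℝ :=
  (eLpNorm (A.indicator ψ) 2 (boxMeasure a L)).toReal

/-- `Q(x, Θ) = sup_{y ∈ Θ} |y - x|`. -/
def supDist {d : ℕ} (x : Rd d) (Θ : Set (Rd d)) : ℝ :=
  sSup ((fun y => ‖y - x‖) '' Θ)

/-! The Laplacian is well defined: its graph is single valued. -/

theorem isOpen_box {d : ℕ} (a : Rd d) (L : ℝ) : IsOpen (box a L) := by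
  have : box a L = ⋂ i, {y : Rd d | |y i - a i| < L / 2} := by
    ext y
    simp [box]
  rw [this]
  exact isOpen_iInter_of_finite fun i => isOpen_lt (by fun_prop) continuous_const

/-- A function in `L²(Λ)` that is orthogonal to all real test functions on the box is zero. -/
theorem eq_zero_of_inner_test {d : ℕ} {a : Rd d} {L : ℝ} (f : L2 a L)
    (h : ∀ g : Rd d → ℝ, ContDiff ℝ ∞ g → HasCompactSupport g → tsupport g ⊆ box a L →
      ∫ x in box a L, (g x : ℂ) * f x = 0) : f = 0 := by
  have hloc : LocallyIntegrableOn (f : Rd d → ℂ) (box a L) volume :=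
    locallyIntegrableOn_of_locallyIntegrable_restrict
      ((Lp.memLp f).locallyIntegrable (by norm_num))
  have key := (isOpen_box a L).ae_eq_zero_of_integral_contDiff_smul_eq_zero hloc (by
    intro g hg hgc hgs
    rw [← h g hg hgc hgs]
    rw [setIntegral_eq_integral_of_forall_compl_eq_zero]
    · simp [Complex.real_smul]
    · intro x hx
      have : g x = 0 := image_eq_zero_of_notMem_tsupport fun hx' => hx (hgs hx')
      simp [this])
  rw [Lp.eq_zero_iff_ae_eq_zero]
  exact (ae_restrict_iff' (isOpen_box a L).measurableSet).2 key

/-- Every test function on the box agrees, on the box, with a function of the core: for the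
periodic boundary condition this is its periodization. -/
theorem exists_core_eqOn {d : ℕ} (bc : BoundaryCondition) {a : Rd d} {L : ℝ} (hL : 0 < L)
    (g : Rd d → ℂ) (hg : ContDiff ℝ ∞ g) (hgc : HasCompactSupport g)
    (hgs : tsupport g ⊆ box a L) : ∃ φ ∈ core bc a L, EqOn φ g (box a L) := by
  cases bc with
  | dirichlet => exact ⟨g, ⟨hg, hgc, hgs⟩, fun _ _ => rfl⟩
  | periodic =>
    let τ : (Fin d → ℤ) → Rd d := fun k => WithLp.toLp 2 fun i => L * (k i : ℝ)
    have hsupp : ∀ (k : Fin d → ℤ) (x : Rd d), g (x + τ k) ≠ 0 → ∀ i,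
        |x i + L * (k i : ℝ) - a i| < L / 2 := by
      intro k x hx i
      have : x + τ k ∈ box a L := hgs (subset_tsupport g hx)
      exact this i
    have hlf : LocallyFinite fun k : Fin d → ℤ =>
        Function.support fun x : Rd d => g (x + τ k) := by
      intro x
      refine ⟨Metric.ball x 1, Metric.ball_mem_nhds x one_pos, ?_⟩
      let M : Fin d → ℤ := fun i => ⌈(L / 2 + 1 + |x i| + |a i|) / L⌉
      refine (Set.finite_Icc (-M) M).subset ?_
      rintro k ⟨y, hy, hyx⟩
      have hb : ∀ i, |(k i : ℝ)| ≤ (L / 2 + 1 + |x i| + |a i|) / L := by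
        intro i
        rw [le_div_iff₀ hL]
        have h1 := abs_lt.1 (hsupp k y hy i)
        have h2 : |y i - x i| < 1 := by
          have h3 : ‖(y - x) i‖ ≤ ‖y - x‖ := PiLp.norm_apply_le _ i
          have h4 : ‖y - x‖ < 1 := by rwa [Metric.mem_ball, dist_eq_norm] at hyx
          exact lt_of_le_of_lt h3 h4
        have h2' := abs_lt.1 h2
        have h5 := abs_le.1 (le_refl |x i|)
        have h6 := abs_le.1 (le_refl |a i|)
        have h7 : |(k i : ℝ)| * L = |L * (k i : ℝ)| := by
          rw [abs_mul, abs_of_pos hL, mul_comm]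
        rw [h7]
        apply abs_le.2
        constructor <;> linarith
      constructor
      · intro i
        have h := (abs_le.1 ((hb i).trans (Int.le_ceil _))).1
        have h' : ((-M i : ℤ) : ℝ) ≤ (k i : ℝ) := by
          push_cast
          exact h
        exact_mod_cast h'
      · intro i
        have h := (abs_le.1 ((hb i).trans (Int.le_ceil _))).2
        exact_mod_cast h
    refine ⟨fun x => ∑ᶠ k, g (x + τ k), ⟨?_, ?_⟩, ?_⟩
    · rw [← contMDiff_iff_contDiff]
      refine contMDiff_finsum (fun k => ?_) hlf
      rw [contMDiff_iff_contDiff]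
      exact hg.comp (contDiff_id.add contDiff_const)
    · intro i x
      let e : (Fin d → ℤ) ≃ (Fin d → ℤ) := Equiv.addRight (Pi.single i 1)
      change ∑ᶠ k, g (x + EuclideanSpace.single i L + τ k) = ∑ᶠ k, g (x + τ k)
      rw [← finsum_comp_equiv e (f := fun k => g (x + τ k))]
      refine finsum_congr fun k => ?_
      congr 1
      ext j
      by_cases hj : j = i
      · subst hj
        simp [τ, e]
        ring
      · simp [τ, e, hj]
    · intro x hx
      have h0 : τ 0 = 0 := by
        ext i
        simp [τ]
      change ∑ᶠ k, g (x + τ k) = g x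
      rw [finsum_eq_single _ 0, h0, add_zero]
      intro k hk
      by_contra hne
      apply hk
      ext i
      have h1 := abs_lt.1 (hsupp k x hne i)
      have h2 := abs_lt.1 (hx i)
      have h3 : (k i : ℝ) < 1 := by
        by_contra hcon
        have := mul_le_mul_of_nonneg_left (not_lt.1 hcon) hL.le
        linarith
      have h4 : (-1 : ℝ) < (k i : ℝ) := by
        by_contra hcon
        have := mul_le_mul_of_nonneg_left (not_lt.1 hcon) hL.le
        linarith
      have h3' : k i < 1 := by exact_mod_cast h3
      have h4' : -1 < k i := by exact_mod_cast h4
      simp only [Pi.zero_apply]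
      omega

/-- The limit of gradients is determined by the limit of functions (closability). -/
theorem formGraph_eq_zero {d : ℕ} (bc : BoundaryCondition) {a : Rd d} {L : ℝ}
    (G : Fin d → L2 a L) (h : ((0 : L2 a L), G) ∈ formGraph bc a L) : G = 0 := by
  ext1 i
  refine eq_zero_of_inner_test (G i) fun g hg hgc hgs => ?_
  let χ : Rd d → ℂ := fun x => (g x : ℂ)
  have hχ : ContDiff ℝ ∞ χ := Complex.ofRealCLM.contDiff.comp hg
  have hχc : HasCompactSupport χ := hgc.comp_left (g := fun t : ℝ => (t : ℂ)) (by simp)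
  have hχs : tsupport χ ⊆ box a L :=
    (closure_mono (Function.support_comp_subset (g := fun t : ℝ => (t : ℂ)) (by simp) g)).trans hgs
  have hreal : ∀ x, (starRingEnd ℂ) (χ x) = χ x := fun x => Complex.conj_ofReal _
  let D : Rd d → ℂ := partialDeriv i χ
  have hDcont : Continuous D :=
    (hχ.continuous_fderiv (by simp)).clm_apply continuous_const
  have hDc : HasCompactSupport D := by
    refine (hχc.fderiv (𝕜 := ℝ)).mono' ?_
    refine (Function.support_subset_iff'.2 fun x hx => ?_).trans subset_closure
    have : fderiv ℝ χ x = 0 := Function.notMem_support.1 hx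
    simp [D, partialDeriv, this]
  have hDs : ∀ x ∉ box a L, D x = 0 := by
    intro x hx
    have : fderiv ℝ χ x = 0 := by
      by_contra hne
      exact hx (hχs (support_fderiv_subset ℝ hne))
    simp [D, partialDeriv, this]
  have hχ2 : MemLp χ 2 (boxMeasure a L) := hχ.continuous.memLp_of_hasCompactSupport hχc
  have hD2 : MemLp (fun x => (starRingEnd ℂ) (D x)) 2 (boxMeasure a L) :=
    (Complex.continuous_conj.comp hDcont).memLp_of_hasCompactSupport
      (hDc.comp_left (g := fun z : ℂ => (starRingEnd ℂ) z) (by simp))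
  let X : L2 a L := hχ2.toLp χ
  let Y : L2 a L := hD2.toLp _
  have hX := hχ2.coeFn_toLp
  have hY := hD2.coeFn_toLp
  have hclosed : IsClosed {p : L2 a L × (Fin d → L2 a L) | ⟪X, p.2 i⟫_ℂ = -⟪Y, p.1⟫_ℂ} :=
    isClosed_eq (by fun_prop) (by fun_prop)
  have hsub : (coreGraph bc a L : Set (L2 a L × (Fin d → L2 a L))) ⊆
      {p | ⟪X, p.2 i⟫_ℂ = -⟪Y, p.1⟫_ℂ} := by
    rintro p ⟨φ, hφ, hp, hp'⟩
    have h1 : ⟪X, p.2 i⟫_ℂ = ∫ x, χ x * partialDeriv i φ x := by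
      rw [L2.inner_def]
      trans ∫ x in box a L, χ x * partialDeriv i φ x
      · refine integral_congr_ae ?_
        filter_upwards [hX, hp' i] with x h2 h3
        change inner ℂ ((hχ2.toLp χ : L2 a L) x) (p.2 i x) = _
        rw [h2, h3, RCLike.inner_apply, hreal, mul_comm]
      · refine setIntegral_eq_integral_of_forall_compl_eq_zero fun x hx => ?_
        rw [image_eq_zero_of_notMem_tsupport fun h => hx (hχs h), zero_mul]
    have h2 : ⟪Y, p.1⟫_ℂ = ∫ x, D x * φ x := by
      rw [L2.inner_def]
      trans ∫ x in box a L, D x * φ x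
      · refine integral_congr_ae ?_
        filter_upwards [hY, hp] with x h2 h3
        change inner ℂ ((hD2.toLp _ : L2 a L) x) (p.1 x) = _
        rw [h2, h3, RCLike.inner_apply, Complex.conj_conj, mul_comm]
      · refine setIntegral_eq_integral_of_forall_compl_eq_zero fun x hx => ?_
        rw [hDs x hx, zero_mul]
    have hφc : Continuous φ := hφ.1.continuous
    have hφd : Continuous (partialDeriv i φ) :=
      (hφ.1.continuous_fderiv (by simp)).clm_apply continuous_const
    change ⟪X, p.2 i⟫_ℂ = -⟪Y, p.1⟫_ℂ
    rw [h1, h2]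
    refine integral_mul_fderiv_eq_neg_fderiv_mul_of_integrable ?_ ?_ ?_ ?_ ?_
    · exact (hDcont.mul hφc).integrable_of_hasCompactSupport hDc.mul_right
    · exact (hχ.continuous.mul hφd).integrable_of_hasCompactSupport hχc.mul_right
    · exact (hχ.continuous.mul hφc).integrable_of_hasCompactSupport hχc.mul_right
    · exact fun x _ => hχ.differentiable (by simp) x
    · exact fun x _ => hφ.1.differentiable (by simp) x
  have hmem : ((0 : L2 a L), G) ∈ {p : L2 a L × (Fin d → L2 a L) |
      ⟪X, p.2 i⟫_ℂ = -⟪Y, p.1⟫_ℂ} := closure_minimal hsub hclosed h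
  have h3 : ⟪X, G i⟫_ℂ = 0 := by
    have : ⟪X, G i⟫_ℂ = -⟪Y, (0 : L2 a L)⟫_ℂ := hmem
    simpa using this
  rw [← h3, L2.inner_def]
  refine integral_congr_ae ?_
  filter_upwards [hX] with x h2
  change _ = inner ℂ ((hχ2.toLp χ : L2 a L) x) (G i x)
  rw [h2, RCLike.inner_apply, hreal, mul_comm]

theorem laplacianGraph_single_valued {d : ℕ} (bc : BoundaryCondition) {a : Rd d} {L : ℝ}
    (hL : 0 < L) (p : L2 a L × L2 a L) (hp : p ∈ laplacianGraph bc a L) (h0 : p.1 = 0) :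
    p.2 = 0 := by
  obtain ⟨G, hG, h⟩ := hp
  rw [h0] at hG
  have hG0 := formGraph_eq_zero bc G hG
  subst hG0
  refine eq_zero_of_inner_test p.2 fun g hg hgc hgs => ?_
  have hχ : ContDiff ℝ ∞ fun x => (g x : ℂ) := Complex.ofRealCLM.contDiff.comp hg
  have hχc : HasCompactSupport fun x => (g x : ℂ) :=
    hgc.comp_left (g := fun t : ℝ => (t : ℂ)) (by simp)
  have hχs : tsupport (fun x => (g x : ℂ)) ⊆ box a L :=
    (closure_mono (Function.support_comp_subset (g := fun t : ℝ => (t : ℂ)) (by simp) g)).trans hgs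
  obtain ⟨φ, hφ, heq⟩ := exists_core_eqOn bc hL _ hχ hχc hχs
  have hbox := (isOpen_box a L).measurableSet
  have hae : φ =ᵐ[boxMeasure a L] fun x => (g x : ℂ) :=
    (ae_restrict_iff' hbox).2 (Filter.Eventually.of_forall heq)
  have hφ2 : MemLp φ 2 (boxMeasure a L) :=
    (memLp_congr_ae hae).2 (hχ.continuous.memLp_of_hasCompactSupport hχc)
  have hder : ∀ i, MemLp (partialDeriv i φ) 2 (boxMeasure a L) := by
    intro i
    have hc : HasCompactSupport (partialDeriv i fun x => (g x : ℂ)) := by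
      refine (hχc.fderiv (𝕜 := ℝ)).mono' ?_
      refine (Function.support_subset_iff'.2 fun x hx => ?_).trans subset_closure
      have : fderiv ℝ (fun x => (g x : ℂ)) x = 0 := Function.notMem_support.1 hx
      simp [partialDeriv, this]
    refine (memLp_congr_ae ?_).2
      (((hχ.continuous_fderiv (by simp)).clm_apply
        continuous_const).memLp_of_hasCompactSupport hc)
    refine (ae_restrict_iff' hbox).2 (Filter.Eventually.of_forall fun x hx => ?_)
    have hev : φ =ᶠ[nhds x] fun x => (g x : ℂ) :=
      Filter.eventuallyEq_of_mem ((isOpen_box a L).mem_nhds hx) heq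
    rw [partialDeriv, hev.fderiv_eq]
  have key := h (hφ2.toLp φ, fun i => (hder i).toLp _)
    ⟨φ, hφ, hφ2.coeFn_toLp, fun i => (hder i).coeFn_toLp⟩
  have h3 : ⟪(hφ2.toLp φ : L2 a L), p.2⟫_ℂ = 0 := by simpa using key
  rw [← h3, L2.inner_def]
  refine integral_congr_ae ?_
  filter_upwards [hφ2.coeFn_toLp, hae] with x h4 h5
  rw [h4, h5, RCLike.inner_apply, Complex.conj_ofReal, mul_comm]

/-- The graph of `Δ_Λ` is the graph in its definition. -/
theorem laplacian_graph {d : ℕ} (bc : BoundaryCondition) {a : Rd d} {L : ℝ} (hL : 0 < L) :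
    (laplacian bc a L).graph = laplacianGraph bc a L :=
  Submodule.toLinearPMap_graph_eq _ (laplacianGraph_single_valued bc hL)

end BoxSchrodinger

end

open BoxSchrodinger

/-!
The estimate is a Carleman estimate for smooth functions, transferred to the box by means of the
eigenfunctions of the Laplacian.

*Carleman estimate.* The operator `|x|² Δ` is conjugated with the weight `|x| ^ (-2 N) exp (γ |x|²)`.
The product of its symmetric part `S` and its antisymmetric part `A` is, up to a divergence, a
quadratic form that is positive because of the factor `exp (γ |x|²)`
(`integral_symmPart_mul_antisymmPart`), and `(S + A)² ≥ 4 S A` gives a Carleman inequality with the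
gain `γ N²` (`carleman`). Applied to a smooth `u` with `|Δu| ≤ K |u| + g`, cut off near the origin and
at distance about `8 Q`, with `γ` of order `N / Q²`, it absorbs the term with `K` as soon as
`N³ ≥ const K² Q⁴`; this is the origin of the powers `K ^ (2 / 3)` and `Q ^ (4 / 3)`. The outer
cutoff contributes the mass of `u` times `exp (-N)` (`exists_unique_continuation`).

*Transfer to the box.* The eigenfunctions are products of sines or exponentials. Their span is dense,
by the Stone–Weierstrass theorem (`exists_modeSpan_near`), and `1 - Δ` maps it onto itself, so it is
a core: each element of the graph of the Laplacian is a limit of pairs `(p, Δp)` with `p` in the span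
(`exists_modeSpan_near_laplacianGraph`). Such `p` are smooth on the whole space, and `|p|` and `|Δp|`
are invariant under the translations, or the reflections, that map the box to the other cells of the
lattice. Since `Q ≤ d L`, the ball of radius `8 Q` meets a number of cells that depends on `d` only,
so the integrals over this ball are bounded by integrals over the box
(`setIntegral_le_of_cellMap_invariant`). The function `g = max 0 (|Δp| - K |p|)` has the same
symmetries, and is bounded by `|-Δp + V p|` on the box. The resulting estimate is closed in the norm
of the graph, hence holds in the domain of the Laplacian
(`exists_unique_continuation_laplacianGraph`). Finally `N` is chosen so large, in terms of
`log (‖ψ‖ / ‖ψ_Θ‖)`, that the term with `exp (-N) ‖ψ‖²` is at most half of the left-hand side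
(`rpow_mul_sq_le_of_forall`).
-/

namespace BoxSchrodinger

/-! ### Coordinate calculus -/

/-- The `i`-th partial derivative of a function with values in a real normed space. For complex
values this is `partialDeriv i`. -/
noncomputable def pd {d : ℕ} {F : Type*} [NormedAddCommGroup F] [NormedSpace ℝ F] (i : Fin d)
    (u : Rd d → F) (x : Rd d) : F :=
  fderiv ℝ u x (EuclideanSpace.single i 1)

/-- The Laplacian, as the sum of the second partial derivatives. -/
noncomputable def lap {d : ℕ} {F : Type*} [NormedAddCommGroup F] [NormedSpace ℝ F]
    (u : Rd d → F) (x : Rd d) : F :=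
  ∑ i, pd i (pd i u) x

/-- The square of the Euclidean norm, as a polynomial in the coordinates. -/
def sq {d : ℕ} (x : Rd d) : ℝ := ∑ i, x i ^ 2

/-- The Euler (radial) derivative `x · ∇u`. -/
noncomputable def eul {d : ℕ} (u : Rd d → ℝ) (x : Rd d) : ℝ := ∑ i, x i * pd i u x

/-- The product of gradients `∇u · ∇w`. -/
noncomputable def gdot {d : ℕ} (u w : Rd d → ℝ) (x : Rd d) : ℝ := ∑ i, pd i u x * pd i w x

section Rules

variable {d : ℕ} {F : Type*} [NormedAddCommGroup F] [NormedSpace ℝ F]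

theorem contDiff_pd {u : Rd d → F} (hu : ContDiff ℝ ∞ u) (i : Fin d) :
    ContDiff ℝ ∞ (pd i u) :=
  (hu.fderiv_right (m := ∞) (by simp)).clm_apply contDiff_const

theorem contDiff_lap {u : Rd d → F} (hu : ContDiff ℝ ∞ u) : ContDiff ℝ ∞ (lap u) :=
  ContDiff.sum fun i _ => contDiff_pd (contDiff_pd hu i) i

theorem contDiff_coord (i : Fin d) : ContDiff ℝ ∞ fun x : Rd d => x i :=
  (EuclideanSpace.proj i : Rd d →L[ℝ] ℝ).contDiff

theorem contDiff_sq : ContDiff ℝ ∞ (sq : Rd d → ℝ) :=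
  ContDiff.sum fun i _ => (contDiff_coord i).pow 2

theorem contDiff_eul {u : Rd d → ℝ} (hu : ContDiff ℝ ∞ u) : ContDiff ℝ ∞ (eul u) :=
  ContDiff.sum fun i _ => (contDiff_coord i).mul (contDiff_pd hu i)

theorem contDiff_gdot {u w : Rd d → ℝ} (hu : ContDiff ℝ ∞ u) (hw : ContDiff ℝ ∞ w) :
    ContDiff ℝ ∞ (gdot u w) :=
  ContDiff.sum fun i _ => (contDiff_pd hu i).mul (contDiff_pd hw i)

theorem differentiableAt_of_contDiff {u : Rd d → F} (hu : ContDiff ℝ ∞ u) (x : Rd d) :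
    DifferentiableAt ℝ u x :=
  hu.differentiable (by simp) x

theorem pd_congr {u w : Rd d → F} {x : Rd d} (h : u =ᶠ[nhds x] w) (i : Fin d) :
    pd i u x = pd i w x := by
  rw [pd, pd, h.fderiv_eq]

theorem eventuallyEq_pd {u w : Rd d → F} {x : Rd d} (h : u =ᶠ[nhds x] w) (i : Fin d) :
    pd i u =ᶠ[nhds x] pd i w :=
  h.eventuallyEq_nhds.mono fun _ hy => pd_congr hy i

theorem lap_congr {u w : Rd d → F} {x : Rd d} (h : u =ᶠ[nhds x] w) : lap u x = lap w x :=
  Finset.sum_congr rfl fun i _ => pd_congr (eventuallyEq_pd h i) i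

theorem pd_const (c : F) (i : Fin d) (x : Rd d) : pd i (fun _ : Rd d => c) x = 0 := by
  simp [pd]

theorem pd_add {u w : Rd d → F} {x : Rd d} (hu : DifferentiableAt ℝ u x)
    (hw : DifferentiableAt ℝ w x) (i : Fin d) :
    pd i (fun y => u y + w y) x = pd i u x + pd i w x := by
  simp only [pd, fderiv_fun_add hu hw, add_apply]

theorem pd_sub {u w : Rd d → F} {x : Rd d} (hu : DifferentiableAt ℝ u x)
    (hw : DifferentiableAt ℝ w x) (i : Fin d) :
    pd i (fun y => u y - w y) x = pd i u x - pd i w x := by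
  simp only [pd, fderiv_fun_sub hu hw, sub_apply]

theorem pd_sum {ι : Type*} {A : ι → Rd d → F} {s : Finset ι} {x : Rd d}
    (h : ∀ j ∈ s, DifferentiableAt ℝ (A j) x) (i : Fin d) :
    pd i (fun y => ∑ j ∈ s, A j y) x = ∑ j ∈ s, pd i (A j) x := by
  simp only [pd, fderiv_fun_sum h, sum_apply]

theorem pd_smul {a : Rd d → ℝ} {u : Rd d → F} {x : Rd d} (ha : DifferentiableAt ℝ a x)
    (hu : DifferentiableAt ℝ u x) (i : Fin d) :
    pd i (fun y => a y • u y) x = pd i a x • u x + a x • pd i u x := by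
  simp only [pd, fderiv_fun_smul ha hu, add_apply, smul_apply,
    ContinuousLinearMap.smulRight_apply]
  exact add_comm _ _

theorem pd_mul {u w : Rd d → ℝ} {x : Rd d} (hu : DifferentiableAt ℝ u x)
    (hw : DifferentiableAt ℝ w x) (i : Fin d) :
    pd i (fun y => u y * w y) x = pd i u x * w x + u x * pd i w x :=
  pd_smul hu hw i

theorem pd_mul_complex {u w : Rd d → ℂ} {x : Rd d} (hu : DifferentiableAt ℝ u x)
    (hw : DifferentiableAt ℝ w x) (i : Fin d) :
    pd i (fun y => u y * w y) x = pd i u x * w x + u x * pd i w x := by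
  simp only [pd]
  rw [fderiv_fun_mul hu hw]
  simp only [add_apply, smul_apply, smul_eq_mul]
  ring

theorem pd_coord (i j : Fin d) (x : Rd d) :
    pd i (fun y : Rd d => y j) x = if j = i then 1 else 0 := by
  have h : fderiv ℝ (fun y : Rd d => y j) x =
      (EuclideanSpace.proj j : Rd d →L[ℝ] ℝ) :=
    (EuclideanSpace.proj j : Rd d →L[ℝ] ℝ).hasFDerivAt.fderiv
  rw [pd, h]
  simp [eq_comm]

theorem pd_comp {g : ℝ → ℝ} {a : Rd d → ℝ} {x : Rd d} {g' : ℝ} (hg : HasDerivAt g g' (a x))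
    (ha : DifferentiableAt ℝ a x) (i : Fin d) :
    pd i (fun y => g (a y)) x = g' * pd i a x := by
  have := (hg.comp_hasFDerivAt x ha.hasFDerivAt).fderiv
  rw [pd, pd]
  change (fderiv ℝ (g ∘ a) x) _ = _
  rw [this]
  simp

theorem pd_clm {G : Type*} [NormedAddCommGroup G] [NormedSpace ℝ G] (l : F →L[ℝ] G)
    {u : Rd d → F} {x : Rd d} (hu : DifferentiableAt ℝ u x) (i : Fin d) :
    pd i (fun y => l (u y)) x = l (pd i u x) := by
  have := (l.hasFDerivAt.comp x hu.hasFDerivAt).fderiv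
  rw [pd, pd]
  change (fderiv ℝ (l ∘ u) x) _ = _
  rw [this]
  simp

theorem pd_sq (i : Fin d) (x : Rd d) : pd i sq x = 2 * x i := by
  have h : ∀ j, ContDiff ℝ ∞ fun y : Rd d => y j ^ 2 := fun j => (contDiff_coord j).pow 2
  have h1 : pd i sq x = ∑ j, pd i (fun y : Rd d => y j ^ 2) x :=
    pd_sum (fun j _ => differentiableAt_of_contDiff (h j) x) i
  have h2 : ∀ j, pd i (fun y : Rd d => y j ^ 2) x = 2 * x j * (if j = i then 1 else 0) := by
    intro j
    have h3 := pd_comp (g := fun t => t ^ 2) (a := fun y : Rd d => y j) (x := x)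
      (by simpa using hasDerivAt_pow 2 (x j))
      (differentiableAt_of_contDiff (contDiff_coord j) x) i
    rw [h3, pd_coord]
  rw [h1, Finset.sum_congr rfl fun j _ => h2 j]
  simp

theorem pd_comm {u : Rd d → F} (hu : ContDiff ℝ ∞ u) (i j : Fin d) (x : Rd d) :
    pd i (pd j u) x = pd j (pd i u) x := by
  have h : ∀ k l : Fin d, pd k (pd l u) x =
      fderiv ℝ (fderiv ℝ u) x (EuclideanSpace.single k 1) (EuclideanSpace.single l 1) := by
    intro k l
    have hd : DifferentiableAt ℝ (fderiv ℝ u) x :=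
      (hu.fderiv_right (m := ∞) (by simp)).differentiable (by simp) x
    have h1 := (hd.hasFDerivAt.clm_apply
      (hasFDerivAt_const (EuclideanSpace.single l (1 : ℝ)) x)).fderiv
    change (fderiv ℝ (fun y => fderiv ℝ u y (EuclideanSpace.single l 1)) x) _ = _
    rw [h1]
    simp
  rw [h, h]
  exact (hu.contDiffAt.isSymmSndFDerivAt (by simp; exact WithTop.coe_le_coe.2 le_top)) _ _

theorem eul_mul {u w : Rd d → ℝ} {x : Rd d} (hu : DifferentiableAt ℝ u x)
    (hw : DifferentiableAt ℝ w x) :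
    eul (fun y => u y * w y) x = eul u x * w x + u x * eul w x := by
  simp only [eul, pd_mul hu hw, Finset.mul_sum, Finset.sum_mul, ← Finset.sum_add_distrib]
  exact Finset.sum_congr rfl fun i _ => by ring

theorem gdot_mul_left {a b w : Rd d → ℝ} {x : Rd d} (ha : DifferentiableAt ℝ a x)
    (hb : DifferentiableAt ℝ b x) :
    gdot (fun y => a y * b y) w x = gdot a w x * b x + a x * gdot b w x := by
  simp only [gdot, pd_mul ha hb, Finset.mul_sum, Finset.sum_mul, ← Finset.sum_add_distrib]
  exact Finset.sum_congr rfl fun i _ => by ring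

theorem eul_comp {g : ℝ → ℝ} {a : Rd d → ℝ} {x : Rd d} {g' : ℝ} (hg : HasDerivAt g g' (a x))
    (ha : DifferentiableAt ℝ a x) : eul (fun y => g (a y)) x = g' * eul a x := by
  simp only [eul, pd_comp hg ha, Finset.mul_sum]
  exact Finset.sum_congr rfl fun i _ => by ring

theorem gdot_comp_left {g : ℝ → ℝ} {a w : Rd d → ℝ} {x : Rd d} {g' : ℝ}
    (hg : HasDerivAt g g' (a x)) (ha : DifferentiableAt ℝ a x) :
    gdot (fun y => g (a y)) w x = g' * gdot a w x := by
  simp only [gdot, pd_comp hg ha, Finset.mul_sum]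
  exact Finset.sum_congr rfl fun i _ => by ring

theorem eul_sq (x : Rd d) : eul sq x = 2 * sq x := by
  simp only [eul, pd_sq, sq, Finset.mul_sum]
  exact Finset.sum_congr rfl fun i _ => by ring

theorem gdot_sq_left (w : Rd d → ℝ) (x : Rd d) : gdot sq w x = 2 * eul w x := by
  simp only [gdot, pd_sq, eul, Finset.mul_sum]
  exact Finset.sum_congr rfl fun i _ => by ring

theorem lap_sq (x : Rd d) : lap sq x = 2 * d := by
  have h : ∀ i : Fin d, pd i (pd i sq) x = 2 := by
    intro i
    have h1 : (pd i sq : Rd d → ℝ) = fun y => 2 * y i := funext fun y => pd_sq i y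
    rw [h1, pd_mul (differentiableAt_const _)
      (differentiableAt_of_contDiff (contDiff_coord i) x), pd_const, pd_coord]
    simp
  simp only [lap, h]
  simp [mul_comm]

/-- The commutation rule `∇(x · ∇u) · ∇u = |∇u|² + (x · ∇)|∇u|² / 2`. -/
theorem gdot_eul_left {u : Rd d → ℝ} (hu : ContDiff ℝ ∞ u) (x : Rd d) :
    gdot (eul u) u x = gdot u u x + 1 / 2 * eul (gdot u u) x := by
  have hd := fun i => differentiableAt_of_contDiff (contDiff_pd hu i) x
  have hc := fun i => differentiableAt_of_contDiff (contDiff_coord (d := d) i) x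
  have h1 : ∀ i, pd i (eul u) x = pd i u x + ∑ j, x j * pd i (pd j u) x := by
    intro i
    have : pd i (eul u) x = ∑ j, pd i (fun y => y j * pd j u y) x :=
      pd_sum (fun j _ => (hc j).mul (hd j)) i
    rw [this, Finset.sum_congr rfl fun j _ => pd_mul (hc j) (hd j) i, Finset.sum_add_distrib]
    simp [pd_coord]
  have h2 : ∀ i, pd i (gdot u u) x = 2 * ∑ j, pd j u x * pd i (pd j u) x := by
    intro i
    have : pd i (gdot u u) x = ∑ j, pd i (fun y => pd j u y * pd j u y) x :=
      pd_sum (fun j _ => (hd j).mul (hd j)) i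
    rw [this, Finset.sum_congr rfl fun j _ => pd_mul (hd j) (hd j) i, Finset.mul_sum]
    exact Finset.sum_congr rfl fun j _ => by ring
  rw [gdot, Finset.sum_congr rfl fun i _ => by rw [h1 i]]
  have h3 : eul (gdot u u) x = ∑ i, x i * (2 * ∑ j, pd j u x * pd i (pd j u) x) :=
    Finset.sum_congr rfl fun i _ => by rw [h2 i]
  rw [h3, gdot]
  simp only [add_mul, Finset.sum_add_distrib, Finset.mul_sum, Finset.sum_mul]
  congr 1
  rw [Finset.sum_comm]
  refine Finset.sum_congr rfl fun i _ => Finset.sum_congr rfl fun j _ => ?_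
  rw [pd_comm hu j i]
  ring

theorem lap_mul {u w : Rd d → ℝ} {x : Rd d} (hu : ContDiffAt ℝ ∞ u x)
    (hw : ContDiffAt ℝ ∞ w x) :
    lap (fun y => u y * w y) x = lap u x * w x + 2 * gdot u w x + u x * lap w x := by
  have hev : ∀ {f : Rd d → ℝ}, ContDiffAt ℝ ∞ f x → ∀ᶠ y in nhds x, DifferentiableAt ℝ f y := by
    intro f hf
    have h1 : ContDiffAt ℝ 1 f x := hf.of_le (by simp)
    filter_upwards [h1.eventually (by simp)] with y hy using hy.differentiableAt (by simp)
  have hp : ∀ {f : Rd d → ℝ}, ContDiffAt ℝ ∞ f x → ∀ i, DifferentiableAt ℝ (pd i f) x := by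
    intro f hf i
    exact ((hf.fderiv_right (m := ∞) (by simp)).clm_apply contDiffAt_const).differentiableAt
      (by simp)
  have h : ∀ i, pd i (pd i fun y => u y * w y) x =
      pd i (pd i u) x * w x + 2 * (pd i u x * pd i w x) + u x * pd i (pd i w) x := by
    intro i
    have h1 : (pd i fun y => u y * w y) =ᶠ[nhds x] fun y => pd i u y * w y + u y * pd i w y := by
      filter_upwards [hev hu, hev hw] with y h1 h2 using pd_mul h1 h2 i
    have hux := (hev hu).self_of_nhds
    have hwx := (hev hw).self_of_nhds
    rw [pd_congr h1, pd_add ((hp hu i).fun_mul hwx) (hux.fun_mul (hp hw i)), pd_mul (hp hu i) hwx,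
      pd_mul hux (hp hw i)]
    ring
  simp only [lap, h, gdot, Finset.sum_add_distrib, Finset.mul_sum, Finset.sum_mul]

theorem lap_comp {g g' : ℝ → ℝ} {g'' : ℝ} {a : Rd d → ℝ} {x : Rd d}
    (hg : ∀ᶠ t in nhds (a x), HasDerivAt g (g' t) t) (hg' : HasDerivAt g' g'' (a x))
    (ha : ContDiff ℝ ∞ a) :
    lap (fun y => g (a y)) x = g'' * gdot a a x + g' (a x) * lap a x := by
  have hda := fun y => differentiableAt_of_contDiff ha y
  have h : ∀ i, pd i (pd i fun y => g (a y)) x =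
      g'' * (pd i a x * pd i a x) + g' (a x) * pd i (pd i a) x := by
    intro i
    have h1 : (pd i fun y => g (a y)) =ᶠ[nhds x] fun y => g' (a y) * pd i a y := by
      filter_upwards [(ha.continuous.tendsto x).eventually hg] with y hy using pd_comp hy (hda y) i
    rw [pd_congr h1, pd_mul (DifferentiableAt.fun_comp' x hg'.differentiableAt (hda x))
      (differentiableAt_of_contDiff (contDiff_pd ha i) x), pd_comp hg' (hda x)]
    ring
  simp only [lap, h, gdot, Finset.sum_add_distrib, Finset.mul_sum]

theorem lap_sub {u w : Rd d → F} (hu : ContDiff ℝ ∞ u) (hw : ContDiff ℝ ∞ w) (x : Rd d) :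
    lap (fun y => u y - w y) x = lap u x - lap w x := by
  have h : ∀ i, pd i (fun y => u y - w y) = fun y => pd i u y - pd i w y := fun i =>
    funext fun y => pd_sub (differentiableAt_of_contDiff hu y)
      (differentiableAt_of_contDiff hw y) i
  simp only [lap, h, ← Finset.sum_sub_distrib]
  exact Finset.sum_congr rfl fun i _ => pd_sub
    (differentiableAt_of_contDiff (contDiff_pd hu i) x)
    (differentiableAt_of_contDiff (contDiff_pd hw i) x) i

theorem lap_clm {G : Type*} [NormedAddCommGroup G] [NormedSpace ℝ G] (l : F →L[ℝ] G)
    {u : Rd d → F} (hu : ContDiff ℝ ∞ u) (x : Rd d) :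
    lap (fun y => l (u y)) x = l (lap u x) := by
  have h : ∀ i, pd i (fun y => l (u y)) = fun y => l (pd i u y) := fun i =>
    funext fun y => pd_clm l (differentiableAt_of_contDiff hu y) i
  simp only [lap, h, map_sum]
  exact Finset.sum_congr rfl fun i _ => pd_clm l
    (differentiableAt_of_contDiff (contDiff_pd hu i) x) i

theorem pd_eq_zero_of_notMem_tsupport {u : Rd d → F} {x : Rd d} (hx : x ∉ tsupport u)
    (i : Fin d) : pd i u x = 0 := by
  rw [pd_congr (notMem_tsupport_iff_eventuallyEq.1 hx) i]
  exact pd_const 0 i x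

theorem tsupport_pd_subset (u : Rd d → F) (i : Fin d) : tsupport (pd i u) ⊆ tsupport u :=
  closure_minimal (Function.support_subset_iff'.2 fun _ hx =>
    pd_eq_zero_of_notMem_tsupport hx i) (isClosed_tsupport u)

theorem hasCompactSupport_pd {u : Rd d → F} (hu : HasCompactSupport u) (i : Fin d) :
    HasCompactSupport (pd i u) :=
  hu.mono' ((subset_tsupport _).trans (tsupport_pd_subset u i))

theorem sq_eq_norm (x : Rd d) : sq x = ‖x‖ ^ 2 := by
  rw [EuclideanSpace.real_norm_sq_eq]
  rfl

theorem sq_nonneg' (x : Rd d) : 0 ≤ sq x := Finset.sum_nonneg fun _ _ => sq_nonneg _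

end Rules

/-! ### Integration by parts -/

section Parts

variable {d : ℕ}

theorem integrable_of_vanishing {v f : Rd d → ℝ} (hv : HasCompactSupport v) (hf : Continuous f)
    (h : ∀ x ∉ tsupport v, f x = 0) : Integrable f :=
  hf.integrable_of_hasCompactSupport
    (hv.mono' (Function.support_subset_iff'.2 h))

theorem integral_pd_eq_zero {F : Type*} [NormedAddCommGroup F] [NormedSpace ℝ F]
    {b : Rd d → F} (hb : ContDiff ℝ ∞ b) (hbc : HasCompactSupport b)
    (i : Fin d) : ∫ x, pd i b x = 0 := by
  have h := integral_smul_fderiv_eq_neg_fderiv_smul_of_integrable (μ := (volume : Measure (Rd d)))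
    (f := fun _ : Rd d => (1 : ℝ)) (g := b) (v := EuclideanSpace.single i 1)
    (by simp) ?_ ?_ (fun x _ => differentiableAt_const _)
    (fun x _ => differentiableAt_of_contDiff hb x)
  · simpa [pd] using h
  · simp only [one_smul]
    exact (contDiff_pd hb i).continuous.integrable_of_hasCompactSupport
      (hasCompactSupport_pd hbc i)
  · simpa using hb.continuous.integrable_of_hasCompactSupport hbc

/-- The integral of the divergence of `a x` vanishes. -/
theorem integral_eul_add {a : Rd d → ℝ} (ha : ContDiff ℝ ∞ a) (hac : HasCompactSupport a) :
    Integrable (fun x => eul a x + d * a x) ∧ ∫ x, (eul a x + d * a x) = 0 := by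
  have hb : ∀ i, ContDiff ℝ ∞ fun x : Rd d => x i * a x := fun i => (contDiff_coord i).mul ha
  have hbc : ∀ i, HasCompactSupport fun x : Rd d => x i * a x := fun i => hac.mul_left
  have h : (fun x => eul a x + d * a x) = fun x => ∑ i, pd i (fun y : Rd d => y i * a y) x := by
    funext x
    simp only [pd_mul (differentiableAt_of_contDiff (contDiff_coord _) x)
      (differentiableAt_of_contDiff ha x), pd_coord, Finset.sum_add_distrib, eul]
    simp
    ring
  rw [h]
  have hi : ∀ i ∈ Finset.univ, Integrable (pd i fun y : Rd d => y i * a y) := fun i _ =>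
    (contDiff_pd (hb i) i).continuous.integrable_of_hasCompactSupport
      (hasCompactSupport_pd (hbc i) i)
  refine ⟨integrable_finsetSum _ hi, ?_⟩
  rw [integral_finsetSum _ hi]
  exact Finset.sum_eq_zero fun i _ => integral_pd_eq_zero (hb i) (hbc i) i

/-- Green's formula: the integral of the divergence of `a ∇v` vanishes. -/
theorem integral_mul_lap_add {a v : Rd d → ℝ} (ha : ContDiff ℝ ∞ a) (hv : ContDiff ℝ ∞ v)
    (hc : HasCompactSupport a ∨ HasCompactSupport v) :
    Integrable (fun x => a x * lap v x + gdot a v x) ∧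
      ∫ x, (a x * lap v x + gdot a v x) = 0 := by
  have hb : ∀ i, ContDiff ℝ ∞ fun x : Rd d => a x * pd i v x := fun i =>
    ha.mul (contDiff_pd hv i)
  have hbc : ∀ i, HasCompactSupport fun x : Rd d => a x * pd i v x := fun i =>
    hc.elim (fun h => h.mul_right) fun h => (hasCompactSupport_pd h i).mul_left
  have h : (fun x => a x * lap v x + gdot a v x) =
      fun x => ∑ i, pd i (fun y : Rd d => a y * pd i v y) x := by
    funext x
    simp only [pd_mul (differentiableAt_of_contDiff ha x)
      (differentiableAt_of_contDiff (contDiff_pd hv _) x), Finset.sum_add_distrib, lap, gdot,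
      Finset.mul_sum]
    ring
  rw [h]
  have hi : ∀ i ∈ Finset.univ, Integrable (pd i fun y : Rd d => a y * pd i v y) := fun i _ =>
    (contDiff_pd (hb i) i).continuous.integrable_of_hasCompactSupport
      (hasCompactSupport_pd (hbc i) i)
  refine ⟨integrable_finsetSum _ hi, ?_⟩
  rw [integral_finsetSum _ hi]
  exact Finset.sum_eq_zero fun i _ => integral_pd_eq_zero (hb i) (hbc i) i

end Parts

/-! ### The Carleman inequality -/

section Carleman

variable {d : ℕ}

/-- The radial function `β - 2 γ |x|²`: up to the shift by `1`, minus the radial logarithmic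
derivative of the weight `|x| ^ (-β - 1) exp (γ |x|²)`. -/
def radialLogDeriv (β γ : ℝ) (x : Rd d) : ℝ := β - 2 * γ * sq x

/-- The symmetric part of the operator `|x|² Δ` conjugated with the weight. -/
noncomputable def symmPart (β γ : ℝ) (v : Rd d → ℝ) (x : Rd d) : ℝ :=
  sq x * lap v x + 2 * eul v x + (radialLogDeriv β γ x ^ 2 + d - 1) * v x

/-- The antisymmetric part of the operator `|x|² Δ` conjugated with the weight. -/
noncomputable def antisymmPart (β γ : ℝ) (v : Rd d → ℝ) (x : Rd d) : ℝ :=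
  2 * radialLogDeriv β γ x * eul v x + (-4 * γ * sq x + d * radialLogDeriv β γ x) * v x

theorem contDiff_radialLogDeriv (β γ : ℝ) : ContDiff ℝ ∞ (radialLogDeriv β γ : Rd d → ℝ) :=
  contDiff_const.sub (contDiff_const.mul contDiff_sq)

theorem continuous_symmPart (β γ : ℝ) {v : Rd d → ℝ} (hv : ContDiff ℝ ∞ v) :
    Continuous (symmPart β γ v) := by
  have h1 := (contDiff_lap hv).continuous
  have h2 := (contDiff_eul hv).continuous
  have h3 := (contDiff_radialLogDeriv (d := d) β γ).continuous
  have h4 := (contDiff_sq (d := d)).continuous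
  have h5 := hv.continuous
  unfold symmPart
  fun_prop

theorem continuous_antisymmPart (β γ : ℝ) {v : Rd d → ℝ} (hv : ContDiff ℝ ∞ v) :
    Continuous (antisymmPart β γ v) := by
  have h2 := (contDiff_eul hv).continuous
  have h3 := (contDiff_radialLogDeriv (d := d) β γ).continuous
  have h4 := (contDiff_sq (d := d)).continuous
  have h5 := hv.continuous
  unfold antisymmPart
  fun_prop

/-- The commutator identity: the product of the symmetric and the antisymmetric part differs from
a positive quadratic form, with an error of lower order in the weight, by a divergence. -/
theorem integral_symmPart_mul_antisymmPart (β γ : ℝ) {v : Rd d → ℝ} (hv : ContDiff ℝ ∞ v)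
    (hvc : HasCompactSupport v) :
    ∫ x, (symmPart β γ v x * antisymmPart β γ v x -
      (8 * γ * sq x * eul v x ^ 2 + 8 * γ * sq x * radialLogDeriv β γ x ^ 2 * v x ^ 2 -
        2 * γ * (d + 2) ^ 2 * sq x * v x ^ 2)) = 0 := by
  set q : Rd d → ℝ := radialLogDeriv β γ with hq
  have hqs : ContDiff ℝ ∞ q := contDiff_radialLogDeriv β γ
  have hE : ContDiff ℝ ∞ (eul v) := contDiff_eul hv
  have hG : ContDiff ℝ ∞ (gdot v v) := contDiff_gdot hv hv
  have hs : ContDiff ℝ ∞ (sq : Rd d → ℝ) := contDiff_sq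
  let c : Rd d → ℝ := radialLogDeriv (d * β) (γ * (d + 2))
  have hc : ContDiff ℝ ∞ c := contDiff_radialLogDeriv _ _
  have hpdc : ∀ i, HasCompactSupport (pd i v) := fun i => hasCompactSupport_pd hvc i
  have hEc : HasCompactSupport (eul v) := by
    refine hvc.mono' (Function.support_subset_iff'.2 fun x hx => ?_)
    exact Finset.sum_eq_zero fun i _ => by rw [pd_eq_zero_of_notMem_tsupport hx, mul_zero]
  have hGc : HasCompactSupport (gdot v v) := by
    refine hvc.mono' (Function.support_subset_iff'.2 fun x hx => ?_)
    exact Finset.sum_eq_zero fun i _ => by rw [pd_eq_zero_of_notMem_tsupport hx, mul_zero]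
  obtain ⟨i1, t1⟩ := integral_mul_lap_add (a := fun x => q x * (sq x * eul v x))
    (hqs.mul (hs.mul hE)) hv (.inl hEc.mul_left.mul_left)
  obtain ⟨i2, t2⟩ := integral_eul_add (a := fun x => q x * (sq x * gdot v v x))
    (hqs.mul (hs.mul hG)) hGc.mul_left.mul_left
  obtain ⟨i3, t3⟩ := integral_mul_lap_add (a := fun x => c x * (sq x * v x))
    (hc.mul (hs.mul hv)) hv (.inl hvc.mul_left.mul_left)
  obtain ⟨i4, t4⟩ := integral_eul_add (a := fun x => sq x * (v x * v x))
    (hs.mul (hv.mul hv)) hvc.mul_left.mul_left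
  obtain ⟨i5, t5⟩ := integral_eul_add (a := fun x => (q x * q x + (d - 1)) * (q x * (v x * v x)))
    (((hqs.mul hqs).add contDiff_const).mul (hqs.mul (hv.mul hv))) hvc.mul_left.mul_left.mul_left
  -- the left-hand side is the divergence of a combination of the fields `q |x|² (x · ∇v) ∇v`,
  -- `q |x|² |∇v|² x`, `c |x|² v ∇v`, `|x|² v² x` and `(q² + d - 1) q v² x`
  have key : ∀ x, symmPart β γ v x * antisymmPart β γ v x -
      (8 * γ * sq x * eul v x ^ 2 + 8 * γ * sq x * q x ^ 2 * v x ^ 2 -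
        2 * γ * (d + 2) ^ 2 * sq x * v x ^ 2) =
      2 * (q x * (sq x * eul v x) * lap v x + gdot (fun x => q x * (sq x * eul v x)) v x) -
      (eul (fun x => q x * (sq x * gdot v v x)) x + d * (q x * (sq x * gdot v v x))) +
      (c x * (sq x * v x) * lap v x + gdot (fun x => c x * (sq x * v x)) v x) +
      2 * γ * (d + 2) * (eul (fun x => sq x * (v x * v x)) x + d * (sq x * (v x * v x))) +
      (eul (fun x => (q x * q x + (d - 1)) * (q x * (v x * v x))) x +
        d * ((q x * q x + (d - 1)) * (q x * (v x * v x)))) := by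
    intro x
    have dq := differentiableAt_of_contDiff hqs x
    have dE := differentiableAt_of_contDiff hE x
    have dG := differentiableAt_of_contDiff hG x
    have ds := differentiableAt_of_contDiff hs x
    have dc := differentiableAt_of_contDiff hc x
    have dv := differentiableAt_of_contDiff hv x
    have lin : ∀ b g : ℝ, HasDerivAt (fun t => b - 2 * g * t) (-(2 * g)) (sq x) := fun b g => by
      simpa using ((hasDerivAt_id (sq x)).const_mul (2 * g)).const_sub b
    have gq : gdot q v x = -4 * γ * eul v x := by
      have := gdot_comp_left (w := v) (lin β γ) ds
      rw [gdot_sq_left] at this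
      change gdot q v x = _ at this
      rw [this]; ring
    have gc : gdot c v x = -4 * (γ * (d + 2)) * eul v x := by
      have := gdot_comp_left (w := v) (lin (d * β) (γ * (d + 2))) ds
      rw [gdot_sq_left] at this
      change gdot c v x = _ at this
      rw [this]; ring
    have eq : eul q x = -4 * γ * sq x := by
      have := eul_comp (lin β γ) ds
      rw [eul_sq] at this
      change eul q x = _ at this
      rw [this]; ring
    have eqq : eul (fun x => q x * q x + (d - 1)) x = 2 * q x * (-4 * γ * sq x) := by
      have hd : HasDerivAt (fun t : ℝ => t * t + (d - 1)) (2 * q x) (q x) := by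
        have := ((hasDerivAt_id (q x)).mul (hasDerivAt_id (q x))).add_const ((d : ℝ) - 1)
        convert! this using 1
        simp; ring
      rw [eul_comp hd dq, eq]
    rw [gdot_mul_left dq (ds.fun_mul dE), gdot_mul_left ds dE, gdot_eul_left hv, gdot_sq_left,
      eul_mul dq (ds.fun_mul dG), eul_mul ds dG, eul_sq,
      gdot_mul_left dc (ds.fun_mul dv), gdot_mul_left ds dv, gdot_sq_left,
      eul_mul ds (dv.fun_mul dv), eul_mul dv dv, eul_sq,
      eul_mul ((dq.fun_mul dq).add_const _) (dq.fun_mul (dv.fun_mul dv)),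
      eul_mul dq (dv.fun_mul dv), eul_mul dv dv, eqq, gq, gc, eq]
    simp only [symmPart, antisymmPart, ← hq]
    have cx : c x = -4 * γ * sq x + d * q x := by
      simp only [c, hq, radialLogDeriv]; ring
    rw [cx]
    ring
  rw [integral_congr_ae (Filter.Eventually.of_forall key)]
  have comb : ∀ (r : ℝ) (f₁ f₂ f₃ f₄ f₅ : Rd d → ℝ), Integrable f₁ → Integrable f₂ →
      Integrable f₃ → Integrable f₄ → Integrable f₅ → ∫ x, f₁ x = 0 → ∫ x, f₂ x = 0 →
      ∫ x, f₃ x = 0 → ∫ x, f₄ x = 0 → ∫ x, f₅ x = 0 →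
      ∫ x, (2 * f₁ x - f₂ x + f₃ x + r * f₄ x + f₅ x) = 0 := by
    intro r f₁ f₂ f₃ f₄ f₅ i1 i2 i3 i4 i5 t1 t2 t3 t4 t5
    have j12 : Integrable fun x => 2 * f₁ x - f₂ x := (i1.const_mul 2).sub i2
    have j123 : Integrable fun x => 2 * f₁ x - f₂ x + f₃ x := j12.add i3
    have j1234 : Integrable fun x => 2 * f₁ x - f₂ x + f₃ x + r * f₄ x :=
      j123.add (i4.const_mul r)
    rw [integral_add j1234 i5, integral_add j123 (i4.const_mul r), integral_add j12 i3,
      integral_sub (i1.const_mul 2) i2, integral_const_mul, integral_const_mul, t1, t2, t3, t4, t5]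
    simp
  exact comb _ _ _ _ _ _ i1 i2 i3 i4 i5 t1 t2 t3 t4 t5

/-- The Carleman inequality for the conjugated operator, from `(S + A)² ≥ 4 S A` for its symmetric
part `S` and its antisymmetric part `A`. The hypothesis on the support makes half of the positive
term of order zero in the commutator dominate the error term. -/
theorem carleman_conjugated (β : ℝ) {γ : ℝ} (hγ : 0 ≤ γ) {v : Rd d → ℝ} (hv : ContDiff ℝ ∞ v)
    (hvc : HasCompactSupport v)
    (hq : ∀ x, v x ≠ 0 → ((d : ℝ) + 2) ^ 2 ≤ 2 * radialLogDeriv β γ x ^ 2) :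
    16 * γ * ∫ x, sq x * radialLogDeriv β γ x ^ 2 * v x ^ 2 ≤
      ∫ x, (symmPart β γ v x + antisymmPart β γ v x) ^ 2 := by
  have h1 := (contDiff_lap hv).continuous
  have h2 := (contDiff_eul hv).continuous
  have h3 := (contDiff_radialLogDeriv (d := d) β γ).continuous
  have h4 := (contDiff_sq (d := d)).continuous
  have h5 := hv.continuous
  have hS := continuous_symmPart β γ hv
  have hA := continuous_antisymmPart β γ hv
  have v0 : ∀ x ∉ tsupport v, v x = 0 := fun x hx => image_eq_zero_of_notMem_tsupport hx
  have E0 : ∀ x ∉ tsupport v, eul v x = 0 := fun x hx =>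
    Finset.sum_eq_zero fun i _ => by rw [pd_eq_zero_of_notMem_tsupport hx, mul_zero]
  have L0 : ∀ x ∉ tsupport v, lap v x = 0 := fun x hx => Finset.sum_eq_zero fun i _ =>
    pd_eq_zero_of_notMem_tsupport (fun h => hx (tsupport_pd_subset v i h)) i
  have A0 : ∀ x ∉ tsupport v, antisymmPart β γ v x = 0 := fun x hx => by
    simp [antisymmPart, v0 x hx, E0 x hx]
  have S0 : ∀ x ∉ tsupport v, symmPart β γ v x = 0 := fun x hx => by
    simp [symmPart, v0 x hx, E0 x hx, L0 x hx]
  have iL : Integrable fun x => sq x * radialLogDeriv β γ x ^ 2 * v x ^ 2 :=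
    integrable_of_vanishing hvc (by fun_prop) fun x hx => by simp [v0 x hx]
  have iR : Integrable fun x => (symmPart β γ v x + antisymmPart β γ v x) ^ 2 :=
    integrable_of_vanishing hvc (by fun_prop) fun x hx => by simp [S0 x hx, A0 x hx]
  have iD : Integrable fun x => symmPart β γ v x * antisymmPart β γ v x -
      (8 * γ * sq x * eul v x ^ 2 + 8 * γ * sq x * radialLogDeriv β γ x ^ 2 * v x ^ 2 -
        2 * γ * (d + 2) ^ 2 * sq x * v x ^ 2) :=
    integrable_of_vanishing hvc (by fun_prop) fun x hx => by simp [S0 x hx, v0 x hx, E0 x hx]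
  have h0 := integral_symmPart_mul_antisymmPart β γ hv hvc
  rw [← integral_const_mul]
  have : ∫ x, (16 * γ * (sq x * radialLogDeriv β γ x ^ 2 * v x ^ 2) +
      4 * (symmPart β γ v x * antisymmPart β γ v x -
      (8 * γ * sq x * eul v x ^ 2 + 8 * γ * sq x * radialLogDeriv β γ x ^ 2 * v x ^ 2 -
        2 * γ * (d + 2) ^ 2 * sq x * v x ^ 2))) ≤
      ∫ x, (symmPart β γ v x + antisymmPart β γ v x) ^ 2 := by
    refine integral_mono ((iL.const_mul _).add (iD.const_mul _)) iR fun x => ?_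
    have hs := sq_nonneg' x
    have e1 : 0 ≤ γ * sq x * eul v x ^ 2 := by positivity
    have e2 : 0 ≤ γ * sq x * v x ^ 2 * (2 * radialLogDeriv β γ x ^ 2 - ((d : ℝ) + 2) ^ 2) := by
      by_cases hx : v x = 0
      · simp [hx]
      · exact mul_nonneg (by positivity) (sub_nonneg.2 (hq x hx))
    have e3 := sq_nonneg (symmPart β γ v x - antisymmPart β γ v x)
    dsimp only
    nlinarith
  rwa [integral_add (iL.const_mul _) (iD.const_mul _), integral_const_mul 4, h0, mul_zero,
    add_zero] at this

/-- The Carleman weight `|x| ^ (-2 N) exp (γ |x|²)`, as a function of `t = |x|²`. -/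
noncomputable def weight (N : ℕ) (γ t : ℝ) : ℝ := (t ^ N)⁻¹ * Real.exp (γ * t)

theorem hasDerivAt_weight (N : ℕ) (γ : ℝ) {t : ℝ} (ht : t ≠ 0) :
    HasDerivAt (weight N γ) ((γ - N / t) * weight N γ t) t := by
  have h1 : HasDerivAt (fun t : ℝ => (t ^ N)⁻¹) (-(N * t ^ (N - 1)) / (t ^ N) ^ 2) t :=
    (hasDerivAt_pow N t).inv (pow_ne_zero _ ht)
  have h2 : HasDerivAt (fun t : ℝ => Real.exp (γ * t)) (Real.exp (γ * t) * γ) t := by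
    simpa using ((hasDerivAt_id t).const_mul γ).exp
  convert! h1.mul h2 using 1
  rw [weight]
  rcases Nat.eq_zero_or_pos N with rfl | hN
  · simp; ring
  · obtain ⟨M, rfl⟩ : ∃ M, N = M + 1 := ⟨N - 1, by omega⟩
    simp only [Nat.add_sub_cancel]
    field_simp
    ring

/-- Conjugation of `|x|² Δ` with the weight. -/
theorem symmPart_add_antisymmPart_weight (N : ℕ) (γ : ℝ) {f : Rd d → ℝ} (hf : ContDiff ℝ ∞ f)
    {x : Rd d} (hx : sq x ≠ 0) :
    symmPart (2 * N - 1) γ (fun y => weight N γ (sq y) * f y) x +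
      antisymmPart (2 * N - 1) γ (fun y => weight N γ (sq y) * f y) x =
      weight N γ (sq x) * sq x * lap f x := by
  have hs : ContDiff ℝ ∞ (sq : Rd d → ℝ) := contDiff_sq
  have ds := differentiableAt_of_contDiff hs x
  have df := differentiableAt_of_contDiff hf x
  have hw1 := hasDerivAt_weight N γ hx
  have hw1' : ∀ᶠ t in nhds (sq x), HasDerivAt (weight N γ) ((γ - N / t) * weight N γ t) t := by
    filter_upwards [isOpen_ne.mem_nhds hx] with t ht using hasDerivAt_weight N γ ht
  have hw2 : HasDerivAt (fun t => (γ - N / t) * weight N γ t)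
      ((N / sq x ^ 2 + (γ - N / sq x) ^ 2) * weight N γ (sq x)) (sq x) := by
    have h1 : HasDerivAt (fun t : ℝ => γ - N / t) (N / sq x ^ 2) (sq x) := by
      have := (((hasDerivAt_inv hx).const_mul (N : ℝ)).const_sub γ)
      convert! this using 1
      field_simp
    convert! h1.mul hw1 using 1
    ring
  have hwc : ContDiffAt ℝ ∞ (fun y : Rd d => weight N γ (sq y)) x := by
    unfold weight
    exact ((hs.contDiffAt.pow N).inv (pow_ne_zero _ hx)).mul
      (contDiffAt_const.mul hs.contDiffAt).exp
  have hwd : DifferentiableAt ℝ (fun y : Rd d => weight N γ (sq y)) x :=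
    hwc.differentiableAt (by simp)
  have g1 : gdot (fun y => weight N γ (sq y)) f x =
      (γ - N / sq x) * weight N γ (sq x) * (2 * eul f x) := by
    rw [gdot_comp_left hw1 ds, gdot_sq_left]
  have l1 : lap (fun y : Rd d => weight N γ (sq y)) x =
      ((N / sq x ^ 2 + (γ - N / sq x) ^ 2) * weight N γ (sq x)) * (4 * sq x) +
        (γ - N / sq x) * weight N γ (sq x) * (2 * d) := by
    rw [lap_comp hw1' hw2 hs, gdot_sq_left, eul_sq, lap_sq]
    ring
  have e1 : eul (fun y : Rd d => weight N γ (sq y)) x =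
      (γ - N / sq x) * weight N γ (sq x) * (2 * sq x) := by
    rw [eul_comp hw1 ds, eul_sq]
  simp only [symmPart, antisymmPart, radialLogDeriv]
  rw [lap_mul hwc hf.contDiffAt, eul_mul hwd df, g1, l1, e1]
  field_simp
  ring

end Carleman

section CarlemanWeight

variable {d : ℕ}

theorem isOpen_sq_lt (r : ℝ) : IsOpen {x : Rd d | sq x < r} :=
  isOpen_lt contDiff_sq.continuous continuous_const

theorem isCompact_sq_le (r : ℝ) : IsCompact {x : Rd d | sq x ≤ r} := by
  refine Metric.isCompact_of_isClosed_isBounded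
    (isClosed_le contDiff_sq.continuous continuous_const)
    ((Metric.isBounded_closedBall (x := (0 : Rd d)) (r := Real.sqrt r)).subset fun x hx => ?_)
  rw [Set.mem_ofPred_eq, sq_eq_norm] at hx
  simpa using Real.le_sqrt_of_sq_le hx

theorem hasCompactSupport_of_sq_le {F : Type*} [Zero F] {f : Rd d → F} {r : ℝ}
    (h : ∀ x, r < sq x → f x = 0) : HasCompactSupport f :=
  HasCompactSupport.intro (isCompact_sq_le r) fun x hx => h x (not_le.1 hx)

/-- **Carleman inequality** with the weight `|x| ^ (-2 N) exp (γ |x|²)`, for functions that vanish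
near the origin and are supported where the radial logarithmic derivative of the weight is
large. -/
theorem carleman (N : ℕ) {γ : ℝ} (hγ : 0 ≤ γ) {f : Rd d → ℝ} (hf : ContDiff ℝ ∞ f)
    (hfc : HasCompactSupport f) {r : ℝ} (hr : 0 < r) (hf0 : ∀ x, sq x < r → f x = 0)
    (hq : ∀ x, f x ≠ 0 → ((d : ℝ) + 2) ^ 2 ≤ 2 * radialLogDeriv (2 * N - 1) γ x ^ 2) :
    16 * γ * ∫ x, sq x * radialLogDeriv (2 * N - 1) γ x ^ 2 * (weight N γ (sq x) * f x) ^ 2 ≤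
      ∫ x, (weight N γ (sq x) * sq x * lap f x) ^ 2 := by
  have hs : ContDiff ℝ ∞ (sq : Rd d → ℝ) := contDiff_sq
  have hnear : ∀ x : Rd d, sq x < r → (fun y => weight N γ (sq y) * f y) =ᶠ[nhds x] fun _ => 0 := by
    intro x hx
    filter_upwards [(isOpen_sq_lt r).mem_nhds hx] with y hy
    rw [hf0 y hy, mul_zero]
  have hv : ContDiff ℝ ∞ fun y => weight N γ (sq y) * f y := by
    rw [contDiff_iff_contDiffAt]
    intro x
    by_cases hx : sq x < r
    · exact contDiffAt_const.congr_of_eventuallyEq (hnear x hx)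
    · have hx0 : sq x ≠ 0 := (hr.trans_le (not_lt.1 hx)).ne'
      unfold weight
      exact (((hs.contDiffAt.pow N).inv (pow_ne_zero _ hx0)).mul
        (contDiffAt_const.mul hs.contDiffAt).exp).mul hf.contDiffAt
  refine (carleman_conjugated (2 * N - 1) hγ hv hfc.mul_left fun x hx =>
    hq x (right_ne_zero_of_mul hx)).trans (le_of_eq ?_)
  refine integral_congr_ae (Filter.Eventually.of_forall fun x => ?_)
  dsimp only
  by_cases hx : sq x = 0
  · have hxr : sq x < r := hx ▸ hr
    have h0 := hnear x hxr
    have hp : ∀ i, pd i (fun y => weight N γ (sq y) * f y) x = 0 := fun i => by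
      rw [pd_congr h0, pd_const]
    have h1 : weight N γ (sq x) * f x = 0 := h0.self_of_nhds
    rw [hx] at h1
    simp only [symmPart, antisymmPart, eul, hp, hx, h1]
    simp
  · rw [symmPart_add_antisymmPart_weight N γ hf hx]

end CarlemanWeight

/-! ### Cutoff functions -/

section Cutoff

variable {d : ℕ}

/-- A bound on the first two derivatives of `Real.smoothTransition`. -/
theorem exists_bound_deriv_smoothTransition : ∃ B : ℝ, 0 < B ∧
    (∀ t, |deriv Real.smoothTransition t| ≤ B) ∧
    ∀ t, |deriv (deriv Real.smoothTransition) t| ≤ B := by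
  have h0 : ∀ t ∉ Icc (0 : ℝ) 1, deriv Real.smoothTransition =ᶠ[nhds t] 0 := by
    intro t ht
    rcases lt_or_ge t 0 with h | h
    · filter_upwards [isOpen_Iio.mem_nhds h] with s hs
      have : Real.smoothTransition =ᶠ[nhds s] fun _ => 0 := by
        filter_upwards [isOpen_Iio.mem_nhds hs] with y hy
          using Real.smoothTransition.zero_of_nonpos (le_of_lt hy)
      rw [this.deriv_eq]; simp
    · have h1 : 1 < t := by
        by_contra h2
        exact ht ⟨h, not_lt.1 h2⟩
      filter_upwards [isOpen_Ioi.mem_nhds h1] with s hs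
      have : Real.smoothTransition =ᶠ[nhds s] fun _ => 1 := by
        filter_upwards [isOpen_Ioi.mem_nhds hs] with y hy
          using Real.smoothTransition.one_of_one_le (le_of_lt hy)
      rw [this.deriv_eq]; simp
  have hc : ContDiff ℝ 2 Real.smoothTransition := Real.smoothTransition.contDiff
  have hc1 : ContDiff ℝ 1 (deriv Real.smoothTransition) := by
    have : ContDiff ℝ (1 + 1) Real.smoothTransition := hc.of_le (by norm_num)
    exact this.deriv'
  obtain ⟨B1, hB1⟩ := (HasCompactSupport.intro isCompact_Icc fun t ht =>
    (h0 t ht).self_of_nhds).exists_bound_of_continuous hc1.continuous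
  obtain ⟨B2, hB2⟩ := (HasCompactSupport.intro isCompact_Icc fun t ht => by
    rw [(h0 t ht).deriv_eq]; simp).exists_bound_of_continuous
      (f := deriv (deriv Real.smoothTransition)) (hc1.continuous_deriv (by simp))
  refine ⟨max (max B1 B2) 1, by positivity, fun t => ?_, fun t => ?_⟩
  · exact (hB1 t).trans ((le_max_left _ _).trans (le_max_left _ _))
  · exact (hB2 t).trans ((le_max_right _ _).trans (le_max_left _ _))

/-- The radial cutoff: `0` where `|x|² ≤ c l`, and `1` where `(c + 1) l ≤ |x|²`. -/
noncomputable def cut (c l : ℝ) (x : Rd d) : ℝ := Real.smoothTransition (sq x / l - c)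

theorem contDiff_cut (c l : ℝ) : ContDiff ℝ ∞ (cut c l : Rd d → ℝ) :=
  Real.smoothTransition.contDiff.comp ((contDiff_sq.div_const l).sub contDiff_const)

theorem cut_eq_zero {c l : ℝ} (hl : 0 < l) {x : Rd d} (h : sq x ≤ c * l) : cut c l x = 0 :=
  Real.smoothTransition.zero_of_nonpos (by rw [sub_nonpos, div_le_iff₀ hl]; exact h)

theorem cut_eq_one {c l : ℝ} (hl : 0 < l) {x : Rd d} (h : (c + 1) * l ≤ sq x) : cut c l x = 1 :=
  Real.smoothTransition.one_of_one_le (by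
    rw [le_sub_iff_add_le, le_div_iff₀ hl]; linarith)

theorem cut_nonneg (c l : ℝ) (x : Rd d) : 0 ≤ cut c l x := Real.smoothTransition.nonneg _

theorem cut_le_one (c l : ℝ) (x : Rd d) : cut c l x ≤ 1 := Real.smoothTransition.le_one _

theorem cut_eventuallyEq_const {c l : ℝ} (hl : 0 < l) {x : Rd d}
    (h : sq x < c * l ∨ (c + 1) * l < sq x) : ∃ k : ℝ, cut c l =ᶠ[nhds x] fun _ => k := by
  rcases h with h | h
  · exact ⟨0, (isOpen_sq_lt _).mem_nhds h |> Filter.mem_of_superset <| fun y hy =>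
      cut_eq_zero hl (le_of_lt hy)⟩
  · exact ⟨1, (isOpen_lt continuous_const contDiff_sq.continuous).mem_nhds h |>
      Filter.mem_of_superset <| fun y hy => cut_eq_one hl (le_of_lt hy)⟩

theorem lap_cut_eq_zero {c l : ℝ} (hl : 0 < l) {x : Rd d}
    (h : sq x < c * l ∨ (c + 1) * l < sq x) : lap (cut c l) x = 0 := by
  obtain ⟨k, hk⟩ := cut_eventuallyEq_const hl h
  rw [lap_congr hk]
  refine Finset.sum_eq_zero fun i _ => ?_
  rw [pd_congr (Filter.Eventually.of_forall fun y => pd_const k i y), pd_const]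

theorem gdot_cut_eq_zero {c l : ℝ} (hl : 0 < l) {x : Rd d}
    (h : sq x < c * l ∨ (c + 1) * l < sq x) (u : Rd d → ℝ) : gdot (cut c l) u x = 0 := by
  obtain ⟨k, hk⟩ := cut_eventuallyEq_const hl h
  exact Finset.sum_eq_zero fun i _ => by rw [pd_congr hk, pd_const, zero_mul]

/-- The gradient and the Laplacian of a radial cutoff are controlled by its scale. -/
theorem exists_bound_cut (d : ℕ) (c : ℝ) (hc : 0 ≤ c) : ∃ C : ℝ, 0 < C ∧ ∀ l : ℝ, 0 < l →
    ∀ x : Rd d, gdot (cut c l) (cut c l) x ≤ C / l ∧ |lap (cut c l) x| ≤ C / l := by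
  obtain ⟨B, hB, hB1, hB2⟩ := exists_bound_deriv_smoothTransition
  refine ⟨B ^ 2 * (4 * (c + 1)) + (B * (4 * (c + 1)) + B * (2 * d)), by positivity,
    fun l hl x => ?_⟩
  have hpos : 0 < B ^ 2 * (4 * (c + 1)) := by positivity
  have hpos' : 0 ≤ B * (4 * (c + 1)) + B * (2 * d) := by positivity
  by_cases h : sq x < c * l ∨ (c + 1) * l < sq x
  · rw [gdot_cut_eq_zero hl h, lap_cut_eq_zero hl h, abs_zero]
    constructor <;> positivity
  push Not at h
  have hs := sq_nonneg' x
  have hsl : sq x / l ≤ c + 1 := by rw [div_le_iff₀ hl]; exact h.2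
  have hsl0 : 0 ≤ sq x / l := by positivity
  let g : ℝ → ℝ := fun t => Real.smoothTransition (t / l - c)
  let g' : ℝ → ℝ := fun t => deriv Real.smoothTransition (t / l - c) / l
  have hc2 : ContDiff ℝ 2 Real.smoothTransition := Real.smoothTransition.contDiff
  have hc1 : ContDiff ℝ 1 (deriv Real.smoothTransition) := by
    have : ContDiff ℝ (1 + 1) Real.smoothTransition := hc2.of_le (by norm_num)
    exact this.deriv'
  have hlin : ∀ t, HasDerivAt (fun t : ℝ => t / l - c) (1 / l) t := fun t =>
    ((hasDerivAt_id t).div_const l).sub_const c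
  have hg : ∀ t, HasDerivAt g (g' t) t := by
    intro t
    have := ((hc2.differentiable (by simp)) (t / l - c)).hasDerivAt.comp t (hlin t)
    convert! this using 1
    simp only [g']; ring
  have hg' : ∀ t, HasDerivAt g' (deriv (deriv Real.smoothTransition) (t / l - c) / l ^ 2) t := by
    intro t
    have := (((hc1.differentiable (by simp)) (t / l - c)).hasDerivAt.comp t (hlin t)).div_const l
    convert! this using 1
    field_simp
  have hsq : ContDiff ℝ ∞ (sq : Rd d → ℝ) := contDiff_sq
  have ds := differentiableAt_of_contDiff hsq x
  have e1 : gdot (cut c l) (cut c l) x = g' (sq x) ^ 2 * (4 * sq x) := by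
    have h1 : gdot (cut c l) (cut c l) x = g' (sq x) * gdot sq (cut c l) x :=
      gdot_comp_left (hg (sq x)) ds
    have h2 : eul (cut c l) x = g' (sq x) * eul sq x := eul_comp (hg (sq x)) ds
    rw [h1, gdot_sq_left, h2, eul_sq]; ring
  have e2 : lap (cut c l) x = deriv (deriv Real.smoothTransition) (sq x / l - c) / l ^ 2 *
      (4 * sq x) + g' (sq x) * (2 * d) := by
    have h1 : lap (cut c l) x = _ := lap_comp (g := g) (x := x) (Filter.Eventually.of_forall hg)
      (hg' (sq x)) hsq
    rw [h1, gdot_sq_left, eul_sq, lap_sq]; ring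
  set D1 := deriv Real.smoothTransition (sq x / l - c) with hD1
  set D2 := deriv (deriv Real.smoothTransition) (sq x / l - c) with hD2
  have b1 : |D1| ≤ B := hB1 _
  have b2 : |D2| ≤ B := hB2 _
  constructor
  · have : g' (sq x) ^ 2 * (4 * sq x) = D1 ^ 2 * (4 * (sq x / l)) / l := by
      simp only [g']; rw [← hD1]; field_simp
    rw [e1, this, div_le_div_iff_of_pos_right hl]
    have h1 : D1 ^ 2 ≤ B ^ 2 := sq_le_sq' (abs_le.1 b1).1 (abs_le.1 b1).2
    have h2 : D1 ^ 2 * (4 * (sq x / l)) ≤ B ^ 2 * (4 * (c + 1)) :=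
      mul_le_mul h1 (by linarith) (by positivity) (by positivity)
    linarith
  · have : D2 / l ^ 2 * (4 * sq x) + g' (sq x) * (2 * d) =
        (D2 * (4 * (sq x / l)) + D1 * (2 * d)) / l := by
      simp only [g']; rw [← hD1]; field_simp
    rw [e2, this, abs_div, abs_of_pos hl, div_le_div_iff_of_pos_right hl]
    have h1 : |D2 * (4 * (sq x / l))| ≤ B * (4 * (c + 1)) := by
      rw [abs_mul, abs_of_nonneg (by positivity : 0 ≤ 4 * (sq x / l))]
      exact mul_le_mul b2 (by linarith) (by positivity) hB.le
    have h2 : |D1 * (2 * d)| ≤ B * (2 * d) := by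
      rw [abs_mul, abs_of_nonneg (by positivity : (0 : ℝ) ≤ 2 * d)]
      exact mul_le_mul_of_nonneg_right b1 (by positivity)
    linarith [abs_add_le (D2 * (4 * (sq x / l))) (D1 * (2 * d))]

theorem integrableOn_sq_lt {f : Rd d → ℝ} (hf : Continuous f) (r : ℝ) :
    IntegrableOn f {x : Rd d | sq x < r} :=
  (hf.continuousOn.integrableOn_compact (isCompact_sq_le r)).mono_set
    fun x (hx : sq x < r) => show sq x ≤ r from hx.le

/-- The commutator of the Laplacian with a cutoff, applied to `u`. -/
noncomputable def comm (η u : Rd d → ℝ) (x : Rd d) : ℝ := 2 * gdot η u x + lap η x * u x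

theorem gdot_comm (u w : Rd d → ℝ) (x : Rd d) : gdot u w x = gdot w u x :=
  Finset.sum_congr rfl fun _ _ => mul_comm _ _

theorem gdot_self_nonneg (u : Rd d → ℝ) (x : Rd d) : 0 ≤ gdot u u x :=
  Finset.sum_nonneg fun _ _ => mul_self_nonneg _

theorem gdot_sq_le (u w : Rd d → ℝ) (x : Rd d) :
    gdot u w x ^ 2 ≤ gdot u u x * gdot w w x := by
  have := Finset.sum_mul_sq_le_sq_mul_sq Finset.univ (fun i => pd i u x) fun i => pd i w x
  simpa only [gdot, pow_two] using this

theorem continuous_comm {η u : Rd d → ℝ} (hη : ContDiff ℝ ∞ η) (hu : ContDiff ℝ ∞ u) :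
    Continuous (comm η u) := by
  have h1 := (contDiff_gdot hη hu).continuous
  have h2 := (contDiff_lap hη).continuous
  have h3 := hu.continuous
  unfold comm
  fun_prop

theorem comm_cut_eq_zero {c l : ℝ} (hl : 0 < l) {x : Rd d}
    (h : sq x < c * l ∨ (c + 1) * l < sq x) (u : Rd d → ℝ) : comm (cut c l) u x = 0 := by
  rw [comm, gdot_cut_eq_zero hl h, lap_cut_eq_zero hl h]; ring

/-- The interior (Caccioppoli) estimate, for a compactly supported cutoff `χ`. -/
theorem integral_mul_gdot_self {χ u : Rd d → ℝ} (hχ : ContDiff ℝ ∞ χ) (hχc : HasCompactSupport χ)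
    (hu : ContDiff ℝ ∞ u) :
    ∫ x, χ x * gdot u u x = ∫ x, (1 / 2 * (u x ^ 2 * lap χ x) - χ x * u x * lap u x) := by
  obtain ⟨i1, t1⟩ := integral_mul_lap_add (hχ.mul hu) hu (.inl hχc.mul_right)
  obtain ⟨i2, t2⟩ := integral_mul_lap_add (hu.mul hu) hχ (.inr hχc)
  have dχ := differentiableAt_of_contDiff hχ
  have du := differentiableAt_of_contDiff hu
  have cu := hu.continuous
  have cχ := hχ.continuous
  have clu := (contDiff_lap hu).continuous
  have clχ := (contDiff_lap hχ).continuous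
  have cg := (contDiff_gdot hu hu).continuous
  have χ0 : ∀ x ∉ tsupport χ, χ x = 0 := fun x hx => image_eq_zero_of_notMem_tsupport hx
  have L0 : ∀ x ∉ tsupport χ, lap χ x = 0 := fun x hx => Finset.sum_eq_zero fun i _ =>
    pd_eq_zero_of_notMem_tsupport (fun h => hx (tsupport_pd_subset χ i h)) i
  have j1 : Integrable fun x => χ x * gdot u u x :=
    integrable_of_vanishing hχc (by fun_prop) fun x hx => by simp [χ0 x hx]
  have j2 : Integrable fun x => 1 / 2 * (u x ^ 2 * lap χ x) - χ x * u x * lap u x :=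
    integrable_of_vanishing hχc (by fun_prop) fun x hx => by simp [χ0 x hx, L0 x hx]
  rw [← sub_eq_zero, ← integral_sub j1 j2]
  have : ∀ x, χ x * gdot u u x - (1 / 2 * (u x ^ 2 * lap χ x) - χ x * u x * lap u x) =
      (χ x * u x * lap u x + gdot (fun x => χ x * u x) u x) -
      1 / 2 * (u x * u x * lap χ x + gdot (fun x => u x * u x) χ x) := by
    intro x
    rw [gdot_mul_left (dχ x) (du x), gdot_mul_left (du x) (du x), gdot_comm χ u]
    ring
  rw [integral_congr_ae (Filter.Eventually.of_forall this), integral_sub i1 (i2.const_mul _),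
    integral_const_mul, t1, t2]
  simp

/-- The commutator with a radial cutoff of scale `l` is bounded by `u` and its Laplacian in a
ball. -/
theorem exists_bound_comm_cut (d : ℕ) : ∃ C : ℝ, 0 < C ∧ ∀ l : ℝ, 0 < l →
    ∀ u : Rd d → ℝ, ContDiff ℝ ∞ u →
    ∫ x, comm (cut 1 l) u x ^ 2 ≤ C * (l⁻¹ ^ 2 * (∫ x in {x | sq x < 4 * l}, u x ^ 2) +
      ∫ x in {x | sq x < 4 * l}, lap u x ^ 2) := by
  obtain ⟨C1, hC1, hb1⟩ := exists_bound_cut d 1 zero_le_one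
  obtain ⟨C2, hC2, hb2⟩ := exists_bound_cut d 2 zero_le_two
  refine ⟨8 * C1 * (C2 + 1) + 2 * C1 ^ 2, by positivity, fun l hl u hu => ?_⟩
  let D : Set (Rd d) := {x | sq x < 4 * l}
  have hD : MeasurableSet D := (isOpen_sq_lt _).measurableSet
  let χ : Rd d → ℝ := fun x => 1 - cut 2 l x
  have hχ : ContDiff ℝ ∞ χ := contDiff_const.sub (contDiff_cut 2 l)
  have χ0 : ∀ x, 3 * l < sq x → χ x = 0 := fun x hx => by
    simp only [χ]; rw [cut_eq_one hl (by linarith), sub_self]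
  have hχc : HasCompactSupport χ := hasCompactSupport_of_sq_le χ0
  have hlχ : ∀ x, lap χ x = -lap (cut 2 l) x := fun x => by
    have h1 : lap χ x = lap (fun _ => (1 : ℝ)) x - lap (cut 2 l) x :=
      lap_sub contDiff_const (contDiff_cut 2 l) x
    have h2 : lap (fun _ : Rd d => (1 : ℝ)) x = 0 := Finset.sum_eq_zero fun i _ => by
      rw [pd_congr (Filter.Eventually.of_forall fun y => pd_const 1 i y), pd_const]
    rw [h1, h2, zero_sub]
  have cu := hu.continuous
  have cχ := hχ.continuous
  have clu := (contDiff_lap hu).continuous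
  have clχ := (contDiff_lap hχ).continuous
  have cg := (contDiff_gdot hu hu).continuous
  have cc := continuous_comm (contDiff_cut 1 l) hu
  have hcc : HasCompactSupport fun x => comm (cut 1 l) u x ^ 2 :=
    hasCompactSupport_of_sq_le (r := 2 * l) fun x hx => by
      rw [comm_cut_eq_zero hl (.inr (by linarith))]; simp
  have hLHS : Integrable fun x => comm (cut 1 l) u x ^ 2 :=
    (cc.pow 2).integrable_of_hasCompactSupport hcc
  have i1 : Integrable fun x => χ x * gdot u u x :=
    (cχ.mul cg).integrable_of_hasCompactSupport hχc.mul_right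
  have i2 : Integrable (D.indicator fun x => u x ^ 2) :=
    (integrable_indicator_iff hD).2 (integrableOn_sq_lt (cu.pow 2) _)
  have i3 : Integrable (D.indicator fun x => lap u x ^ 2) :=
    (integrable_indicator_iff hD).2 (integrableOn_sq_lt (clu.pow 2) _)
  have i4 : Integrable fun x => 1 / 2 * (u x ^ 2 * lap χ x) - χ x * u x * lap u x := by
    refine Continuous.integrable_of_hasCompactSupport (by fun_prop)
      (hasCompactSupport_of_sq_le (r := 3 * l) fun x hx => ?_)
    rw [χ0 x hx, hlχ, lap_cut_eq_zero hl (.inr (by linarith))]; simp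
  have key1 : ∫ x, comm (cut 1 l) u x ^ 2 ≤ ∫ x, (8 * (C1 / l) * (χ x * gdot u u x) +
      2 * (C1 / l) ^ 2 * D.indicator (fun x => u x ^ 2) x) := by
    refine integral_mono hLHS ((i1.const_mul _).add (i2.const_mul _)) fun x => ?_
    dsimp only
    have hg := gdot_self_nonneg u x
    have hind : 0 ≤ D.indicator (fun x => u x ^ 2) x := indicator_nonneg (fun _ _ => sq_nonneg _) x
    have hχx : 0 ≤ χ x := sub_nonneg.2 (cut_le_one _ _ _)
    by_cases hx : 2 * l < sq x
    · rw [comm_cut_eq_zero hl (.inr (by linarith)), zero_pow two_ne_zero]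
      exact add_nonneg (mul_nonneg (by positivity) (mul_nonneg hχx hg))
        (mul_nonneg (by positivity) hind)
    · have hx' : sq x ≤ 2 * l := not_lt.1 hx
      have h1 : χ x = 1 := by simp only [χ]; rw [cut_eq_zero hl hx', sub_zero]
      have h2 : D.indicator (fun x => u x ^ 2) x = u x ^ 2 :=
        indicator_of_mem (show x ∈ D from (show sq x < 4 * l by linarith)) _
      rw [h1, h2, comm]
      obtain ⟨h3, h4⟩ := hb1 l hl x
      have h5 := gdot_sq_le (cut 1 l) u x
      have h6 : lap (cut 1 l) x ^ 2 ≤ (C1 / l) ^ 2 :=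
        sq_le_sq' (abs_le.1 h4).1 (abs_le.1 h4).2
      have h7 := mul_le_mul_of_nonneg_right h6 (sq_nonneg (u x))
      have h8 := mul_le_mul_of_nonneg_right h3 hg
      nlinarith [sq_nonneg (2 * gdot (cut 1 l) u x - lap (cut 1 l) x * u x)]
  have key2 : ∫ x, χ x * gdot u u x ≤ ∫ x, ((C2 + 1) / l * D.indicator (fun x => u x ^ 2) x +
      l * D.indicator (fun x => lap u x ^ 2) x) := by
    rw [integral_mul_gdot_self hχ hχc hu]
    refine integral_mono i4 ((i2.const_mul _).add (i3.const_mul _)) fun x => ?_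
    dsimp only
    have hind : 0 ≤ D.indicator (fun x => u x ^ 2) x := indicator_nonneg (fun _ _ => sq_nonneg _) x
    have hind' : 0 ≤ D.indicator (fun x => lap u x ^ 2) x :=
      indicator_nonneg (fun _ _ => sq_nonneg _) x
    by_cases hx : 3 * l < sq x
    · rw [χ0 x hx, hlχ, lap_cut_eq_zero hl (.inr (by linarith))]
      have : 0 ≤ (C2 + 1) / l := by positivity
      simp only [neg_zero, mul_zero, zero_mul, sub_zero]
      positivity
    · have hxD : x ∈ D := show sq x < 4 * l by linarith
      rw [indicator_of_mem hxD, indicator_of_mem hxD, hlχ]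
      obtain ⟨-, h4⟩ := hb2 l hl x
      have h5 : -lap (cut 2 l) x ≤ C2 / l := (neg_le_abs _).trans h4
      have h6 := mul_le_mul_of_nonneg_left h5 (sq_nonneg (u x))
      have hχx : 0 ≤ χ x := sub_nonneg.2 (cut_le_one _ _ _)
      have hχ1 : χ x ≤ 1 := sub_le_self _ (cut_nonneg _ _ _)
      have h7 : -(u x * lap u x) ≤ 1 / 2 * (u x ^ 2 / l + l * lap u x ^ 2) := by
        have : u x ^ 2 / l + l * lap u x ^ 2 + 2 * (u x * lap u x) =
            (u x + l * lap u x) ^ 2 / l := by field_simp; ring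
        have h8 : 0 ≤ (u x + l * lap u x) ^ 2 / l := by positivity
        linarith
      have h9 : 0 ≤ 1 / 2 * (u x ^ 2 / l + l * lap u x ^ 2) := by positivity
      have h10 : -(χ x * u x * lap u x) ≤ 1 / 2 * (u x ^ 2 / l + l * lap u x ^ 2) := by
        have e1 := mul_le_mul_of_nonneg_left h7 hχx
        have e2 := mul_le_mul_of_nonneg_right hχ1 h9
        linarith
      have e3 : (C2 + 1) / l * u x ^ 2 = u x ^ 2 * (C2 / l) + u x ^ 2 / l := by ring
      have e4 : 0 ≤ u x ^ 2 * (C2 / l) := by positivity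
      have e5 : 0 ≤ u x ^ 2 / l := by positivity
      have e6 : 0 ≤ l * lap u x ^ 2 := by positivity
      linarith
  rw [integral_add (i1.const_mul _) (i2.const_mul _), integral_const_mul, integral_const_mul,
    integral_indicator hD] at key1
  rw [integral_add (i2.const_mul _) (i3.const_mul _), integral_const_mul, integral_const_mul,
    integral_indicator hD, integral_indicator hD] at key2
  have n1 : 0 ≤ ∫ x in D, u x ^ 2 := integral_nonneg fun x => sq_nonneg _
  have n2 : 0 ≤ ∫ x in D, lap u x ^ 2 := integral_nonneg fun x => sq_nonneg _
  refine key1.trans ?_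
  have := mul_le_mul_of_nonneg_left key2 (by positivity : 0 ≤ 8 * (C1 / l))
  refine (add_le_add_left this _).trans ?_
  have e : 8 * (C1 / l) * ((C2 + 1) / l * (∫ x in D, u x ^ 2) + l * ∫ x in D, lap u x ^ 2) +
      2 * (C1 / l) ^ 2 * (∫ x in D, u x ^ 2) =
      (8 * C1 * (C2 + 1) + 2 * C1 ^ 2) * (l⁻¹ ^ 2 * ∫ x in D, u x ^ 2) +
      8 * C1 * ∫ x in D, lap u x ^ 2 := by field_simp; ring
  rw [e, mul_add]
  have : 8 * C1 * (∫ x in D, lap u x ^ 2) ≤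
      (8 * C1 * (C2 + 1) + 2 * C1 ^ 2) * ∫ x in D, lap u x ^ 2 := by
    refine mul_le_mul_of_nonneg_right ?_ n2
    nlinarith [mul_pos hC1 hC2]
  linarith

end Cutoff

/-! ### Quantitative unique continuation for smooth functions -/

section Smooth

variable {d : ℕ}

/-- Bound on the Carleman weight at squared distance `t ≥ l`. -/
theorem weight_mul_le (M : ℕ) {γ l R t : ℝ} (hl : 0 < l) (ht : l ≤ t) (hγ : 0 ≤ γ) (hR : t ≤ R) :
    (weight (M + 1) γ t * t) ^ 2 ≤ (l ^ M)⁻¹ ^ 2 * Real.exp (2 * (γ * R)) := by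
  have ht0 : 0 < t := hl.trans_le ht
  have h1 : weight (M + 1) γ t * t = (t ^ M)⁻¹ * Real.exp (γ * t) := by
    rw [weight, pow_succ]; field_simp
  rw [h1, mul_pow, ← Real.exp_nat_mul]
  have h2 : (t ^ M)⁻¹ ≤ (l ^ M)⁻¹ := by gcongr
  gcongr
  norm_num

theorem mul_weight_sq (M : ℕ) (γ : ℝ) {t : ℝ} (ht : t ≠ 0) :
    t * weight (M + 1) γ t ^ 2 = t⁻¹ ^ (2 * M + 1) * Real.exp (γ * t) ^ 2 := by
  have h : t * (t ^ (M + 1))⁻¹ ^ 2 = t⁻¹ ^ (2 * M + 1) := by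
    rw [inv_pow, inv_pow, ← pow_mul, show (M + 1) * 2 = (2 * M + 1) + 1 by ring,
      pow_succ t (2 * M + 1)]
    field_simp
  rw [weight, mul_pow, ← mul_assoc, h]

theorem inv_pow_sq_eq (M : ℕ) {l : ℝ} (hl : l ≠ 0) :
    (l ^ M)⁻¹ ^ 2 = l ^ 2 * l⁻¹ ^ (2 * (M + 1)) := by
  rw [inv_pow, inv_pow, ← pow_mul, show 2 * (M + 1) = M * 2 + 2 by ring, pow_add]
  field_simp

theorem exp_le_two_pow (M : ℕ) : Real.exp (M + 1) ≤ 2 ^ (2 * (M + 1)) := by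
  have : Real.exp ((M : ℝ) + 1) = Real.exp 1 ^ (M + 1) := by
    rw [← Real.exp_nat_mul]; push_cast; ring_nf
  rw [pow_mul, this]
  gcongr
  linarith [Real.exp_one_lt_d9]

theorem pow_mul_exp_le (M : ℕ) :
    (1 / 16) ^ (2 * (M + 1)) * Real.exp (M + 1) ≤ Real.exp (-M) := by
  have e1 : Real.exp (-(M : ℝ)) = Real.exp 1 * Real.exp (-1) ^ (M + 1) := by
    rw [← Real.exp_nat_mul, ← Real.exp_add]; push_cast; ring_nf
  have e2 : Real.exp ((M : ℝ) + 1) = Real.exp 1 ^ (M + 1) := by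
    rw [← Real.exp_nat_mul]; push_cast; ring_nf
  rw [pow_mul, e1, e2, ← mul_pow]
  have h1 : (1 / 16) ^ 2 * Real.exp 1 ≤ Real.exp (-1) := by
    rw [Real.exp_neg, ← one_div, le_div_iff₀ (Real.exp_pos 1)]
    nlinarith [Real.exp_one_lt_d9, Real.exp_pos 1]
  have h2 : 1 ≤ Real.exp 1 := Real.one_le_exp zero_le_one
  calc _ ≤ Real.exp (-1) ^ (M + 1) := by gcongr
    _ ≤ _ := le_mul_of_one_le_left (by positivity) h2

theorem continuous_weight_mul (N : ℕ) (γ : ℝ) {r : ℝ} (hr : 0 < r) {h : Rd d → ℝ}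
    (hh : Continuous h) (h0 : ∀ x, sq x < r → h x = 0) :
    Continuous fun x => weight N γ (sq x) * h x := by
  rw [continuous_iff_continuousAt]
  intro x
  by_cases hx : sq x < r
  · have : (fun y => weight N γ (sq y) * h y) =ᶠ[nhds x] fun _ => 0 := by
      filter_upwards [(isOpen_sq_lt r).mem_nhds hx] with y hy
      rw [h0 y hy, mul_zero]
    exact continuousAt_const.congr this.symm
  · have hx0 : sq x ≠ 0 := (hr.trans_le (not_lt.1 hx)).ne'
    have hsx := (contDiff_sq (d := d)).continuous.continuousAt (x := x)
    simp only [weight]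
    exact (((hsx.pow _).inv₀ (pow_ne_zero _ hx0)).mul
      (Real.continuous_exp.continuousAt.comp (continuousAt_const.mul hsx))).mul hh.continuousAt

/-- The Carleman inequality, applied to a function `u` that is cut off at squared distances about
`l₁` and `l₂`. The condition `4 γ l₂ ≤ M + 1` keeps the radial logarithmic derivative of the
weight at least `M` on the support; the commutators with the two cutoffs give the last two
terms. -/
theorem exists_carleman_cut (d : ℕ) : ∃ C : ℝ, 0 < C ∧ ∀ (M : ℕ) (γ l₁ l₂ : ℝ), 0 < l₁ →
    2 * l₁ ≤ l₂ → 0 ≤ γ → 4 * γ * l₂ ≤ M + 1 → (d : ℝ) + 2 ≤ M →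
    ∀ u : Rd d → ℝ, ContDiff ℝ ∞ u →
    16 * γ * M ^ 2 * ∫ x, sq x * (weight (M + 1) γ (sq x) * ((cut 1 l₁ x - cut 1 l₂ x) * u x)) ^ 2 ≤
      3 * (∫ x, (weight (M + 1) γ (sq x) * sq x * ((cut 1 l₁ x - cut 1 l₂ x) * lap u x)) ^ 2) +
      C * (l₁ ^ M)⁻¹ ^ 2 * Real.exp (M + 1) *
        (l₁⁻¹ ^ 2 * (∫ x in {x | sq x < 4 * l₁}, u x ^ 2) +
          ∫ x in {x | sq x < 4 * l₁}, lap u x ^ 2) +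
      C * (l₂ ^ M)⁻¹ ^ 2 * Real.exp (M + 1) *
        (l₂⁻¹ ^ 2 * (∫ x in {x | sq x < 4 * l₂}, u x ^ 2) +
          ∫ x in {x | sq x < 4 * l₂}, lap u x ^ 2) := by
  obtain ⟨C, hC, hcomm⟩ := exists_bound_comm_cut d
  refine ⟨3 * C, by positivity, fun M γ l₁ l₂ hl₁ hl hγ hγl hM u hu => ?_⟩
  have hl₂ : 0 < l₂ := by linarith
  let η : Rd d → ℝ := fun x => cut 1 l₁ x - cut 1 l₂ x
  let W : Rd d → ℝ := fun x => weight (M + 1) γ (sq x)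
  have hη : ContDiff ℝ ∞ η := (contDiff_cut 1 l₁).sub (contDiff_cut 1 l₂)
  have η0 : ∀ x, sq x < l₁ → η x = 0 := fun x hx => by
    simp only [η]
    rw [cut_eq_zero hl₁ (by linarith), cut_eq_zero hl₂ (by linarith), sub_zero]
  have η1 : ∀ x, 2 * l₂ < sq x → η x = 0 := fun x hx => by
    simp only [η]
    rw [cut_eq_one hl₁ (by linarith), cut_eq_one hl₂ (by linarith), sub_self]
  have hηc : HasCompactSupport η := hasCompactSupport_of_sq_le η1
  have hf : ContDiff ℝ ∞ fun x => η x * u x := hη.mul hu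
  have hfc : HasCompactSupport fun x => η x * u x := hηc.mul_right
  have hlapη : ∀ x, lap (fun x => η x * u x) x =
      η x * lap u x + comm (cut 1 l₁) u x - comm (cut 1 l₂) u x := by
    intro x
    have g1 : gdot η u x = gdot (cut 1 l₁) u x - gdot (cut 1 l₂) u x := by
      simp only [gdot, ← Finset.sum_sub_distrib, ← sub_mul]
      refine Finset.sum_congr rfl fun i _ => ?_
      rw [← pd_sub (differentiableAt_of_contDiff (contDiff_cut 1 l₁) x)
        (differentiableAt_of_contDiff (contDiff_cut 1 l₂) x)]
    have g2 : lap η x = lap (cut 1 l₁) x - lap (cut 1 l₂) x :=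
      lap_sub (contDiff_cut 1 l₁) (contDiff_cut 1 l₂) x
    rw [lap_mul hη.contDiffAt hu.contDiffAt, g1, g2, comm, comm]
    ring
  have hqlow : ∀ x : Rd d, sq x ≤ 2 * l₂ →
      (M : ℝ) ≤ radialLogDeriv (2 * ((M + 1 : ℕ) : ℝ) - 1) γ x := by
    intro x hx
    have := mul_le_mul_of_nonneg_left hx hγ
    rw [radialLogDeriv]
    push_cast
    nlinarith
  have hcar := carleman (M + 1) hγ hf hfc hl₁ (fun x hx => by rw [η0 x hx, zero_mul])
    (fun x hx => by
      have hx2 : sq x ≤ 2 * l₂ := by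
        by_contra h
        exact hx (by rw [η1 x (not_le.1 h), zero_mul])
      have h1 := hqlow x hx2
      have h2 : (d : ℝ) + 2 ≤ radialLogDeriv (2 * ((M + 1 : ℕ) : ℝ) - 1) γ x := hM.trans h1
      have h3 : (0 : ℝ) ≤ (d : ℝ) + 2 := by positivity
      nlinarith [mul_self_le_mul_self h3 h2])
  -- all integrands are continuous, because the cutoffs vanish near the origin
  have hcont : ∀ h : Rd d → ℝ, Continuous h → (∀ x, sq x < l₁ → h x = 0) →
      Continuous fun x => W x * h x := fun h hh h0 => continuous_weight_mul (M + 1) γ hl₁ hh h0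
  have cs := (contDiff_sq (d := d)).continuous
  have cu := hu.continuous
  have cη := hη.continuous
  have clu := (contDiff_lap hu).continuous
  have cc1 := continuous_comm (contDiff_cut 1 l₁) hu
  have cc2 := continuous_comm (contDiff_cut 1 l₂) hu
  have z1 : ∀ x, sq x < l₁ → comm (cut 1 l₁) u x = 0 := fun x hx =>
    comm_cut_eq_zero hl₁ (.inl (by linarith)) u
  have z2 : ∀ x, sq x < l₁ → comm (cut 1 l₂) u x = 0 := fun x hx =>
    comm_cut_eq_zero hl₂ (.inl (by linarith)) u
  have z1' : ∀ x, 2 * l₂ < sq x → comm (cut 1 l₁) u x = 0 := fun x hx =>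
    comm_cut_eq_zero hl₁ (.inr (by linarith)) u
  have z2' : ∀ x, 2 * l₂ < sq x → comm (cut 1 l₂) u x = 0 := fun x hx =>
    comm_cut_eq_zero hl₂ (.inr (by linarith)) u
  have hint : ∀ h : Rd d → ℝ, Continuous h → (∀ x, sq x < l₁ → h x = 0) →
      (∀ x, 2 * l₂ < sq x → h x = 0) → Integrable fun x => (W x * sq x * h x) ^ 2 := by
    intro h hh h0 h1
    have := hcont (fun x => sq x * h x) (cs.mul hh) fun x hx => by rw [h0 x hx, mul_zero]
    simp only [mul_assoc]
    refine (this.pow 2).integrable_of_hasCompactSupport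
      (hasCompactSupport_of_sq_le (r := 2 * l₂) fun x hx => ?_)
    simp [h1 x hx]
  have j0 := hint (fun x => η x * lap u x) (cη.mul clu) (fun x hx => by simp [η0 x hx])
    (fun x hx => by simp [η1 x hx])
  have j1 := hint _ cc1 z1 z1'
  have j2 := hint _ cc2 z2 z2'
  have j3 := hint (fun x => lap (fun x => η x * u x) x) (contDiff_lap hf).continuous
    (fun x hx => by rw [hlapη, η0 x hx, z1 x hx, z2 x hx]; simp)
    (fun x hx => by rw [hlapη, η1 x hx, z1' x hx, z2' x hx]; simp)
  have hlow : 16 * γ * M ^ 2 * ∫ x, sq x * (W x * (η x * u x)) ^ 2 ≤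
      16 * γ * ∫ x, sq x * radialLogDeriv (2 * ((M + 1 : ℕ) : ℝ) - 1) γ x ^ 2 *
        (W x * (η x * u x)) ^ 2 := by
    rw [mul_assoc, ← integral_const_mul]
    refine mul_le_mul_of_nonneg_left ?_ (by positivity)
    have k1 := hcont (fun x => η x * u x) (cη.mul cu) fun x hx => by simp [η0 x hx]
    have cq := (contDiff_radialLogDeriv (d := d) (2 * ((M + 1 : ℕ) : ℝ) - 1) γ).continuous
    refine integral_mono ?_ ?_ fun x => ?_
    · refine Continuous.integrable_of_hasCompactSupport (by fun_prop)
        (hasCompactSupport_of_sq_le (r := 2 * l₂) fun x hx => ?_)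
      simp [η1 x hx]
    · refine Continuous.integrable_of_hasCompactSupport (by fun_prop)
        (hasCompactSupport_of_sq_le (r := 2 * l₂) fun x hx => ?_)
      simp [η1 x hx]
    · dsimp only
      by_cases hx : 2 * l₂ < sq x
      · simp [η1 x hx]
      · have h1 := hqlow x (not_lt.1 hx)
        have h2 : (M : ℝ) ^ 2 ≤ radialLogDeriv (2 * ((M + 1 : ℕ) : ℝ) - 1) γ x ^ 2 := by
          gcongr
        have h3 : 0 ≤ sq x * (W x * (η x * u x)) ^ 2 := mul_nonneg (sq_nonneg' x) (sq_nonneg _)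
        nlinarith [mul_le_mul_of_nonneg_right h2 h3]
  have hsplit : ∫ x, (W x * sq x * lap (fun x => η x * u x) x) ^ 2 ≤
      3 * (∫ x, (W x * sq x * (η x * lap u x)) ^ 2) +
      3 * (∫ x, (W x * sq x * comm (cut 1 l₁) u x) ^ 2) +
      3 * ∫ x, (W x * sq x * comm (cut 1 l₂) u x) ^ 2 := by
    have j01 : Integrable fun x => 3 * (W x * sq x * (η x * lap u x)) ^ 2 +
        3 * (W x * sq x * comm (cut 1 l₁) u x) ^ 2 := (j0.const_mul 3).add (j1.const_mul 3)
    rw [← integral_const_mul, ← integral_const_mul, ← integral_const_mul,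
      ← integral_add (j0.const_mul 3) (j1.const_mul 3), ← integral_add j01 (j2.const_mul 3)]
    refine integral_mono j3 (j01.add (j2.const_mul 3)) fun x => ?_
    dsimp only
    rw [hlapη]
    set a := W x * sq x * (η x * lap u x) with ha
    set b := W x * sq x * comm (cut 1 l₁) u x with hb
    set c := W x * sq x * comm (cut 1 l₂) u x with hc
    have e : W x * sq x * (η x * lap u x + comm (cut 1 l₁) u x - comm (cut 1 l₂) u x) =
        a + b - c := by rw [ha, hb, hc]; ring
    rw [e]
    nlinarith [sq_nonneg (a - b), sq_nonneg (a + c), sq_nonneg (b + c)]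
  have hterm : ∀ l : ℝ, 0 < l → l ≤ l₂ →
      Integrable (fun x => (W x * sq x * comm (cut 1 l) u x) ^ 2) →
      3 * (∫ x, (W x * sq x * comm (cut 1 l) u x) ^ 2) ≤
      3 * C * (l ^ M)⁻¹ ^ 2 * Real.exp (M + 1) *
        (l⁻¹ ^ 2 * (∫ x in {x | sq x < 4 * l}, u x ^ 2) +
          ∫ x in {x | sq x < 4 * l}, lap u x ^ 2) := by
    intro l hl0 hll hi
    have cc := continuous_comm (contDiff_cut 1 l) hu
    have hk : ∫ x, (W x * sq x * comm (cut 1 l) u x) ^ 2 ≤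
        (l ^ M)⁻¹ ^ 2 * Real.exp (M + 1) * ∫ x, comm (cut 1 l) u x ^ 2 := by
      rw [← integral_const_mul]
      refine integral_mono hi (Integrable.const_mul ?_ _) fun x => ?_
      · refine Continuous.integrable_of_hasCompactSupport (by fun_prop)
          (hasCompactSupport_of_sq_le (r := 2 * l) fun x hx => ?_)
        rw [comm_cut_eq_zero hl0 (.inr (by linarith))]; simp
      · dsimp only
        by_cases hx : sq x < 1 * l ∨ (1 + 1) * l < sq x
        · rw [comm_cut_eq_zero hl0 hx]; simp
        · push Not at hx
          rw [mul_pow]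
          refine mul_le_mul_of_nonneg_right ?_ (sq_nonneg _)
          refine (weight_mul_le M hl0 (by linarith) hγ (R := 2 * l₂) (by linarith)).trans ?_
          refine mul_le_mul_of_nonneg_left (Real.exp_le_exp.2 (by linarith)) (by positivity)
    have h2 := mul_le_mul_of_nonneg_left (hcomm l hl0 u hu)
      (by positivity : 0 ≤ (l ^ M)⁻¹ ^ 2 * Real.exp (M + 1))
    linarith
  have t1 := hterm l₁ hl₁ (by linarith) j1
  have t2 := hterm l₂ hl₂ le_rfl j2
  have hfin := (hlow.trans hcar).trans hsplit
  linarith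

/-- `exists_carleman_cut` for complex functions, by summing over real and imaginary part. -/
theorem exists_carleman_cut_complex (d : ℕ) : ∃ C : ℝ, 0 < C ∧ ∀ (M : ℕ) (γ l₁ l₂ : ℝ), 0 < l₁ →
    2 * l₁ ≤ l₂ → 0 ≤ γ → 4 * γ * l₂ ≤ M + 1 → (d : ℝ) + 2 ≤ M →
    ∀ u : Rd d → ℂ, ContDiff ℝ ∞ u →
    16 * γ * M ^ 2 * ∫ x, sq x * (weight (M + 1) γ (sq x) * (cut 1 l₁ x - cut 1 l₂ x)) ^ 2 *
        ‖u x‖ ^ 2 ≤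
      3 * (∫ x, (weight (M + 1) γ (sq x) * (sq x * (cut 1 l₁ x - cut 1 l₂ x))) ^ 2 *
        ‖lap u x‖ ^ 2) +
      C * (l₁ ^ M)⁻¹ ^ 2 * Real.exp (M + 1) *
        (l₁⁻¹ ^ 2 * (∫ x in {x | sq x < 4 * l₁}, ‖u x‖ ^ 2) +
          ∫ x in {x | sq x < 4 * l₁}, ‖lap u x‖ ^ 2) +
      C * (l₂ ^ M)⁻¹ ^ 2 * Real.exp (M + 1) *
        (l₂⁻¹ ^ 2 * (∫ x in {x | sq x < 4 * l₂}, ‖u x‖ ^ 2) +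
          ∫ x in {x | sq x < 4 * l₂}, ‖lap u x‖ ^ 2) := by
  obtain ⟨C, hC, H⟩ := exists_carleman_cut d
  refine ⟨C, hC, fun M γ l₁ l₂ hl₁ hl hγ hγl hM u hu => ?_⟩
  have hl₂ : 0 < l₂ := by linarith
  have hre : ContDiff ℝ ∞ fun x => (u x).re := Complex.reCLM.contDiff.comp hu
  have him : ContDiff ℝ ∞ fun x => (u x).im := Complex.imCLM.contDiff.comp hu
  have lre : ∀ x, lap (fun x => (u x).re) x = (lap u x).re := lap_clm Complex.reCLM hu
  have lim : ∀ x, lap (fun x => (u x).im) x = (lap u x).im := lap_clm Complex.imCLM hu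
  have h1 := H M γ l₁ l₂ hl₁ hl hγ hγl hM _ hre
  have h2 := H M γ l₁ l₂ hl₁ hl hγ hγl hM _ him
  simp only [lre, lim] at h1 h2
  have cre := hre.continuous
  have cim := him.continuous
  have clre : Continuous fun x => (lap u x).re := Complex.continuous_re.comp (contDiff_lap hu).continuous
  have clim : Continuous fun x => (lap u x).im := Complex.continuous_im.comp (contDiff_lap hu).continuous
  have cs := (contDiff_sq (d := d)).continuous
  have cη : Continuous fun x : Rd d => cut 1 l₁ x - cut 1 l₂ x :=
    ((contDiff_cut 1 l₁).sub (contDiff_cut 1 l₂)).continuous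
  have η0 : ∀ x : Rd d, sq x < l₁ → cut 1 l₁ x - cut 1 l₂ x = 0 := fun x hx => by
    rw [cut_eq_zero hl₁ (by linarith), cut_eq_zero hl₂ (by linarith), sub_zero]
  have η1 : ∀ x : Rd d, 2 * l₂ < sq x → cut 1 l₁ x - cut 1 l₂ x = 0 := fun x hx => by
    rw [cut_eq_one hl₁ (by linarith), cut_eq_one hl₂ (by linarith), sub_self]
  have hn : ∀ z : ℂ, ‖z‖ ^ 2 = z.re ^ 2 + z.im ^ 2 := fun z => by
    rw [← Complex.normSq_eq_norm_sq, Complex.normSq_apply]; ring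
  have hset : ∀ (w : Rd d → ℂ) (r : ℝ), Continuous (fun x => (w x).re) →
      Continuous (fun x => (w x).im) → ∫ x in {x | sq x < r}, ‖w x‖ ^ 2 =
      (∫ x in {x | sq x < r}, (w x).re ^ 2) + ∫ x in {x | sq x < r}, (w x).im ^ 2 := by
    intro w r hr hi
    have i1 : IntegrableOn (fun x => (w x).re ^ 2) {x | sq x < r} := integrableOn_sq_lt (hr.pow 2) r
    have i2 : IntegrableOn (fun x => (w x).im ^ 2) {x | sq x < r} := integrableOn_sq_lt (hi.pow 2) r
    rw [← integral_add i1 i2]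
    simp only [hn]
  have hW : ∀ h : Rd d → ℝ, Continuous h → Continuous fun x =>
      weight (M + 1) γ (sq x) * ((cut 1 l₁ x - cut 1 l₂ x) * h x) := fun h hh =>
    continuous_weight_mul (M + 1) γ hl₁ (cη.mul hh) fun x hx => by rw [η0 x hx, zero_mul]
  have hWs : ∀ h : Rd d → ℝ, Continuous h → Continuous fun x =>
      weight (M + 1) γ (sq x) * sq x * ((cut 1 l₁ x - cut 1 l₂ x) * h x) := fun h hh => by
    simp only [mul_assoc]
    exact continuous_weight_mul (M + 1) γ hl₁ (cs.mul (cη.mul hh)) fun x hx => by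
      rw [η0 x hx, zero_mul, mul_zero]
  have e1 : ∫ x, sq x * (weight (M + 1) γ (sq x) * (cut 1 l₁ x - cut 1 l₂ x)) ^ 2 * ‖u x‖ ^ 2 =
      (∫ x, sq x * (weight (M + 1) γ (sq x) * ((cut 1 l₁ x - cut 1 l₂ x) * (u x).re)) ^ 2) +
      ∫ x, sq x * (weight (M + 1) γ (sq x) * ((cut 1 l₁ x - cut 1 l₂ x) * (u x).im)) ^ 2 := by
    rw [← integral_add]
    · refine integral_congr_ae (Filter.Eventually.of_forall fun x => ?_)
      dsimp only
      rw [hn]; ring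
    · refine Continuous.integrable_of_hasCompactSupport (cs.mul ((hW _ cre).pow 2))
        (hasCompactSupport_of_sq_le (r := 2 * l₂) fun x hx => ?_)
      simp [η1 x hx]
    · refine Continuous.integrable_of_hasCompactSupport (cs.mul ((hW _ cim).pow 2))
        (hasCompactSupport_of_sq_le (r := 2 * l₂) fun x hx => ?_)
      simp [η1 x hx]
  have e2 : ∫ x, (weight (M + 1) γ (sq x) * (sq x * (cut 1 l₁ x - cut 1 l₂ x))) ^ 2 *
        ‖lap u x‖ ^ 2 =
      (∫ x, (weight (M + 1) γ (sq x) * sq x *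
        ((cut 1 l₁ x - cut 1 l₂ x) * (lap u x).re)) ^ 2) +
      ∫ x, (weight (M + 1) γ (sq x) * sq x *
        ((cut 1 l₁ x - cut 1 l₂ x) * (lap u x).im)) ^ 2 := by
    rw [← integral_add]
    · refine integral_congr_ae (Filter.Eventually.of_forall fun x => ?_)
      dsimp only
      rw [hn]; ring
    · refine Continuous.integrable_of_hasCompactSupport ((hWs _ clre).pow 2)
        (hasCompactSupport_of_sq_le (r := 2 * l₂) fun x hx => ?_)
      simp [η1 x hx]
    · refine Continuous.integrable_of_hasCompactSupport ((hWs _ clim).pow 2)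
        (hasCompactSupport_of_sq_le (r := 2 * l₂) fun x hx => ?_)
      simp [η1 x hx]
  rw [e1, e2, hset u _ cre cim, hset u _ cre cim, hset (lap u) _ clre clim,
    hset (lap u) _ clre clim]
  linarith

/-- The arithmetic of the choice of the parameters in `exists_unique_continuation`. Here `X` is the
weighted mass, `Y` the mass to be estimated, `U₁` and `U₂` are the masses in the small and in the
large ball, and `J = (M + 1) M²` dominates `K² l₂²`, so that the terms with `K` are absorbed. -/
theorem absorption_arithmetic {M : ℕ} {K C δ Q l₁ l₂ J U₁ U₂ G A B X Y : ℝ}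
    (hC : 0 < C) (hδ : 0 < δ) (hδ1 : δ ≤ 1) (hQ0 : 0 < Q) (hl₁d : l₁ = δ ^ 2 / 4)
    (hl₂d : l₂ = 16 * Q ^ 2) (hll : l₁ ≤ l₂) (hJ1 : 1 ≤ J) (hKJ : 6 * K ^ 2 * l₂ ^ 2 ≤ J)
    (U₁0 : 0 ≤ U₁) (U₂0 : 0 ≤ U₂) (G0 : 0 ≤ G)
    (hA : A = (l₁⁻¹) ^ (2 * (M + 1)) * Real.exp (M + 1))
    (hB : B = (l₂⁻¹) ^ (2 * (M + 1)) * Real.exp (M + 1)) (hBA : l₂ ^ 2 * B ≤ l₁ ^ 2 * A)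
    (main' : 4 * J / l₂ * X ≤ (2 * J / l₂ * X + 6 * (l₁ ^ 2 * A * G)) +
      C * (l₁ ^ 2 * A) * (l₁⁻¹ ^ 2 * U₁ + (2 * K ^ 2 * U₁ + 2 * G)) +
      C * (l₂ ^ 2 * B) * (l₂⁻¹ ^ 2 * U₂ + (2 * K ^ 2 * U₂ + 2 * G)))
    (hlowT : (Q ^ 2)⁻¹ ^ (2 * M + 1) * Y ≤ X) :
    Y ≤ 16 * (6 + 4 * C) * ((8 * Q ^ 2 / δ ^ 2) ^ (2 * (M + 1)) * (U₁ + δ ^ 2 * G) +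
      Real.exp (-M) * U₂) := by
  have hl₁ : 0 < l₁ := by rw [hl₁d]; positivity
  have hl₂ : 0 < l₂ := by rw [hl₂d]; positivity
  have hδ2 : δ ^ 2 ≤ 1 := by nlinarith
  have hA0 : 0 < A := by rw [hA]; positivity
  have hB0 : 0 < B := by rw [hB]; positivity
  have hK₂ : K ^ 2 * l₂ ^ 2 ≤ J / 6 := by linarith
  have hK₁ : K ^ 2 * l₁ ^ 2 ≤ J / 6 := by
    have : K ^ 2 * l₁ ^ 2 ≤ K ^ 2 * l₂ ^ 2 := by
      gcongr
    linarith
  have s1 : l₁ ^ 2 * A * (l₁⁻¹ ^ 2 * U₁ + (2 * K ^ 2 * U₁ + 2 * G)) ≤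
      2 * J * (A * U₁) + 2 * (l₁ ^ 2 * A * G) := by
    have e : l₁ ^ 2 * A * (l₁⁻¹ ^ 2 * U₁ + (2 * K ^ 2 * U₁ + 2 * G)) =
        (1 + 2 * (K ^ 2 * l₁ ^ 2)) * (A * U₁) + 2 * (l₁ ^ 2 * A * G) := by
      field_simp; ring
    rw [e]
    have : (1 + 2 * (K ^ 2 * l₁ ^ 2)) * (A * U₁) ≤ 2 * J * (A * U₁) :=
      mul_le_mul_of_nonneg_right (by linarith) (by positivity)
    linarith
  have s2 : l₂ ^ 2 * B * (l₂⁻¹ ^ 2 * U₂ + (2 * K ^ 2 * U₂ + 2 * G)) ≤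
      2 * J * (B * U₂) + 2 * (l₁ ^ 2 * A * G) := by
    have e : l₂ ^ 2 * B * (l₂⁻¹ ^ 2 * U₂ + (2 * K ^ 2 * U₂ + 2 * G)) =
        (1 + 2 * (K ^ 2 * l₂ ^ 2)) * (B * U₂) + 2 * (l₂ ^ 2 * B * G) := by
      field_simp; ring
    rw [e]
    have h1 : (1 + 2 * (K ^ 2 * l₂ ^ 2)) * (B * U₂) ≤ 2 * J * (B * U₂) :=
      mul_le_mul_of_nonneg_right (by linarith) (by positivity)
    have h2 := mul_le_mul_of_nonneg_right hBA G0
    linarith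
  have s3 : 2 * J / l₂ * X ≤ 2 * J * (6 + 4 * C) * (A * U₁ + l₁ ^ 2 * A * G + B * U₂) := by
    have p1 : 0 ≤ A * U₁ := by positivity
    have p2 : 0 ≤ B * U₂ := by positivity
    have p3 : 0 ≤ l₁ ^ 2 * A * G := by positivity
    have t1 := mul_le_mul_of_nonneg_left s1 hC.le
    have t2 := mul_le_mul_of_nonneg_left s2 hC.le
    rw [← mul_assoc] at t1 t2
    have t0 := main'.trans (add_le_add (add_le_add le_rfl t1) t2)
    have t3 : 4 * J / l₂ * X = 2 * (2 * J / l₂ * X) := by ring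
    rw [t3] at t0
    clear main' s1 s2 hKJ hA hB hBA hK₁ hK₂ t1 t2 t3
    generalize 2 * J / l₂ * X = y at *
    generalize l₁ ^ 2 * A * G = z at *
    generalize A * U₁ = a at *
    generalize B * U₂ = b at *
    have p4 : (6 + 4 * C) * z ≤ 2 * J * (6 + 4 * C) * z := by
      refine mul_le_mul_of_nonneg_right ?_ p3
      nlinarith
    have p5 : 0 ≤ J * a := by positivity
    have p6 : 0 ≤ J * b := by positivity
    have p7 : 0 ≤ C * (J * a) := by positivity
    have p8 : 0 ≤ C * (J * b) := by positivity
    linarith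
  have s4 : X ≤ l₂ * (6 + 4 * C) * (A * U₁ + l₁ ^ 2 * A * G + B * U₂) := by
    have hJl : 0 < 2 * J / l₂ := by positivity
    refine le_of_mul_le_mul_left ?_ hJl
    calc 2 * J / l₂ * X ≤ _ := s3
      _ = 2 * J / l₂ * (l₂ * (6 + 4 * C) * (A * U₁ + l₁ ^ 2 * A * G + B * U₂)) := by
        field_simp
  have s5 : Y ≤ 16 * (6 + 4 * C) *
      ((Q ^ 2) ^ (2 * (M + 1)) * A * (U₁ + l₁ ^ 2 * G) + (Q ^ 2) ^ (2 * (M + 1)) * B * U₂) := by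
    have h1 := mul_le_mul_of_nonneg_left (hlowT.trans s4)
      (by positivity : 0 ≤ (Q ^ 2) ^ (2 * M + 1))
    rw [← mul_assoc, ← mul_pow, mul_inv_cancel₀ (by positivity), one_pow, one_mul] at h1
    refine h1.trans (le_of_eq ?_)
    rw [hl₂d]; ring
  have f1 : (Q ^ 2) ^ (2 * (M + 1)) * A ≤ (8 * Q ^ 2 / δ ^ 2) ^ (2 * (M + 1)) := by
    have e : 8 * Q ^ 2 / δ ^ 2 = Q ^ 2 * l₁⁻¹ * 2 := by rw [hl₁d]; field_simp; ring
    rw [e, hA, mul_pow, mul_pow, ← mul_assoc]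
    exact mul_le_mul_of_nonneg_left (exp_le_two_pow M) (by positivity)
  have f2 : (Q ^ 2) ^ (2 * (M + 1)) * B ≤ Real.exp (-M) := by
    have e : (Q ^ 2) ^ (2 * (M + 1)) * B = (1 / 16) ^ (2 * (M + 1)) * Real.exp (M + 1) := by
      rw [hB, ← mul_assoc, ← mul_pow]
      congr 2
      rw [hl₂d]; field_simp
    rw [e]
    exact pow_mul_exp_le M
  have f3 : l₁ ^ 2 ≤ δ ^ 2 := by
    rw [hl₁d]
    nlinarith [sq_nonneg δ]
  refine s5.trans (mul_le_mul_of_nonneg_left (add_le_add ?_ ?_) (by positivity))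
  · refine mul_le_mul f1 ?_ (by positivity) (by positivity)
    linarith [mul_le_mul_of_nonneg_right f3 G0]
  · exact mul_le_mul_of_nonneg_right f2 U₂0

set_option maxHeartbeats 1000000 in
/-- **Quantitative unique continuation** for a smooth function `u` with `|Δu| ≤ K |u| + g`: the
mass of `u` at distance between `δ` and `Q` from the origin is controlled by its mass in the ball
of radius `δ` and by `g`, up to a fraction `exp (-M)` of its mass in the ball of radius `8 Q`. -/
theorem exists_unique_continuation (d : ℕ) : ∃ C : ℝ, 0 < C ∧ ∀ (M : ℕ) (K δ Q : ℝ), 0 ≤ K →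
    0 < δ → δ ≤ 1 → 1 ≤ Q → (d : ℝ) + 2 ≤ M → 1536 * K ^ 2 * Q ^ 4 ≤ M ^ 3 →
    ∀ (u : Rd d → ℂ) (g : Rd d → ℝ), ContDiff ℝ ∞ u → Continuous g →
    (∀ x, ‖lap u x‖ ≤ K * ‖u x‖ + g x) →
    ∀ T : Set (Rd d), MeasurableSet T → (∀ x ∈ T, δ ^ 2 ≤ sq x ∧ sq x ≤ Q ^ 2) →
    ∫ x in T, ‖u x‖ ^ 2 ≤ C * ((8 * Q ^ 2 / δ ^ 2) ^ (2 * (M + 1)) *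
      ((∫ x in {x | sq x < δ ^ 2}, ‖u x‖ ^ 2) + δ ^ 2 * ∫ x in {x | sq x < 64 * Q ^ 2}, g x ^ 2) +
      Real.exp (-M) * ∫ x in {x | sq x < 64 * Q ^ 2}, ‖u x‖ ^ 2) := by
  obtain ⟨C, hC, H⟩ := exists_carleman_cut_complex d
  refine ⟨16 * (6 + 4 * C), by positivity,
    fun M K δ Q hK hδ hδ1 hQ hM hKM u g hu hg hug T hT hTb => ?_⟩
  -- the inner cutoff lives in the ball of radius `δ`, and the outer one at distances between `4 Q`
  -- and `8 Q`, where the weight is smaller than at distance `Q` by an exponential factor in `M`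
  set l₁ : ℝ := δ ^ 2 / 4 with hl₁d
  set l₂ : ℝ := 16 * Q ^ 2 with hl₂d
  set γ : ℝ := (M + 1) / (4 * l₂) with hγd
  have hQ0 : 0 < Q := by linarith
  have hl₁ : 0 < l₁ := by positivity
  have hl₂ : 0 < l₂ := by positivity
  have hδ2 : δ ^ 2 ≤ 1 := by nlinarith
  have hQ2 : 1 ≤ Q ^ 2 := by nlinarith
  have hl : 2 * l₁ ≤ l₂ := by rw [hl₁d, hl₂d]; linarith
  have hl₁1 : l₁ ≤ 1 := by rw [hl₁d]; linarith
  have hγ : 0 ≤ γ := by positivity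
  have hγl : 4 * γ * l₂ = M + 1 := by rw [hγd]; field_simp
  have hM1 : (1 : ℝ) ≤ M := by
    have : (0 : ℝ) ≤ d := by positivity
    linarith
  have main := H M γ l₁ l₂ hl₁ hl hγ hγl.le hM u hu
  have r1 : 4 * l₁ = δ ^ 2 := by rw [hl₁d]; ring
  have r2 : 4 * l₂ = 64 * Q ^ 2 := by rw [hl₂d]; ring
  rw [r1, r2] at main
  let η : Rd d → ℝ := fun x => cut 1 l₁ x - cut 1 l₂ x
  let W : Rd d → ℝ := fun x => weight (M + 1) γ (sq x)
  set U₁ := ∫ x in {x : Rd d | sq x < δ ^ 2}, ‖u x‖ ^ 2 with hU₁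
  set U₂ := ∫ x in {x : Rd d | sq x < 64 * Q ^ 2}, ‖u x‖ ^ 2 with hU₂
  set G := ∫ x in {x : Rd d | sq x < 64 * Q ^ 2}, g x ^ 2 with hG
  have U₁0 : 0 ≤ U₁ := integral_nonneg fun x => sq_nonneg _
  have U₂0 : 0 ≤ U₂ := integral_nonneg fun x => sq_nonneg _
  have G0 : 0 ≤ G := integral_nonneg fun x => sq_nonneg _
  have cs := (contDiff_sq (d := d)).continuous
  have cu : Continuous fun x => ‖u x‖ ^ 2 := hu.continuous.norm.pow 2
  have clu : Continuous fun x => ‖lap u x‖ ^ 2 := (contDiff_lap hu).continuous.norm.pow 2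
  have cη : Continuous η := ((contDiff_cut 1 l₁).sub (contDiff_cut 1 l₂)).continuous
  have η0 : ∀ x : Rd d, sq x < l₁ → η x = 0 := fun x hx => by
    simp only [η]
    rw [cut_eq_zero hl₁ (by linarith), cut_eq_zero hl₂ (by linarith), sub_zero]
  have η1 : ∀ x : Rd d, 2 * l₂ < sq x → η x = 0 := fun x hx => by
    simp only [η]
    rw [cut_eq_one hl₁ (by linarith), cut_eq_one hl₂ (by linarith), sub_self]
  have ηsq : ∀ x : Rd d, η x ^ 2 ≤ 1 := fun x => by
    have h1 := cut_nonneg 1 l₁ x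
    have h2 := cut_nonneg 1 l₂ x
    have h3 := cut_le_one 1 l₁ x
    have h4 := cut_le_one 1 l₂ x
    exact (sq_le_one_iff_abs_le_one _).2 (abs_le.2 ⟨by simp only [η]; linarith,
      by simp only [η]; linarith⟩)
  have hlap : ∀ x, ‖lap u x‖ ^ 2 ≤ 2 * K ^ 2 * ‖u x‖ ^ 2 + 2 * g x ^ 2 := fun x => by
    have h1 : ‖lap u x‖ ^ 2 ≤ (K * ‖u x‖ + g x) ^ 2 := by
      gcongr
      exact hug x
    nlinarith [sq_nonneg (K * ‖u x‖ - g x)]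
  have hlapset : ∀ r : ℝ, r ≤ 64 * Q ^ 2 → ∫ x in {x : Rd d | sq x < r}, ‖lap u x‖ ^ 2 ≤
      2 * K ^ 2 * (∫ x in {x : Rd d | sq x < r}, ‖u x‖ ^ 2) + 2 * G := by
    intro r hr
    have hGr : ∫ x in {x : Rd d | sq x < r}, g x ^ 2 ≤ G :=
      setIntegral_mono_set (integrableOn_sq_lt (hg.pow 2) _)
        (Filter.Eventually.of_forall fun x => sq_nonneg _)
        (Filter.Eventually.of_forall fun x (hx : sq x < r) =>
          show sq x < 64 * Q ^ 2 from hx.trans_le hr)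
    have h1 : ∫ x in {x : Rd d | sq x < r}, ‖lap u x‖ ^ 2 ≤
        ∫ x in {x : Rd d | sq x < r}, (2 * K ^ 2 * ‖u x‖ ^ 2 + 2 * g x ^ 2) :=
      integral_mono (integrableOn_sq_lt clu r)
        (integrableOn_sq_lt ((continuous_const.mul cu).add (continuous_const.mul (hg.pow 2))) r)
        hlap
    have i1 : IntegrableOn (fun x => ‖u x‖ ^ 2) {x | sq x < r} := integrableOn_sq_lt cu r
    have i2 : IntegrableOn (fun x => g x ^ 2) {x | sq x < r} := integrableOn_sq_lt (hg.pow 2) r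
    rw [integral_add (i1.const_mul _) (i2.const_mul _), integral_const_mul,
      integral_const_mul] at h1
    linarith
  set J : ℝ := (M + 1) * M ^ 2 with hJ
  have hJ1 : 1 ≤ J := by
    have : (1 : ℝ) ≤ M ^ 2 := by nlinarith
    nlinarith
  have hKJ : 6 * K ^ 2 * l₂ ^ 2 ≤ J := by
    have e : 6 * K ^ 2 * l₂ ^ 2 = 1536 * K ^ 2 * Q ^ 4 := by rw [hl₂d]; ring
    have e' : ((M : ℝ) + 1) * M ^ 2 = M ^ 3 + M ^ 2 := by ring
    have : (0 : ℝ) ≤ (M : ℝ) ^ 2 := sq_nonneg _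
    rw [e, hJ, e']
    linarith
  have hγM : 16 * γ * M ^ 2 = 4 * J / l₂ := by
    rw [hγd, hJ]; field_simp; ring
  -- continuity of the weighted integrands
  have cWη : Continuous fun x => W x * η x :=
    continuous_weight_mul (M + 1) γ hl₁ cη η0
  have cWsη : Continuous fun x => W x * (sq x * η x) :=
    continuous_weight_mul (M + 1) γ hl₁ (cs.mul cη) fun x hx => by rw [η0 x hx, mul_zero]
  have hcs : ∀ h : Rd d → ℝ, (∀ x, η x = 0 → h x = 0) → HasCompactSupport h := fun h hh =>
    hasCompactSupport_of_sq_le (r := 2 * l₂) fun x hx => hh x (η1 x hx)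
  have iL : Integrable fun x => sq x * (W x * η x) ^ 2 * ‖u x‖ ^ 2 :=
    ((cs.mul (cWη.pow 2)).mul cu).integrable_of_hasCompactSupport
      (hcs _ fun x hx => by simp [hx])
  have iR : Integrable fun x => (W x * (sq x * η x)) ^ 2 * ‖lap u x‖ ^ 2 :=
    ((cWsη.pow 2).mul clu).integrable_of_hasCompactSupport (hcs _ fun x hx => by simp [hx])
  have iG : Integrable fun x => (W x * (sq x * η x)) ^ 2 * g x ^ 2 :=
    ((cWsη.pow 2).mul (hg.pow 2)).integrable_of_hasCompactSupport (hcs _ fun x hx => by simp [hx])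
  set X := ∫ x, sq x * (W x * η x) ^ 2 * ‖u x‖ ^ 2 with hX
  -- absorption of the term with `K`
  have habs : 3 * ∫ x, (W x * (sq x * η x)) ^ 2 * ‖lap u x‖ ^ 2 ≤
      2 * J / l₂ * X + 6 * ∫ x, (W x * (sq x * η x)) ^ 2 * g x ^ 2 := by
    rw [hX, ← integral_const_mul, ← integral_const_mul, ← integral_const_mul,
      ← integral_add (iL.const_mul _) (iG.const_mul _)]
    refine integral_mono (iR.const_mul _) ((iL.const_mul _).add (iG.const_mul _)) fun x => ?_
    dsimp only
    by_cases hx : 2 * l₂ < sq x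
    · simp [η1 x hx]
    · have hx2 := not_lt.1 hx
      have h1 := mul_le_mul_of_nonneg_left (hlap x) (sq_nonneg (W x * (sq x * η x)))
      have h2 : 6 * K ^ 2 * sq x ≤ 2 * J / l₂ := by
        rw [le_div_iff₀ hl₂]
        have : 6 * K ^ 2 * sq x ≤ 6 * K ^ 2 * (2 * l₂) :=
          mul_le_mul_of_nonneg_left hx2 (by positivity)
        nlinarith
      have h3 : 0 ≤ sq x * (W x * η x) ^ 2 * ‖u x‖ ^ 2 :=
        mul_nonneg (mul_nonneg (sq_nonneg' x) (sq_nonneg _)) (sq_nonneg _)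
      have h4 := mul_le_mul_of_nonneg_right h2 h3
      have e1 : (W x * (sq x * η x)) ^ 2 * (2 * K ^ 2 * ‖u x‖ ^ 2 + 2 * g x ^ 2) * 3 =
        6 * K ^ 2 * sq x * (sq x * (W x * η x) ^ 2 * ‖u x‖ ^ 2) +
          6 * ((W x * (sq x * η x)) ^ 2 * g x ^ 2) := by ring
      linarith
  set A : ℝ := (l₁⁻¹) ^ (2 * (M + 1)) * Real.exp (M + 1) with hA
  set B : ℝ := (l₂⁻¹) ^ (2 * (M + 1)) * Real.exp (M + 1) with hB
  have hA0 : 0 < A := by positivity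
  have hB0 : 0 < B := by positivity
  have eA : (l₁ ^ M)⁻¹ ^ 2 * Real.exp (M + 1) = l₁ ^ 2 * A := by
    rw [inv_pow_sq_eq M hl₁.ne', mul_assoc]
  have eB : (l₂ ^ M)⁻¹ ^ 2 * Real.exp (M + 1) = l₂ ^ 2 * B := by
    rw [inv_pow_sq_eq M hl₂.ne', mul_assoc]
  have hBA : l₂ ^ 2 * B ≤ l₁ ^ 2 * A := by
    rw [← eA, ← eB]
    have : l₁ ≤ l₂ := by linarith
    gcongr
  have hgint : ∫ x, (W x * (sq x * η x)) ^ 2 * g x ^ 2 ≤ l₁ ^ 2 * A * G := by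
    rw [hG, ← integral_const_mul, ← integral_indicator (isOpen_sq_lt _).measurableSet]
    refine integral_mono iG ((integrable_indicator_iff (isOpen_sq_lt _).measurableSet).2
      ((integrableOn_sq_lt (hg.pow 2) _).const_mul _)) fun x => ?_
    dsimp only
    by_cases hx : 2 * l₂ < sq x
    · simp only [η1 x hx]
      simp only [mul_zero, zero_pow two_ne_zero, zero_mul]
      exact indicator_nonneg (fun _ _ => by positivity) x
    · have hx2 := not_lt.1 hx
      have hmem : x ∈ {x : Rd d | sq x < 64 * Q ^ 2} := by
        change sq x < 64 * Q ^ 2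
        linarith
      rw [indicator_of_mem hmem]
      refine mul_le_mul_of_nonneg_right ?_ (sq_nonneg _)
      by_cases hx1 : sq x < l₁
      · rw [η0 x hx1]; simp only [mul_zero, zero_pow two_ne_zero]; positivity
      · have h1 := weight_mul_le M hl₁ (not_lt.1 hx1) hγ hx2
        have h2 : 2 * (γ * (2 * l₂)) = M + 1 := by linarith
        rw [h2, eA] at h1
        have e : (W x * (sq x * η x)) ^ 2 = (weight (M + 1) γ (sq x) * sq x) ^ 2 * η x ^ 2 := by
          simp only [W]; ring
        rw [e]
        calc _ ≤ (weight (M + 1) γ (sq x) * sq x) ^ 2 * 1 :=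
              mul_le_mul_of_nonneg_left (ηsq x) (sq_nonneg _)
          _ ≤ _ := by rw [mul_one]; exact h1
  -- lower bound on `T`
  have hlowT : (Q ^ 2)⁻¹ ^ (2 * M + 1) * ∫ x in T, ‖u x‖ ^ 2 ≤ X := by
    have iT : IntegrableOn (fun x => ‖u x‖ ^ 2) T :=
      (cu.continuousOn.integrableOn_compact (isCompact_sq_le (Q ^ 2))).mono_set
        fun x hx => (hTb x hx).2
    rw [hX, ← integral_const_mul, ← integral_indicator hT]
    refine integral_mono ((integrable_indicator_iff hT).2 (iT.const_mul _)) iL fun x => ?_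
    dsimp only
    by_cases hx : x ∈ T
    · rw [indicator_of_mem hx]
      obtain ⟨h1, h2⟩ := hTb x hx
      have hs0 : 0 < sq x := lt_of_lt_of_le (by positivity) h1
      have hη : η x = 1 := by
        simp only [η]
        rw [cut_eq_one hl₁ (by rw [hl₁d]; linarith), cut_eq_zero hl₂ (by rw [hl₂d]; linarith),
          sub_zero]
      rw [hη, mul_one]
      refine mul_le_mul_of_nonneg_right ?_ (sq_nonneg _)
      rw [mul_weight_sq M γ hs0.ne']
      have h3 : (Q ^ 2)⁻¹ ^ (2 * M + 1) ≤ (sq x)⁻¹ ^ (2 * M + 1) := by gcongr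
      have h4 : 1 ≤ Real.exp (γ * sq x) ^ 2 :=
        one_le_pow₀ (Real.one_le_exp (by positivity))
      calc _ ≤ (sq x)⁻¹ ^ (2 * M + 1) * 1 := by rw [mul_one]; exact h3
        _ ≤ _ := mul_le_mul_of_nonneg_left h4 (by positivity)
    · rw [indicator_of_notMem hx]
      exact mul_nonneg (mul_nonneg (sq_nonneg' x) (sq_nonneg _)) (sq_nonneg _)
  have b1 := hlapset (δ ^ 2) (by linarith)
  have b2 := hlapset (64 * Q ^ 2) le_rfl
  change _ ≤ 2 * K ^ 2 * U₁ + 2 * G at b1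
  change _ ≤ 2 * K ^ 2 * U₂ + 2 * G at b2
  set L₁ := ∫ x in {x : Rd d | sq x < δ ^ 2}, ‖lap u x‖ ^ 2
  set L₂ := ∫ x in {x : Rd d | sq x < 64 * Q ^ 2}, ‖lap u x‖ ^ 2
  have main' : 4 * J / l₂ * X ≤ (2 * J / l₂ * X + 6 * (l₁ ^ 2 * A * G)) +
      C * (l₁ ^ 2 * A) * (l₁⁻¹ ^ 2 * U₁ + (2 * K ^ 2 * U₁ + 2 * G)) +
      C * (l₂ ^ 2 * B) * (l₂⁻¹ ^ 2 * U₂ + (2 * K ^ 2 * U₂ + 2 * G)) := by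
    have c1 : C * (l₁ ^ M)⁻¹ ^ 2 * Real.exp (M + 1) = C * (l₁ ^ 2 * A) := by rw [mul_assoc, eA]
    have c2 : C * (l₂ ^ M)⁻¹ ^ 2 * Real.exp (M + 1) = C * (l₂ ^ 2 * B) := by rw [mul_assoc, eB]
    rw [hγM, c1, c2] at main
    refine main.trans (add_le_add (add_le_add ?_ ?_) ?_)
    · exact habs.trans (add_le_add le_rfl (mul_le_mul_of_nonneg_left hgint (by norm_num)))
    · exact mul_le_mul_of_nonneg_left (add_le_add le_rfl b1) (by positivity)
    · exact mul_le_mul_of_nonneg_left (add_le_add le_rfl b2) (by positivity)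
  exact absorption_arithmetic hC hδ hδ1 hQ0 hl₁d hl₂d (by linarith) hJ1 hKJ U₁0 U₂0 G0 hA hB hBA main' hlowT

end Smooth

/-! ### Eigenfunctions of the Laplacian on the box -/

section Products

variable {d : ℕ}

/-- The product of functions of one coordinate each. -/
def prodFun (F : Fin d → ℝ → ℂ) (x : Rd d) : ℂ := ∏ j, F j (x j)

theorem contDiff_prodFun {F : Fin d → ℝ → ℂ} (hF : ∀ j, ContDiff ℝ ∞ (F j)) :
    ContDiff ℝ ∞ (prodFun F) :=
  contDiff_prod fun j _ => (hF j).comp (contDiff_coord j)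

theorem pd_prodFun {F : Fin d → ℝ → ℂ} (hF : ∀ j, ContDiff ℝ ∞ (F j)) (i : Fin d) :
    pd i (prodFun F) = prodFun (Function.update F i (deriv (F i))) := by
  funext x
  have h : ∀ j, HasFDerivAt (fun y : Rd d => F j (y j))
      ((EuclideanSpace.proj j : Rd d →L[ℝ] ℝ).smulRight (deriv (F j) (x j))) x := by
    intro j
    have h1 : HasDerivAt (F j) (deriv (F j) (x j)) (x j) :=
      ((hF j).differentiable (by simp) _).hasDerivAt
    have h2 : HasFDerivAt (fun y : Rd d => y j) (EuclideanSpace.proj j : Rd d →L[ℝ] ℝ) x :=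
      (EuclideanSpace.proj j : Rd d →L[ℝ] ℝ).hasFDerivAt
    have := h1.hasFDerivAt.comp x h2
    convert! this using 1
  have h3 := (HasFDerivAt.finsetProd (u := Finset.univ) fun j _ => h j).fderiv
  change fderiv ℝ (fun y : Rd d => ∏ j, F j (y j)) x _ = _
  rw [h3, prodFun]
  simp only [sum_apply, smul_apply, ContinuousLinearMap.smulRight_apply]
  rw [Finset.sum_eq_single i]
  · rw [← Finset.mul_prod_erase Finset.univ _ (Finset.mem_univ i)]
    have : ∏ j ∈ Finset.univ.erase i, Function.update F i (deriv (F i)) j (x j) =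
        ∏ j ∈ Finset.univ.erase i, F j (x j) :=
      Finset.prod_congr rfl fun j hj => by
        rw [Function.update_of_ne (Finset.ne_of_mem_erase hj)]
    rw [this]
    simp [mul_comm]
  · intro j _ hj
    simp [hj]
  · simp

theorem contDiff_update_deriv {F : Fin d → ℝ → ℂ} (hF : ∀ j, ContDiff ℝ ∞ (F j)) (i : Fin d)
    (j : Fin d) : ContDiff ℝ ∞ (Function.update F i (deriv (F i)) j) := by
  by_cases hj : j = i
  · subst hj
    rw [Function.update_self]
    exact ContDiff.deriv' (n := ∞) (by simpa using hF j)
  · rw [Function.update_of_ne hj]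
    exact hF j

theorem lap_prodFun {F : Fin d → ℝ → ℂ} (hF : ∀ j, ContDiff ℝ ∞ (F j)) {c : Fin d → ℂ}
    (hc : ∀ j t, deriv (deriv (F j)) t = c j * F j t) (x : Rd d) :
    lap (prodFun F) x = (∑ j, c j) * prodFun F x := by
  rw [lap, Finset.sum_mul]
  refine Finset.sum_congr rfl fun i _ => ?_
  rw [pd_prodFun hF, pd_prodFun (contDiff_update_deriv hF i), Function.update_idem,
    Function.update_self, prodFun, prodFun, ← Finset.mul_prod_erase Finset.univ _ (Finset.mem_univ i),
    ← Finset.mul_prod_erase Finset.univ (fun j => F j (x j)) (Finset.mem_univ i),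
    Function.update_self, hc, mul_assoc]
  congr 2
  exact Finset.prod_congr rfl fun j hj => by
    rw [Function.update_of_ne (Finset.ne_of_mem_erase hj)]

end Products

section Modes

variable {d : ℕ}

/-- The eigenfunctions of the second derivative on `(0, L)` with either boundary condition. Also in
the Dirichlet case all integers are admitted, although `n` and `-n` give the same function up to
the sign and `0` gives the zero function: the family is then mapped to its span by the
multiplication with `cos (π t / L)`. -/
noncomputable def fac (bc : BoundaryCondition) (L : ℝ) (n : ℤ) (t : ℝ) : ℂ :=
  match bc with
  | .dirichlet => Complex.sin (Real.pi * n / L * t)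
  | .periodic => Complex.exp (2 * Real.pi * n / L * Complex.I * t)

/-- The corresponding eigenvalues. -/
noncomputable def facEigenvalue (bc : BoundaryCondition) (L : ℝ) (n : ℤ) : ℝ :=
  match bc with
  | .dirichlet => (Real.pi * n / L) ^ 2
  | .periodic => (2 * Real.pi * n / L) ^ 2

theorem facEigenvalue_nonneg (bc : BoundaryCondition) (L : ℝ) (n : ℤ) :
    0 ≤ facEigenvalue bc L n := by
  cases bc <;> exact sq_nonneg _

theorem contDiff_fac (bc : BoundaryCondition) (L : ℝ) (n : ℤ) : ContDiff ℝ ∞ (fac bc L n) := by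
  have h : ContDiff ℝ ∞ fun t : ℝ => (t : ℂ) := Complex.ofRealCLM.contDiff
  cases bc
  · exact (Complex.contDiff_sin (n := ∞)).restrict_scalars ℝ |>.comp (contDiff_const.mul h)
  · exact (contDiff_const.mul h).cexp

theorem deriv_deriv_fac (bc : BoundaryCondition) (L : ℝ) (n : ℤ) (t : ℝ) :
    deriv (deriv (fac bc L n)) t = -(facEigenvalue bc L n : ℂ) * fac bc L n t := by
  have lin : ∀ (c : ℂ) (t : ℝ), HasDerivAt (fun t : ℝ => c * (t : ℂ)) c t := fun c t => by
    simpa using (Complex.ofRealCLM.hasDerivAt (x := t)).const_mul c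
  cases bc
  · have h1 : deriv (fac .dirichlet L n) = fun t : ℝ =>
        Complex.cos (Real.pi * n / L * t) * (Real.pi * n / L) := by
      funext t
      exact ((Complex.hasDerivAt_sin _).comp t (lin _ t)).deriv
    rw [h1]
    have := (((Complex.hasDerivAt_cos _).comp t (lin (Real.pi * n / L) t)).mul_const
      ((Real.pi * n / L : ℂ))).deriv
    refine this.trans ?_
    simp only [fac, facEigenvalue]
    push_cast
    ring
  · have h1 : deriv (fac .periodic L n) = fun t : ℝ =>
        Complex.exp (2 * Real.pi * n / L * Complex.I * t) * (2 * Real.pi * n / L * Complex.I) := by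
      funext t
      exact (lin _ t).cexp.deriv
    rw [h1]
    have := ((lin (2 * Real.pi * n / L * Complex.I) t).cexp.mul_const
      ((2 * Real.pi * n / L * Complex.I : ℂ))).deriv
    refine this.trans ?_
    simp only [fac, facEigenvalue]
    push_cast
    linear_combination (Complex.exp (2 * Real.pi * n / L * Complex.I * t) *
      (2 * Real.pi * n / L) ^ 2) * Complex.I_sq

/-- The one-dimensional factors of `mode`, in the coordinates of the box. -/
noncomputable def modeFac (bc : BoundaryCondition) (a : Rd d) (L : ℝ) (n : Fin d → ℤ) (j : Fin d)
    (t : ℝ) : ℂ :=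
  fac bc L (n j) (t - a j + L / 2)

/-- The eigenfunctions of the Laplacian on the box, as functions on the whole space. -/
noncomputable def mode (bc : BoundaryCondition) (a : Rd d) (L : ℝ) (n : Fin d → ℤ) : Rd d → ℂ :=
  prodFun (modeFac bc a L n)

theorem contDiff_modeFac (bc : BoundaryCondition) (a : Rd d) (L : ℝ) (n : Fin d → ℤ) (j : Fin d) :
    ContDiff ℝ ∞ (modeFac bc a L n j) :=
  (contDiff_fac bc L (n j)).comp ((contDiff_id.sub contDiff_const).add contDiff_const)

theorem contDiff_mode (bc : BoundaryCondition) (a : Rd d) (L : ℝ) (n : Fin d → ℤ) :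
    ContDiff ℝ ∞ (mode bc a L n) :=
  contDiff_prodFun (contDiff_modeFac bc a L n)

/-- The eigenvalue of `-Δ` on `mode`. -/
noncomputable def modeEigenvalue (bc : BoundaryCondition) (L : ℝ) (n : Fin d → ℤ) : ℝ :=
  ∑ j, facEigenvalue bc L (n j)

theorem modeEigenvalue_nonneg (bc : BoundaryCondition) (L : ℝ) (n : Fin d → ℤ) :
    0 ≤ modeEigenvalue bc L n :=
  Finset.sum_nonneg fun _ _ => facEigenvalue_nonneg _ _ _

theorem lap_mode (bc : BoundaryCondition) (a : Rd d) (L : ℝ) (n : Fin d → ℤ) (x : Rd d) :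
    lap (mode bc a L n) x = -(modeEigenvalue bc L n : ℂ) * mode bc a L n x := by
  have h : ∀ j t, deriv (deriv (modeFac bc a L n j)) t =
      -(facEigenvalue bc L (n j) : ℂ) * modeFac bc a L n j t := by
    intro j t
    have e : modeFac bc a L n j = fun t => fac bc L (n j) (t + (-a j + L / 2)) := by
      funext t
      rw [modeFac]
      ring_nf
    have h1 : ∀ f : ℝ → ℂ, deriv (fun t => f (t + (-a j + L / 2))) =
        fun t => deriv f (t + (-a j + L / 2)) := fun f => funext fun t =>
      deriv_comp_add_const f _ t
    rw [e, h1, h1]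
    exact deriv_deriv_fac bc L (n j) _
  rw [mode, lap_prodFun (contDiff_modeFac bc a L n) h, modeEigenvalue]
  push_cast
  rw [Finset.sum_neg_distrib]

end Modes

/-! ### Smooth functions in the domain of the Laplacian -/

section Domain

variable {d : ℕ} {a : Rd d} {L : ℝ}

theorem isBounded_box (a : Rd d) (L : ℝ) : Bornology.IsBounded (box a L) := by
  have h : box a L ⊆ (fun x : Rd d => (WithLp.ofLp x : Fin d → ℝ)) ⁻¹'
      Metric.closedBall (WithLp.ofLp a) (|L| / 2) := by
    intro x hx
    rw [mem_preimage, Metric.mem_closedBall, dist_pi_le_iff (by positivity)]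
    intro i
    rw [Real.dist_eq]
    exact (hx i).le.trans (by linarith [le_abs_self L])
  exact ((PiLp.antilipschitzWith_ofLp 2 fun _ : Fin d => ℝ).isBounded_preimage
    Metric.isBounded_closedBall).subset h

instance isFiniteMeasure_boxMeasure (a : Rd d) (L : ℝ) : IsFiniteMeasure (boxMeasure a L) :=
  isFiniteMeasure_restrict.2 (isBounded_box a L).measure_lt_top.ne

theorem memLp_box_of_continuous {p : Rd d → ℂ} (hp : Continuous p) (a : Rd d) (L : ℝ) :
    MemLp p 2 (boxMeasure a L) := by
  obtain ⟨C, hC⟩ := (isBounded_box a L).isCompact_closure.exists_bound_of_continuousOn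
    hp.continuousOn
  refine MemLp.of_bound hp.aestronglyMeasurable C ?_
  exact (ae_restrict_iff' (isOpen_box a L).measurableSet).2
    (Filter.Eventually.of_forall fun x hx => hC x (subset_closure hx))

/-- The class in `L²(Λ)` of a continuous function on the whole space. -/
noncomputable def toL2 (a : Rd d) (L : ℝ) (p : Rd d → ℂ) (hp : Continuous p) : L2 a L :=
  (memLp_box_of_continuous hp a L).toLp p

theorem coeFn_toL2 {p : Rd d → ℂ} (hp : Continuous p) :
    toL2 a L p hp =ᵐ[boxMeasure a L] p :=
  (memLp_box_of_continuous hp a L).coeFn_toLp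

theorem norm_sq_eq_integral (f : L2 a L) : ‖f‖ ^ 2 = ∫ x in box a L, ‖f x‖ ^ 2 := by
  have h1 : ⟪f, f⟫_ℂ = ∫ x in box a L, ((‖f x‖ ^ 2 : ℝ) : ℂ) := by
    rw [L2.inner_def]
    refine integral_congr_ae (Filter.Eventually.of_forall fun x => ?_)
    simp
  rw [inner_self_eq_norm_sq_to_K, integral_complex_ofReal] at h1
  refine Complex.ofReal_injective ?_
  simpa using h1

theorem norm_toL2_sq {p : Rd d → ℂ} (hp : Continuous p) :
    ‖toL2 a L p hp‖ ^ 2 = ∫ x in box a L, ‖p x‖ ^ 2 := by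
  rw [norm_sq_eq_integral]
  refine integral_congr_ae ?_
  filter_upwards [coeFn_toL2 hp] with x hx
  rw [hx]

theorem inner_eq_integral {f g : L2 a L} {φ ψ : Rd d → ℂ} (hf : f =ᵐ[boxMeasure a L] φ)
    (hg : g =ᵐ[boxMeasure a L] ψ) :
    ⟪f, g⟫_ℂ = ∫ x in box a L, (starRingEnd ℂ) (φ x) * ψ x := by
  rw [L2.inner_def]
  refine integral_congr_ae ?_
  filter_upwards [hf, hg] with x h1 h2
  rw [h1, h2, RCLike.inner_apply, mul_comm]

theorem integrableOn_box {p : Rd d → ℂ} (hp : Continuous p) : IntegrableOn p (box a L) :=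
  (memLp_box_of_continuous hp a L).integrable (by norm_num)

/-- A smooth function belongs to the domain of the Laplacian if it belongs to the form domain and
the boundary terms in the integration by parts vanish. -/
theorem mem_laplacianGraph_of_smooth {bc : BoundaryCondition} {p : Rd d → ℂ}
    (hp : ContDiff ℝ ∞ p)
    (h1 : (toL2 a L p hp.continuous, fun i => toL2 a L (pd i p) (contDiff_pd hp i).continuous) ∈
      formGraph bc a L)
    (h2 : ∀ φ ∈ core bc a L, ∀ i, ∫ x in box a L,
      pd i (fun y => (starRingEnd ℂ) (φ y) * pd i p y) x = 0) :
    (toL2 a L p hp.continuous, toL2 a L (lap p) (contDiff_lap hp).continuous) ∈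
      laplacianGraph bc a L := by
  refine ⟨_, h1, ?_⟩
  rintro q ⟨φ, hφ, hq, hq'⟩
  have cφ : ContDiff ℝ ∞ fun y => (starRingEnd ℂ) (φ y) :=
    Complex.conjCLE.contDiff.comp hφ.1
  have hconj : ∀ i x, pd i (fun y => (starRingEnd ℂ) (φ y)) x = (starRingEnd ℂ) (pd i φ x) :=
    fun i x => pd_clm (Complex.conjCLE : ℂ →L[ℝ] ℂ) (differentiableAt_of_contDiff hφ.1 x) i
  have hmul : ∀ i x, pd i (fun y => (starRingEnd ℂ) (φ y) * pd i p y) x =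
      (starRingEnd ℂ) (pd i φ x) * pd i p x + (starRingEnd ℂ) (φ x) * pd i (pd i p) x := by
    intro i x
    rw [← hconj]
    exact pd_mul_complex (differentiableAt_of_contDiff cφ x)
      (differentiableAt_of_contDiff (contDiff_pd hp i) x) i
  have e1 : ∀ i, ⟪q.2 i, toL2 a L (pd i p) (contDiff_pd hp i).continuous⟫_ℂ =
      -∫ x in box a L, (starRingEnd ℂ) (φ x) * pd i (pd i p) x := by
    intro i
    rw [inner_eq_integral (hq' i) (coeFn_toL2 _), eq_neg_iff_add_eq_zero, ← integral_add, ← h2 φ hφ i]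
    · exact integral_congr_ae (Filter.Eventually.of_forall fun x => (hmul i x).symm)
    · exact integrableOn_box ((Complex.continuous_conj.comp (contDiff_pd hφ.1 i).continuous).mul
        (contDiff_pd hp i).continuous)
    · exact integrableOn_box (cφ.continuous.mul (contDiff_pd (contDiff_pd hp i) i).continuous)
  rw [inner_eq_integral hq (coeFn_toL2 _), Finset.sum_congr rfl fun i _ => e1 i,
    Finset.sum_neg_distrib, ← integral_finsetSum]
  · congr 1
    refine integral_congr_ae (Filter.Eventually.of_forall fun x => ?_)
    simp only [lap, Finset.mul_sum]
  · intro i _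
    exact integrableOn_box (cφ.continuous.mul (contDiff_pd (contDiff_pd hp i) i).continuous)

/-- The estimate `‖ψ‖ ≤ ‖(1 - Δ) ψ‖`. -/
theorem norm_le_of_mem_laplacianGraph {bc : BoundaryCondition} {q : L2 a L × L2 a L}
    (hq : q ∈ laplacianGraph bc a L) : ‖q.1‖ ≤ ‖q.1 - q.2‖ := by
  obtain ⟨G, hG, h⟩ := hq
  have hclosed : IsClosed {p : L2 a L × (Fin d → L2 a L) |
      ∑ i, ⟪p.2 i, G i⟫_ℂ = -⟪p.1, q.2⟫_ℂ} :=
    isClosed_eq (by fun_prop) (by fun_prop)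
  have hmem : ((q.1, G) : L2 a L × (Fin d → L2 a L)) ∈ {p : L2 a L × (Fin d → L2 a L) |
      ∑ i, ⟪p.2 i, G i⟫_ℂ = -⟪p.1, q.2⟫_ℂ} :=
    closure_minimal (s := (coreGraph bc a L : Set (L2 a L × (Fin d → L2 a L)))) h hclosed hG
  have hmem' : ∑ i, ⟪G i, G i⟫_ℂ = -⟪q.1, q.2⟫_ℂ := hmem
  have e : ⟪q.1, q.1 - q.2⟫_ℂ = ⟪q.1, q.1⟫_ℂ + ∑ i, ⟪G i, G i⟫_ℂ := by
    rw [inner_sub_right, hmem', sub_eq_add_neg]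
  have e2 : ‖q.1‖ ^ 2 ≤ RCLike.re ⟪q.1, q.1 - q.2⟫_ℂ := by
    rw [e, map_add, map_sum, ← inner_self_eq_norm_sq (𝕜 := ℂ)]
    exact le_add_of_nonneg_right (Finset.sum_nonneg fun i _ => inner_self_nonneg)
  have e3 := e2.trans (re_inner_le_norm (𝕜 := ℂ) q.1 (q.1 - q.2))
  rcases (norm_nonneg q.1).eq_or_lt with h0 | h0
  · rw [← h0]; exact norm_nonneg _
  · exact le_of_mul_le_mul_left (by rwa [← pow_two]) h0

end Domain

/-! ### The eigenfunctions belong to the domain of the Laplacian -/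

section BoundaryTerms

variable {d : ℕ} {a : Rd d} {L : ℝ}

theorem setIntegral_box_pd_eq_zero_of_tsupport {F : Rd d → ℂ} (hF : ContDiff ℝ ∞ F)
    (hFc : HasCompactSupport F) (hFs : tsupport F ⊆ box a L) (i : Fin d) :
    ∫ x in box a L, pd i F x = 0 := by
  rw [setIntegral_eq_integral_of_forall_compl_eq_zero]
  · exact integral_pd_eq_zero hF hFc i
  · exact fun x hx => pd_eq_zero_of_notMem_tsupport (fun h => hx (hFs h)) i

/-- The integral of a partial derivative of a periodic function over a period box vanishes. -/
theorem setIntegral_box_pd_eq_zero_of_periodic (hL : 0 < L) {F : Rd d → ℂ} (hF : ContDiff ℝ ∞ F)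
    (hper : ∀ (i : Fin d) (x : Rd d), F (x + EuclideanSpace.single i L) = F x) (i : Fin d) :
    ∫ x in box a L, pd i F x = 0 := by
  cases d with
  | zero => exact i.elim0
  | succ n =>
    let lo : Fin (n + 1) → ℝ := fun j => a j - L / 2
    let hi : Fin (n + 1) → ℝ := fun j => a j + L / 2
    let T : (Fin (n + 1) → ℝ) →L[ℝ] Rd (n + 1) :=
      ((EuclideanSpace.equiv (Fin (n + 1)) ℝ).symm : (Fin (n + 1) → ℝ) →L[ℝ] Rd (n + 1))
    have hT : ∀ y, T y = WithLp.toLp 2 y := fun y => rfl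
    have hbox : (WithLp.toLp 2 : (Fin (n + 1) → ℝ) → Rd (n + 1)) ⁻¹' box a L =
        univ.pi fun j => Ioo (lo j) (hi j) := by
      ext y
      simp only [mem_preimage, box, mem_univ_pi, mem_Ioo, lo, hi]
      refine forall_congr' fun j => ?_
      rw [abs_lt]
      constructor <;> rintro ⟨h1, h2⟩ <;> constructor <;> linarith
    have hmp : MeasurePreserving (WithLp.toLp 2 : (Fin (n + 1) → ℝ) → Rd (n + 1)) :=
      PiLp.volume_preserving_toLp (Fin (n + 1))
    have hemb : MeasurableEmbedding (WithLp.toLp 2 : (Fin (n + 1) → ℝ) → Rd (n + 1)) :=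
      (MeasurableEquiv.toLp 2 (Fin (n + 1) → ℝ)).measurableEmbedding
    have hae : (univ.pi fun j => Ioo (lo j) (hi j)) =ᵐ[volume] Icc lo hi :=
      Measure.univ_pi_Ioo_ae_eq_Icc
    rw [← hmp.setIntegral_preimage_emb hemb, hbox, setIntegral_congr_set hae]
    let f : Fin (n + 1) → (Fin (n + 1) → ℝ) → ℂ := fun j y => if j = i then F (T y) else 0
    let f' : Fin (n + 1) → (Fin (n + 1) → ℝ) → (Fin (n + 1) → ℝ) →L[ℝ] ℂ := fun j y =>
      if j = i then (fderiv ℝ F (T y)).comp T else 0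
    have hsum : ∀ y, ∑ j, f' j y (Pi.single j 1) = pd i F (WithLp.toLp 2 y) := by
      intro y
      rw [Finset.sum_eq_single i]
      · simp only [f', if_true, pd]
        rfl
      · intro j _ hj
        simp [f', hj]
      · simp
    have hcont : Continuous fun y => pd i F (T y) :=
      (contDiff_pd hF i).continuous.comp T.continuous
    have key := integral_divergence_of_hasFDerivAt_off_countable' lo hi
      (fun j => by simp only [lo, hi]; linarith) f f' ∅ countable_empty ?_ ?_ ?_
    · simp only [hsum] at key
      rw [key]
      refine Finset.sum_eq_zero fun j _ => ?_
      rw [sub_eq_zero]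
      refine integral_congr_ae (Filter.Eventually.of_forall fun y => ?_)
      by_cases hj : j = i
      · subst hj
        simp only [f, if_true]
        rw [← hper j (T (j.insertNth (lo j) y))]
        congr 1
        ext k
        refine Fin.succAboveCases j ?_ (fun k => ?_) k
        · simp [hT, lo, hi]
          ring
        · simp [hT]
      · simp [f, hj]
    · intro j
      by_cases hj : j = i
      · simp only [f, hj, if_true]
        exact (hF.continuous.comp T.continuous).continuousOn
      · simp only [f, hj, if_false]
        exact continuousOn_const
    · intro y _ j
      by_cases hj : j = i
      · simp only [f, f', hj, if_true]
        exact (differentiableAt_of_contDiff hF (T y)).hasFDerivAt.comp y T.hasFDerivAt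
      · simp only [f, f', hj, if_false]
        exact hasFDerivAt_const _ _
    · simp only [hsum]
      exact hcont.continuousOn.integrableOn_compact isCompact_Icc

/-- The boundary terms in the integration by parts of `⟨∇φ, ∇p⟩` vanish for `φ` in the core; in the
periodic case this needs the periodicity of `p`. -/
theorem boundary_term_eq_zero {bc : BoundaryCondition} (hL : 0 < L) {φ p : Rd d → ℂ}
    (hφ : φ ∈ core bc a L) (hp : ContDiff ℝ ∞ p)
    (hper : bc = .periodic → ∀ (i : Fin d) (x : Rd d), p (x + EuclideanSpace.single i L) = p x)
    (i : Fin d) :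
    ∫ x in box a L, pd i (fun y => (starRingEnd ℂ) (φ y) * pd i p y) x = 0 := by
  obtain ⟨hφs, hφ'⟩ := hφ
  have hs : ContDiff ℝ ∞ fun y => (starRingEnd ℂ) (φ y) * pd i p y :=
    (Complex.conjCLE.contDiff.comp hφs).mul (contDiff_pd hp i)
  cases bc with
  | dirichlet =>
    obtain ⟨hc, hsub⟩ := hφ'
    have hsupp : tsupport (fun y => (starRingEnd ℂ) (φ y) * pd i p y) ⊆ tsupport φ := by
      refine closure_mono fun x hx h0 => hx ?_
      simp [h0]
    refine setIntegral_box_pd_eq_zero_of_tsupport hs ?_ (hsupp.trans hsub) i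
    exact hc.mono' ((subset_tsupport _).trans hsupp)
  | periodic =>
    refine setIntegral_box_pd_eq_zero_of_periodic hL hs (fun j x => ?_) i
    have h1 : pd i p (x + EuclideanSpace.single j L) = pd i p x := by
      have h2 : (fun y => p (y + EuclideanSpace.single j L)) = p := funext (hper rfl j)
      have h3 := fderiv_comp_add_right (𝕜 := ℝ) (f := p) (x := x) (EuclideanSpace.single j L)
      rw [h2] at h3
      rw [pd, pd, h3]
    simp only [h1, hφ' j x]

theorem mode_periodic (hL : 0 < L) (n : Fin d → ℤ) (i : Fin d) (x : Rd d) :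
    mode .periodic a L n (x + EuclideanSpace.single i L) = mode .periodic a L n x := by
  simp only [mode, prodFun]
  refine Finset.prod_congr rfl fun j _ => ?_
  by_cases hj : j = i
  · subst hj
    simp only [modeFac, fac]
    rw [Complex.exp_eq_exp_iff_exists_int]
    refine ⟨n j, ?_⟩
    have : (L : ℂ) ≠ 0 := by exact_mod_cast hL.ne'
    simp
    field_simp
    ring
  · congr 1
    simp [hj]

end BoundaryTerms

section Dirichlet

variable {d : ℕ} {a : Rd d} {L : ℝ}

theorem toL2_sub {p q : Rd d → ℂ} (hp : Continuous p) (hq : Continuous q) :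
    toL2 a L p hp - toL2 a L q hq = toL2 a L (fun x => p x - q x) (hp.sub hq) :=
  (MemLp.toLp_sub _ _).symm

/-- Dominated convergence in `L²(Λ)`. -/
theorem tendsto_toL2 {P : ℕ → Rd d → ℂ} {p : Rd d → ℂ} (hP : ∀ k, Continuous (P k))
    (hp : Continuous p) {C : ℝ} (hC : ∀ k, ∀ x ∈ box a L, ‖P k x‖ ≤ C)
    (hlim : ∀ x ∈ box a L, Filter.Tendsto (fun k => P k x) Filter.atTop (nhds (p x))) :
    Filter.Tendsto (fun k => toL2 a L (P k) (hP k)) Filter.atTop (nhds (toL2 a L p hp)) := by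
  have hm := (isOpen_box a L).measurableSet
  rw [tendsto_iff_norm_sub_tendsto_zero]
  have h1 : Filter.Tendsto (fun k => ∫ x in box a L, ‖P k x - p x‖ ^ 2) Filter.atTop
      (nhds (∫ x in box a L, (0 : ℝ))) := by
    refine tendsto_integral_of_dominated_convergence (fun _ => (C + C) ^ 2)
      (fun k => (((hP k).sub hp).norm.pow 2).aestronglyMeasurable) (integrable_const _)
      (fun k => ?_) ?_
    · refine (ae_restrict_iff' hm).2 (Filter.Eventually.of_forall fun x hx => ?_)
      have hpx : ‖p x‖ ≤ C :=
        le_of_tendsto (hlim x hx).norm (Filter.Eventually.of_forall fun k => hC k x hx)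
      rw [Real.norm_of_nonneg (by positivity)]
      gcongr
      exact (norm_sub_le _ _).trans (add_le_add (hC k x hx) hpx)
    · refine (ae_restrict_iff' hm).2 (Filter.Eventually.of_forall fun x hx => ?_)
      have := ((hlim x hx).sub_const (p x)).norm.pow 2
      simpa using this
  rw [integral_zero] at h1
  have h2 : ∀ k, ‖toL2 a L (P k) (hP k) - toL2 a L p hp‖ =
      Real.sqrt (∫ x in box a L, ‖P k x - p x‖ ^ 2) := fun k => by
    have h3 := norm_toL2_sq (a := a) (L := L) (p := fun x => P k x - p x) ((hP k).sub hp)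
    rw [toL2_sub, ← h3, Real.sqrt_sq (norm_nonneg _)]
  simp only [h2]
  simpa using h1.sqrt

/-- A smooth function on an interval that vanishes at both ends is a limit of smooth functions with
compact support in the interval, with bounded and converging derivatives: near the ends, the
derivative of the cutoff at distance `1 / k` is of order `k` and the function is of order
`1 / k`. -/
theorem exists_compact_approx {F : ℝ → ℂ} (hF : ContDiff ℝ ∞ F) {lo hi : ℝ}
    (h0 : F lo = 0) (h1 : F hi = 0) : ∃ (P : ℕ → ℝ → ℂ) (C : ℝ), (∀ k, ContDiff ℝ ∞ (P k)) ∧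
      (∀ k, ∃ ε > 0, ∀ t, t ∉ Icc (lo + ε) (hi - ε) → P k t = 0) ∧
      (∀ k, ∀ t ∈ Ioo lo hi, ‖P k t‖ ≤ C ∧ ‖deriv (P k) t‖ ≤ C) ∧
      ∀ t ∈ Ioo lo hi, Filter.Tendsto (fun k => P k t) Filter.atTop (nhds (F t)) ∧
        Filter.Tendsto (fun k => deriv (P k) t) Filter.atTop (nhds (deriv F t)) := by
  obtain ⟨B, hB, hB1, -⟩ := exists_bound_deriv_smoothTransition
  obtain ⟨C0, hC0⟩ := isCompact_Icc.exists_bound_of_continuousOn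
    (s := Icc lo hi) hF.continuous.continuousOn
  obtain ⟨C1, hC1⟩ := isCompact_Icc.exists_bound_of_continuousOn
    (s := Icc lo hi) (hF.continuous_deriv (by simp)).continuousOn
  have hσ : ContDiff ℝ ∞ Real.smoothTransition := Real.smoothTransition.contDiff
  let χ : ℕ → ℝ → ℝ := fun k t => Real.smoothTransition ((k + 1) * (t - lo) - 1) *
    Real.smoothTransition ((k + 1) * (hi - t) - 1)
  let χ' : ℕ → ℝ → ℝ := fun k t =>
    (deriv Real.smoothTransition ((k + 1) * (t - lo) - 1) * (k + 1)) *
      Real.smoothTransition ((k + 1) * (hi - t) - 1) +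
    Real.smoothTransition ((k + 1) * (t - lo) - 1) *
      (deriv Real.smoothTransition ((k + 1) * (hi - t) - 1) * (-(k + 1)))
  have hdσ : ∀ t, HasDerivAt Real.smoothTransition (deriv Real.smoothTransition t) t := fun t =>
    (hσ.differentiable (by simp) t).hasDerivAt
  have hχ' : ∀ k t, HasDerivAt (χ k) (χ' k t) t := by
    intro k t
    have l1 : HasDerivAt (fun t : ℝ => ((k : ℝ) + 1) * (t - lo) - 1) ((k : ℝ) + 1) t := by
      simpa using (((hasDerivAt_id t).sub_const lo).const_mul ((k : ℝ) + 1)).sub_const 1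
    have l2 : HasDerivAt (fun t : ℝ => ((k : ℝ) + 1) * (hi - t) - 1) (-((k : ℝ) + 1)) t := by
      simpa using (((hasDerivAt_id t).const_sub hi).const_mul ((k : ℝ) + 1)).sub_const 1
    exact ((hdσ _).comp t l1).mul ((hdσ _).comp t l2)
  have hχs : ∀ k, ContDiff ℝ ∞ (χ k) := fun k =>
    (hσ.comp ((contDiff_const.mul (contDiff_id.sub contDiff_const)).sub contDiff_const)).mul
      (hσ.comp ((contDiff_const.mul (contDiff_const.sub contDiff_id)).sub contDiff_const))
  have hχ1 : ∀ k t, |χ k t| ≤ 1 := fun k t => by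
    rw [abs_of_nonneg (mul_nonneg (Real.smoothTransition.nonneg _) (Real.smoothTransition.nonneg _))]
    exact mul_le_one₀ (Real.smoothTransition.le_one _) (Real.smoothTransition.nonneg _)
      (Real.smoothTransition.le_one _)
  have hdF : ∀ t, HasDerivAt F (deriv F t) t := fun t =>
    (hF.differentiable (by simp) t).hasDerivAt
  have hP' : ∀ k t, HasDerivAt (fun t => χ k t • F t) (χ k t • deriv F t + χ' k t • F t) t :=
    fun k t => (hχ' k t).smul (hdF t)
  -- the function is of the order of the distance to the ends
  have hlip : ∀ s ∈ Icc lo hi, ∀ t ∈ Icc lo hi, ‖F t - F s‖ ≤ C1 * ‖t - s‖ := fun s hs t ht =>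
    (convex_Icc lo hi).norm_image_sub_le_of_norm_deriv_le
      (fun x _ => hF.differentiable (by simp) x) hC1 hs ht
  have hσ0 : ∀ s, 1 < s → deriv Real.smoothTransition s = 0 := by
    intro s hs
    have : Real.smoothTransition =ᶠ[nhds s] fun _ => 1 := by
      filter_upwards [isOpen_Ioi.mem_nhds hs] with y hy
        using Real.smoothTransition.one_of_one_le (le_of_lt hy)
    rw [this.deriv_eq]; simp
  have hbd : ∀ (k : ℕ) (r : ℝ) (z : ℂ), 0 ≤ r → ‖z‖ ≤ C1 * r →
      |deriv Real.smoothTransition ((k + 1) * r - 1)| * (k + 1) * ‖z‖ ≤ 2 * (B * |C1|) := by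
    intro k r z hr hz
    by_cases h : 1 < ((k : ℝ) + 1) * r - 1
    · rw [hσ0 _ h, abs_zero, zero_mul, zero_mul]
      positivity
    · have h2 : ((k : ℝ) + 1) * r ≤ 2 := by linarith [not_lt.1 h]
      have h3 : ‖z‖ ≤ |C1| * r := hz.trans (mul_le_mul_of_nonneg_right (le_abs_self _) hr)
      calc _ ≤ B * (k + 1) * (|C1| * r) := by
            gcongr
            exact hB1 _
        _ = (B * |C1|) * (((k : ℝ) + 1) * r) := by ring
        _ ≤ (B * |C1|) * 2 := mul_le_mul_of_nonneg_left h2 (by positivity)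
        _ = _ := by ring
  refine ⟨fun k t => χ k t • F t, max C0 (C1 + (2 * (B * |C1|) + 2 * (B * |C1|))),
    fun k => (hχs k).smul hF, fun k => ⟨1 / ((k : ℝ) + 1), by positivity, fun t ht => ?_⟩,
    fun k t ht => ⟨?_, ?_⟩, fun t ht => ?_⟩
  · have hk : (0 : ℝ) < (k : ℝ) + 1 := by positivity
    have e : ((k : ℝ) + 1) * (1 / ((k : ℝ) + 1)) = 1 := by field_simp
    have : χ k t = 0 := by
      rw [mem_Icc, not_and_or, not_le, not_le] at ht
      rcases ht with ht | ht
      · refine mul_eq_zero_of_left (Real.smoothTransition.zero_of_nonpos ?_) _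
        have := mul_le_mul_of_nonneg_left (show t - lo ≤ 1 / ((k : ℝ) + 1) by linarith) hk.le
        linarith
      · refine mul_eq_zero_of_right _ (Real.smoothTransition.zero_of_nonpos ?_)
        have := mul_le_mul_of_nonneg_left (show hi - t ≤ 1 / ((k : ℝ) + 1) by linarith) hk.le
        linarith
    simp [this]
  · rw [norm_smul]
    refine le_trans ?_ (le_max_left _ _)
    calc _ ≤ 1 * ‖F t‖ := mul_le_mul_of_nonneg_right (hχ1 k t) (norm_nonneg _)
      _ ≤ C0 := by rw [one_mul]; exact hC0 t (Ioo_subset_Icc_self ht)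
  · rw [(hP' k t).deriv]
    have ht' := Ioo_subset_Icc_self ht
    have hlh : lo ≤ hi := ht'.1.trans ht'.2
    refine le_trans ?_ (le_max_right _ _)
    refine (norm_add_le _ _).trans (add_le_add ?_ ?_)
    · rw [norm_smul]
      calc _ ≤ 1 * ‖deriv F t‖ := mul_le_mul_of_nonneg_right (hχ1 k t) (norm_nonneg _)
        _ ≤ C1 := by rw [one_mul]; exact hC1 t ht'
    · have b1 := hbd k (t - lo) (F t) (by linarith [ht.1]) (by
        have := hlip lo ⟨le_rfl, hlh⟩ t ht'
        rwa [h0, sub_zero, Real.norm_of_nonneg (by linarith [ht.1])] at this)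
      have b2 := hbd k (hi - t) (F t) (by linarith [ht.2]) (by
        have := hlip hi ⟨hlh, le_rfl⟩ t ht'
        rwa [h1, sub_zero, ← norm_neg (t - hi), neg_sub,
          Real.norm_of_nonneg (by linarith [ht.2])] at this)
      have hk : (0 : ℝ) ≤ (k : ℝ) + 1 := by positivity
      rw [norm_smul, Real.norm_eq_abs]
      have s1 := Real.smoothTransition.le_one (((k : ℝ) + 1) * (t - lo) - 1)
      have s2 := Real.smoothTransition.le_one (((k : ℝ) + 1) * (hi - t) - 1)
      have s1' := Real.smoothTransition.nonneg (((k : ℝ) + 1) * (t - lo) - 1)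
      have s2' := Real.smoothTransition.nonneg (((k : ℝ) + 1) * (hi - t) - 1)
      have b3 : |χ' k t| ≤ |deriv Real.smoothTransition (((k : ℝ) + 1) * (t - lo) - 1)| * (k + 1) +
          |deriv Real.smoothTransition (((k : ℝ) + 1) * (hi - t) - 1)| * (k + 1) := by
        refine (abs_add_le _ _).trans (add_le_add ?_ ?_)
        · rw [abs_mul, abs_mul, abs_of_nonneg hk, abs_of_nonneg s2']
          exact mul_le_of_le_one_right (by positivity) s2
        · rw [abs_mul, abs_mul, abs_neg, abs_of_nonneg hk, abs_of_nonneg s1']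
          exact mul_le_of_le_one_left (by positivity) s1
      calc _ ≤ _ := mul_le_mul_of_nonneg_right b3 (norm_nonneg (F t))
        _ ≤ _ := by rw [add_mul]; exact add_le_add b1 b2
  · obtain ⟨k0, hk0⟩ := exists_nat_gt (2 / (t - lo))
    obtain ⟨k1, hk1⟩ := exists_nat_gt (2 / (hi - t))
    have hev : ∀ k ≥ max k0 k1, (fun t => χ k t • F t) =ᶠ[nhds t] F := by
      intro k hk
      have e0 : 1 < ((k : ℝ) + 1) * (t - lo) - 1 := by
        have h3 : (k0 : ℝ) ≤ k := by exact_mod_cast (le_max_left _ _).trans hk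
        have h4 := (div_lt_iff₀ (by linarith [ht.1])).1 hk0
        have h5 := mul_le_mul_of_nonneg_right h3 (show 0 ≤ t - lo by linarith [ht.1])
        linarith [ht.1]
      have e1 : 1 < ((k : ℝ) + 1) * (hi - t) - 1 := by
        have h3 : (k1 : ℝ) ≤ k := by exact_mod_cast (le_max_right _ _).trans hk
        have h4 := (div_lt_iff₀ (by linarith [ht.2])).1 hk1
        have h5 := mul_le_mul_of_nonneg_right h3 (show 0 ≤ hi - t by linarith [ht.2])
        linarith [ht.2]
      have c0 : Continuous fun s : ℝ => ((k : ℝ) + 1) * (s - lo) - 1 := by fun_prop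
      have c1 : Continuous fun s : ℝ => ((k : ℝ) + 1) * (hi - s) - 1 := by fun_prop
      filter_upwards [(isOpen_lt continuous_const c0).mem_nhds e0,
        (isOpen_lt continuous_const c1).mem_nhds e1] with s hs0 hs1
      simp only [χ]
      rw [Real.smoothTransition.one_of_one_le (le_of_lt hs0),
        Real.smoothTransition.one_of_one_le (le_of_lt hs1), one_mul, one_smul]
    constructor
    · refine tendsto_const_nhds.congr' ?_
      filter_upwards [Filter.eventually_ge_atTop (max k0 k1)] with k hk
        using (hev k hk).self_of_nhds.symm
    · refine tendsto_const_nhds.congr' ?_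
      filter_upwards [Filter.eventually_ge_atTop (max k0 k1)] with k hk
        using ((hev k hk).deriv_eq).symm

/-- A product of smooth functions that vanish at the ends of the sides of the box belongs to
`H¹₀(Λ)`. -/
theorem prodFun_mem_formGraph {F : Fin d → ℝ → ℂ} (hF : ∀ j, ContDiff ℝ ∞ (F j))
    (h0 : ∀ j, F j (a j - L / 2) = 0) (h1 : ∀ j, F j (a j + L / 2) = 0) :
    (toL2 a L (prodFun F) (contDiff_prodFun hF).continuous,
      fun i => toL2 a L (pd i (prodFun F)) (contDiff_pd (contDiff_prodFun hF) i).continuous) ∈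
      formGraph .dirichlet a L := by
  choose P C hPs hPc hPb hPl using fun j => exists_compact_approx (hF j) (h0 j) (h1 j)
  let p : ℕ → Rd d → ℂ := fun k => prodFun fun j => P j k
  have hp : ∀ k, ContDiff ℝ ∞ (p k) := fun k => contDiff_prodFun fun j => hPs j k
  have hIoo : ∀ x ∈ box a L, ∀ j, x j ∈ Ioo (a j - L / 2) (a j + L / 2) := by
    intro x hx j
    have := abs_lt.1 (hx j)
    constructor <;> linarith
  have hcore : ∀ k, p k ∈ core .dirichlet a L := by
    intro k
    choose ε hε hεP using fun j => hPc j k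
    let S : Set (Rd d) := ⋂ j, {x : Rd d | x j ∈ Icc (a j - L / 2 + ε j) (a j + L / 2 - ε j)}
    have hS : IsClosed S := isClosed_iInter fun j =>
      isClosed_Icc.preimage (contDiff_coord j).continuous
    have hsub : tsupport (p k) ⊆ S := by
      refine closure_minimal (fun x hx => ?_) hS
      rw [mem_iInter]
      intro j
      by_contra hj
      exact hx (Finset.prod_eq_zero (Finset.mem_univ j) (hεP j _ hj))
    have hSbox : S ⊆ box a L := by
      intro x hx j
      have := mem_iInter.1 hx j
      have h2 := hε j
      rw [abs_lt]
      constructor <;> linarith [this.1, this.2]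
    refine ⟨hp k, ?_, hsub.trans hSbox⟩
    exact Metric.isCompact_of_isClosed_isBounded (isClosed_tsupport _)
      ((isBounded_box a L).subset (hsub.trans hSbox))
  have hprodlim : ∀ (G : Fin d → ℝ → ℂ) (R : Fin d → ℕ → ℝ → ℂ) (D : Fin d → ℝ)
      (hG : Continuous (prodFun G)) (hR : ∀ k, Continuous (prodFun fun j => R j k)),
      (∀ j k, ∀ t ∈ Ioo (a j - L / 2) (a j + L / 2), ‖R j k t‖ ≤ D j) →
      (∀ j, ∀ t ∈ Ioo (a j - L / 2) (a j + L / 2),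
        Filter.Tendsto (fun k => R j k t) Filter.atTop (nhds (G j t))) →
      Filter.Tendsto (fun k => toL2 a L (prodFun fun j => R j k) (hR k)) Filter.atTop
        (nhds (toL2 a L (prodFun G) hG)) := by
    intro G R D hG hR hD hlim
    refine tendsto_toL2 hR hG (C := ∏ j, D j) (fun k x hx => ?_) fun x hx => ?_
    · rw [prodFun, norm_prod]
      exact Finset.prod_le_prod (fun _ _ => norm_nonneg _) fun j _ => hD j k _ (hIoo x hx j)
    · exact tendsto_finsetProd _ fun j _ => hlim j _ (hIoo x hx j)
  have hmem : ∀ k, (toL2 a L (p k) (hp k).continuous,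
      fun i => toL2 a L (pd i (p k)) (contDiff_pd (hp k) i).continuous) ∈
      (coreGraph .dirichlet a L : Set (L2 a L × (Fin d → L2 a L))) := fun k =>
    ⟨p k, hcore k, coeFn_toL2 (hp k).continuous,
      fun i => coeFn_toL2 (contDiff_pd (hp k) i).continuous⟩
  refine mem_closure_of_tendsto (b := Filter.atTop) (Filter.Tendsto.prodMk_nhds ?_ ?_)
    (Filter.Eventually.of_forall hmem)
  · exact hprodlim F P C _ _ (fun j k t ht => (hPb j k t ht).1) fun j t ht => (hPl j t ht).1
  · rw [tendsto_pi_nhds]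
    intro i
    have hpd : ∀ k, pd i (p k) = prodFun fun j =>
        (Function.update P i fun k => deriv (P i k)) j k := by
      intro k
      rw [pd_prodFun fun j => hPs j k]
      congr 1
      funext j
      by_cases hj : j = i
      · subst hj; simp
      · simp [hj]
    have hpd' : pd i (prodFun F) = prodFun (Function.update F i (deriv (F i))) := pd_prodFun hF i
    have c1 := fun k => (contDiff_pd (hp k) i).continuous
    have c2 := (contDiff_pd (contDiff_prodFun hF) i).continuous
    have key := hprodlim (Function.update F i (deriv (F i)))
      (Function.update P i fun k => deriv (P i k)) C (hpd' ▸ c2) (fun k => hpd k ▸ c1 k) ?_ ?_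
    · simpa only [hpd, hpd'] using key
    · intro j k t ht
      by_cases hj : j = i
      · subst hj; simpa using (hPb j k t ht).2
      · simpa [hj] using (hPb j k t ht).1
    · intro j t ht
      by_cases hj : j = i
      · subst hj; simpa using (hPl j t ht).2
      · simpa [hj] using (hPl j t ht).1

theorem mode_mem_laplacianGraph (bc : BoundaryCondition) (hL : 0 < L) (n : Fin d → ℤ) :
    (toL2 a L (mode bc a L n) (contDiff_mode bc a L n).continuous,
      toL2 a L (lap (mode bc a L n)) (contDiff_lap (contDiff_mode bc a L n)).continuous) ∈
      laplacianGraph bc a L := by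
  refine mem_laplacianGraph_of_smooth (contDiff_mode bc a L n) ?_ fun φ hφ i =>
    boundary_term_eq_zero hL hφ (contDiff_mode bc a L n) ?_ i
  · cases bc with
    | dirichlet =>
      refine prodFun_mem_formGraph (contDiff_modeFac .dirichlet a L n) (fun j => ?_) fun j => ?_
      · simp [modeFac, fac]
      · have hL' : (L : ℂ) ≠ 0 := by exact_mod_cast hL.ne'
        have e : (Real.pi * n j / L * ((a j + L / 2 - a j + L / 2 : ℝ) : ℂ) : ℂ) =
            n j * Real.pi := by
          push_cast
          field_simp
          ring
        simp only [modeFac, fac]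
        rw [e]
        exact Complex.sin_int_mul_pi _
    | periodic =>
      exact subset_closure ⟨mode .periodic a L n, ⟨contDiff_mode _ a L n, mode_periodic hL n⟩,
        coeFn_toL2 (contDiff_mode _ a L n).continuous,
        fun i => coeFn_toL2 (contDiff_pd (contDiff_mode _ a L n) i).continuous⟩
  · rintro rfl
    exact mode_periodic hL n

end Dirichlet

/-! ### Density of the span of the eigenfunctions -/

section ModeSpan

variable {d : ℕ} {bc : BoundaryCondition} {a : Rd d} {L : ℝ}

/-- The finite linear combinations of the eigenfunctions `mode`. -/
noncomputable def modeSpan (bc : BoundaryCondition) (a : Rd d) (L : ℝ) :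
    Submodule ℂ (Rd d → ℂ) :=
  Submodule.span ℂ (range (mode bc a L))

theorem mode_mem_modeSpan (n : Fin d → ℤ) : mode bc a L n ∈ modeSpan bc a L :=
  Submodule.subset_span ⟨n, rfl⟩

theorem contDiff_of_mem_modeSpan {p : Rd d → ℂ} (hp : p ∈ modeSpan bc a L) : ContDiff ℝ ∞ p := by
  refine Submodule.span_induction ?_ contDiff_const (fun _ _ _ _ => ContDiff.add)
    (fun c _ _ h => contDiff_const.smul h) hp
  rintro _ ⟨n, rfl⟩
  exact contDiff_mode bc a L n

theorem lap_add {u w : Rd d → ℂ} (hu : ContDiff ℝ ∞ u) (hw : ContDiff ℝ ∞ w) :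
    lap (u + w) = lap u + lap w := by
  funext x
  have h : ∀ i, pd i (u + w) = fun y => pd i u y + pd i w y := fun i =>
    funext fun y => pd_add (differentiableAt_of_contDiff hu y)
      (differentiableAt_of_contDiff hw y) i
  simp only [lap, h, Pi.add_apply, ← Finset.sum_add_distrib]
  exact Finset.sum_congr rfl fun i _ => pd_add
    (differentiableAt_of_contDiff (contDiff_pd hu i) x)
    (differentiableAt_of_contDiff (contDiff_pd hw i) x) i

theorem lap_const_smul {u : Rd d → ℂ} (hu : ContDiff ℝ ∞ u) (c : ℂ) :
    lap (c • u) = c • lap u := by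
  funext x
  exact lap_clm ((ContinuousLinearMap.mul ℝ ℂ) c) hu x

theorem lap_zero : lap (0 : Rd d → ℂ) = 0 := by
  simpa using lap_const_smul (contDiff_const (c := (0 : ℂ)) : ContDiff ℝ ∞ fun _ : Rd d => (0 : ℂ)) 0

theorem lap_mode_eq (n : Fin d → ℤ) :
    lap (mode bc a L n) = (-(modeEigenvalue bc L n : ℂ)) • mode bc a L n :=
  funext fun x => lap_mode bc a L n x

theorem lap_mem_modeSpan {p : Rd d → ℂ} (hp : p ∈ modeSpan bc a L) : lap p ∈ modeSpan bc a L := by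
  refine Submodule.span_induction (p := fun p _ => lap p ∈ modeSpan bc a L) ?_ ?_ ?_ ?_ hp
  · rintro _ ⟨n, rfl⟩
    rw [lap_mode_eq]
    exact Submodule.smul_mem _ _ (mode_mem_modeSpan n)
  · rw [lap_zero]
    exact zero_mem _
  · intro u w hu hw h1 h2
    rw [lap_add (contDiff_of_mem_modeSpan hu) (contDiff_of_mem_modeSpan hw)]
    exact add_mem h1 h2
  · intro c u hu h
    rw [lap_const_smul (contDiff_of_mem_modeSpan hu)]
    exact Submodule.smul_mem _ _ h

/-- `1 - Δ` is onto on the span of the eigenfunctions. -/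
theorem exists_sub_lap_eq {p : Rd d → ℂ} (hp : p ∈ modeSpan bc a L) :
    ∃ q ∈ modeSpan bc a L, q - lap q = p := by
  refine Submodule.span_induction (p := fun p _ => ∃ q ∈ modeSpan bc a L, q - lap q = p)
    ?_ ⟨0, zero_mem _, by rw [lap_zero, sub_zero]⟩ ?_ ?_ hp
  · rintro _ ⟨n, rfl⟩
    have h0 : (1 + (modeEigenvalue bc L n : ℂ)) ≠ 0 := by
      have : (0 : ℝ) < 1 + modeEigenvalue bc L n := by
        linarith [modeEigenvalue_nonneg bc L n]
      exact_mod_cast this.ne'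
    refine ⟨(1 + (modeEigenvalue bc L n : ℂ))⁻¹ • mode bc a L n,
      Submodule.smul_mem _ _ (mode_mem_modeSpan n), ?_⟩
    rw [lap_const_smul (contDiff_mode bc a L n), lap_mode_eq]
    funext x
    simp only [Pi.sub_apply, Pi.smul_apply, smul_eq_mul]
    field_simp
    ring
  · rintro u w - - ⟨q, hq, rfl⟩ ⟨r, hr, rfl⟩
    refine ⟨q + r, add_mem hq hr, ?_⟩
    rw [lap_add (contDiff_of_mem_modeSpan hq) (contDiff_of_mem_modeSpan hr)]
    abel
  · rintro c u - ⟨q, hq, rfl⟩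
    refine ⟨c • q, Submodule.smul_mem _ _ hq, ?_⟩
    rw [lap_const_smul (contDiff_of_mem_modeSpan hq), smul_sub]

theorem toL2_add {p q : Rd d → ℂ} (hp : Continuous p) (hq : Continuous q) :
    toL2 a L (p + q) (hp.add hq) = toL2 a L p hp + toL2 a L q hq :=
  MemLp.toLp_add _ _

theorem toL2_smul {p : Rd d → ℂ} (hp : Continuous p) (c : ℂ) :
    toL2 a L (c • p) (hp.const_smul c) = c • toL2 a L p hp :=
  MemLp.toLp_const_smul c (memLp_box_of_continuous hp a L)

theorem toL2_congr {p q : Rd d → ℂ} (hp : Continuous p) (hq : Continuous q) (h : p = q) :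
    toL2 a L p hp = toL2 a L q hq := by
  subst h
  rfl

theorem toL2_mem_laplacianGraph (hL : 0 < L) {p : Rd d → ℂ} (hp : p ∈ modeSpan bc a L) :
    ∀ (h1 : Continuous p) (h2 : Continuous (lap p)),
      (toL2 a L p h1, toL2 a L (lap p) h2) ∈ laplacianGraph bc a L := by
  refine Submodule.span_induction (p := fun p _ => ∀ (h1 : Continuous p)
    (h2 : Continuous (lap p)), (toL2 a L p h1, toL2 a L (lap p) h2) ∈ laplacianGraph bc a L)
    ?_ ?_ ?_ ?_ hp
  · rintro _ ⟨n, rfl⟩ _ _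
    exact mode_mem_laplacianGraph bc hL n
  · intro h1 h2
    have e1 : toL2 a L 0 h1 = 0 := MemLp.toLp_zero _
    have e2 : toL2 a L (lap 0) h2 = 0 := by
      rw [toL2_congr h2 h1 lap_zero, e1]
    rw [e1, e2]
    exact zero_mem _
  · intro u w hu hw i1 i2 h1 h2
    have cu := contDiff_of_mem_modeSpan hu
    have cw := contDiff_of_mem_modeSpan hw
    have e := add_mem (i1 cu.continuous (contDiff_lap cu).continuous)
      (i2 cw.continuous (contDiff_lap cw).continuous)
    rw [toL2_congr h2 ((contDiff_lap cu).continuous.add (contDiff_lap cw).continuous)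
      (lap_add cu cw), toL2_add cu.continuous cw.continuous,
      toL2_add (contDiff_lap cu).continuous (contDiff_lap cw).continuous]
    exact e
  · intro c u hu i h1 h2
    have cu := contDiff_of_mem_modeSpan hu
    have e := Submodule.smul_mem _ c (i cu.continuous (contDiff_lap cu).continuous)
    rw [toL2_congr h2 ((contDiff_lap cu).continuous.const_smul c) (lap_const_smul cu c),
      toL2_smul cu.continuous, toL2_smul (contDiff_lap cu).continuous]
    exact e

/-- The generators of the algebra of trigonometric polynomials that acts on `modeSpan`. They
separate each point of `(0, L)` from all other points of `[0, L]`. -/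
noncomputable def gen (bc : BoundaryCondition) (L t : ℝ) : ℂ :=
  match bc with
  | .dirichlet => ((Real.cos (Real.pi / L * t) : ℝ) : ℂ)
  | .periodic => Complex.exp (2 * Real.pi / L * Complex.I * t)

theorem continuous_gen (bc : BoundaryCondition) (L : ℝ) : Continuous (gen bc L) := by
  cases bc
  · exact Complex.continuous_ofReal.comp (by fun_prop)
  · exact Complex.continuous_exp.comp (continuous_const.mul Complex.continuous_ofReal)

theorem exists_fac_mul_gen (bc : BoundaryCondition) (L : ℝ) : ∃ c₁ c₂ : ℂ, ∀ (n : ℤ) (t : ℝ),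
    fac bc L n t * gen bc L t = c₁ * fac bc L (n + 1) t + c₂ * fac bc L (n - 1) t := by
  cases bc
  · refine ⟨1 / 2, 1 / 2, fun n t => ?_⟩
    have e1 : (Real.pi * ((n + 1 : ℤ) : ℂ) / L * t : ℂ) =
        Real.pi * n / L * t + Real.pi / L * t := by push_cast; ring
    have e2 : (Real.pi * ((n - 1 : ℤ) : ℂ) / L * t : ℂ) =
        Real.pi * n / L * t - Real.pi / L * t := by push_cast; ring
    simp only [fac, gen, e1, e2, Complex.sin_add, Complex.sin_sub]
    push_cast
    ring
  · refine ⟨1, 0, fun n t => ?_⟩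
    simp only [fac, gen, ← Complex.exp_add, one_mul, zero_mul, add_zero]
    congr 1
    push_cast
    ring

theorem exists_fac_mul_conj_gen (bc : BoundaryCondition) (L : ℝ) : ∃ c₁ c₂ : ℂ,
    ∀ (n : ℤ) (t : ℝ), fac bc L n t * (starRingEnd ℂ) (gen bc L t) =
      c₁ * fac bc L (n + 1) t + c₂ * fac bc L (n - 1) t := by
  cases bc
  · obtain ⟨c₁, c₂, h⟩ := exists_fac_mul_gen .dirichlet L
    refine ⟨c₁, c₂, fun n t => ?_⟩
    rw [← h]
    simp only [gen, Complex.conj_ofReal]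
  · refine ⟨0, 1, fun n t => ?_⟩
    simp only [fac, gen, ← Complex.exp_conj, ← Complex.exp_add, one_mul, zero_mul, zero_add]
    congr 1
    simp only [map_mul, map_div₀, Complex.conj_I, Complex.conj_ofReal, Complex.conj_ofNat]
    push_cast
    ring

/-- `modeSpan` is invariant under the multiplication with a function of one coordinate that acts on
the one-dimensional eigenfunctions by neighbouring shifts. -/
theorem mul_coord_mem_modeSpan {G : ℝ → ℂ} {c₁ c₂ : ℂ} (hG : ∀ (n : ℤ) (t : ℝ),
      fac bc L n t * G t = c₁ * fac bc L (n + 1) t + c₂ * fac bc L (n - 1) t)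
    (j : Fin d) {p : Rd d → ℂ} (hp : p ∈ modeSpan bc a L) :
    (fun x => p x * G (x j - a j + L / 2)) ∈ modeSpan bc a L := by
  refine Submodule.span_induction (p := fun p _ =>
    (fun x => p x * G (x j - a j + L / 2)) ∈ modeSpan bc a L) ?_ ?_ ?_ ?_ hp
  · rintro _ ⟨n, rfl⟩
    have h : (fun x => mode bc a L n x * G (x j - a j + L / 2)) =
        c₁ • mode bc a L (Function.update n j (n j + 1)) +
          c₂ • mode bc a L (Function.update n j (n j - 1)) := by
      funext x
      have e : ∀ m : ℤ, mode bc a L (Function.update n j m) x =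
          fac bc L m (x j - a j + L / 2) *
            ∏ k ∈ Finset.univ.erase j, modeFac bc a L n k (x k) := by
        intro m
        rw [mode, prodFun, ← Finset.mul_prod_erase Finset.univ _ (Finset.mem_univ j)]
        congr 1
        · simp [modeFac]
        · refine Finset.prod_congr rfl fun k hk => ?_
          rw [modeFac, Function.update_of_ne (Finset.ne_of_mem_erase hk), modeFac]
      have e0 := e (n j)
      rw [Function.update_eq_self] at e0
      simp only [Pi.add_apply, Pi.smul_apply, smul_eq_mul, e, e0]
      linear_combination (∏ k ∈ Finset.univ.erase j, modeFac bc a L n k (x k)) *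
        hG (n j) (x j - a j + L / 2)
    rw [h]
    exact add_mem (Submodule.smul_mem _ _ (mode_mem_modeSpan _))
      (Submodule.smul_mem _ _ (mode_mem_modeSpan _))
  · convert zero_mem (modeSpan bc a L) using 1
    funext x
    simp
  · intro u w _ _ h1 h2
    convert add_mem h1 h2 using 1
    funext x
    simp [add_mul]
  · intro c u _ h
    convert Submodule.smul_mem _ c h using 1
    funext x
    simp [mul_assoc]

/-- The closed box: the points `y` with `|y - a|_∞ ≤ L / 2`. -/
def closedBox (a : Rd d) (L : ℝ) : Set (Rd d) := {y | ∀ i, |y i - a i| ≤ L / 2}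

theorem box_subset_closedBox : box a L ⊆ closedBox a L := fun _ hx i => (hx i).le

theorem isCompact_closedBox (hL : 0 < L) : IsCompact (closedBox a L) := by
  refine Metric.isCompact_of_isClosed_isBounded ?_ ((isBounded_box a (2 * L)).subset ?_)
  · have : closedBox a L = ⋂ i, {y : Rd d | |y i - a i| ≤ L / 2} := by
      ext y
      simp [closedBox]
    rw [this]
    exact isClosed_iInter fun i => isClosed_le (by fun_prop) continuous_const
  · intro x hx i
    have := hx i
    linarith

theorem gen_injective (hL : 0 < L) {s t : ℝ} (hs : s ∈ Ioo 0 L) (ht : t ∈ Icc 0 L)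
    (h : gen bc L s = gen bc L t) : s = t := by
  cases bc
  · have h' : Real.cos (Real.pi / L * s) = Real.cos (Real.pi / L * t) := by
      exact Complex.ofReal_injective h
    have hm : ∀ r ∈ Icc 0 L, Real.pi / L * r ∈ Icc 0 Real.pi := by
      intro r hr
      have hpos : 0 < Real.pi / L := div_pos Real.pi_pos hL
      refine ⟨mul_nonneg hpos.le hr.1, ?_⟩
      calc Real.pi / L * r ≤ Real.pi / L * L := mul_le_mul_of_nonneg_left hr.2 hpos.le
        _ = Real.pi := by field_simp
    have := Real.injOn_cos (hm s (Ioo_subset_Icc_self hs)) (hm t ht) h'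
    have hpos : Real.pi / L ≠ 0 := (div_pos Real.pi_pos hL).ne'
    exact mul_left_cancel₀ hpos this
  · simp only [gen] at h
    obtain ⟨k, hk⟩ := Complex.exp_eq_exp_iff_exists_int.1 h
    have hL' : (L : ℂ) ≠ 0 := by exact_mod_cast hL.ne'
    have hpi : (Real.pi : ℂ) ≠ 0 := by exact_mod_cast Real.pi_ne_zero
    have h1 : (s : ℂ) = t + k * L := by
      have h2 : (2 * Real.pi * Complex.I : ℂ) ≠ 0 := Complex.two_pi_I_ne_zero
      field_simp at hk
      linear_combination hk
    have h1' : s = t + k * L := by exact_mod_cast h1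
    have h3 : (k : ℝ) < 1 := by
      by_contra hcon
      have := mul_le_mul_of_nonneg_right (not_lt.1 hcon) hL.le
      linarith [hs.1, hs.2, ht.1, ht.2]
    have h4 : (-1 : ℝ) < k := by
      by_contra hcon
      have := mul_le_mul_of_nonneg_right (not_lt.1 hcon) hL.le
      linarith [hs.1, hs.2, ht.1, ht.2]
    have h5 : k < 1 := by exact_mod_cast h3
    have h6 : -1 < k := by exact_mod_cast h4
    have h7 : k = 0 := by omega
    rw [h1', h7]
    simp

/-- There is an element of `modeSpan` without zeros in the open box. -/
theorem exists_mem_modeSpan_ne_zero (bc : BoundaryCondition) (a : Rd d) (hL : 0 < L) :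
    ∃ w ∈ modeSpan bc a L, (∀ x ∈ box a L, w x ≠ 0) ∧ ∀ x, ‖w x‖ ≤ 1 := by
  have hL' : (L : ℂ) ≠ 0 := by exact_mod_cast hL.ne'
  cases bc
  · refine ⟨mode .dirichlet a L 1, mode_mem_modeSpan _, fun x hx => ?_, fun x => ?_⟩
    · rw [mode, prodFun, Finset.prod_ne_zero_iff]
      intro j _
      have h1 := abs_lt.1 (hx j)
      have h2 : Real.sin (Real.pi / L * (x j - a j + L / 2)) ≠ 0 := by
        have hpos : 0 < Real.pi / L := div_pos Real.pi_pos hL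
        refine (Real.sin_pos_of_pos_of_lt_pi (mul_pos hpos (by linarith)) ?_).ne'
        calc Real.pi / L * (x j - a j + L / 2) < Real.pi / L * L :=
              mul_lt_mul_of_pos_left (by linarith) hpos
          _ = Real.pi := by field_simp
      have h3 : modeFac .dirichlet a L 1 j (x j) =
          ((Real.sin (Real.pi / L * (x j - a j + L / 2)) : ℝ) : ℂ) := by
        simp [modeFac, fac]
      rw [h3]
      exact_mod_cast h2
    · rw [mode, prodFun, norm_prod]
      refine Finset.prod_le_one (fun _ _ => norm_nonneg _) fun j _ => ?_
      have h3 : modeFac .dirichlet a L 1 j (x j) =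
          ((Real.sin (Real.pi / L * (x j - a j + L / 2)) : ℝ) : ℂ) := by
        simp [modeFac, fac]
      rw [h3, Complex.norm_real]
      exact Real.abs_sin_le_one _
  · have h1 : ∀ x, mode .periodic a L 0 x = 1 := fun x => by
      simp [mode, prodFun, modeFac, fac]
    refine ⟨mode .periodic a L 0, mode_mem_modeSpan _, fun x _ => ?_, fun x => ?_⟩
    · rw [h1]; exact one_ne_zero
    · rw [h1]; simp

/-- Stone–Weierstrass: test functions on the box are uniform limits, on the closed box, of linear
combinations of eigenfunctions. A test function is the product of one eigenfunction `w` without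
zeros in the box and of a continuous function of the generators `gen`, and the latter is a limit of
polynomials in the generators and their conjugates. -/
theorem exists_modeSpan_near (bc : BoundaryCondition) (hL : 0 < L) {g : Rd d → ℂ}
    (hg : Continuous g) (hgs : tsupport g ⊆ box a L) {ε : ℝ} (hε : 0 < ε) :
    ∃ p ∈ modeSpan bc a L, ∀ x ∈ closedBox a L, ‖p x - g x‖ ≤ ε := by
  obtain ⟨w, hw, hw0, hw1⟩ := exists_mem_modeSpan_ne_zero bc a hL
  have cw := (contDiff_of_mem_modeSpan hw).continuous
  have : CompactSpace (closedBox a L) := isCompact_iff_compactSpace.1 (isCompact_closedBox hL)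
  -- the quotient of `g` by `w`
  let h : Rd d → ℂ := fun x => g x / w x
  have hh : Continuous h := by
    rw [continuous_iff_continuousAt]
    intro x
    by_cases hx : x ∈ box a L
    · exact hg.continuousAt.div cw.continuousAt (hw0 x hx)
    · have : h =ᶠ[nhds x] fun _ => 0 := by
        filter_upwards [(isClosed_tsupport g).isOpen_compl.mem_nhds fun hx' => hx (hgs hx')]
          with y hy
        simp only [h, image_eq_zero_of_notMem_tsupport hy, zero_div]
      exact continuousAt_const.congr this.symm
  -- `h` factors through the generators, because they can identify only points of the boundary
  let E : C(closedBox a L, Fin d → ℂ) :=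
    ⟨fun x j => gen bc L (x.1 j - a j + L / 2), continuous_pi fun j =>
      (continuous_gen bc L).comp (by fun_prop)⟩
  let E' : C(closedBox a L, range E) := ⟨rangeFactorization E, by fun_prop⟩
  have hE' : Topology.IsQuotientMap E' :=
    IsClosedMap.isQuotientMap E'.continuous.isClosedMap E'.continuous
      rangeFactorization_surjective
  have : CompactSpace (range E) := isCompact_iff_compactSpace.1 (isCompact_range E.continuous)
  have hfac : Function.FactorsThrough (fun x : closedBox a L => h x.1) E' := by
    have key : ∀ x y : closedBox a L, E' x = E' y → x.1 ∈ box a L → x = y := by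
      intro x y hxy hx
      have h1 : E x = E y := congrArg Subtype.val hxy
      ext j
      have h2 : gen bc L (x.1 j - a j + L / 2) = gen bc L (y.1 j - a j + L / 2) := congrFun h1 j
      have h3 := abs_lt.1 (hx j)
      have h4 := abs_le.1 (y.2 j)
      have := gen_injective hL ⟨by linarith, by linarith⟩ ⟨by linarith, by linarith⟩ h2
      linarith
    intro x y hxy
    by_cases hx : x.1 ∈ box a L
    · rw [key x y hxy hx]
    · by_cases hy : y.1 ∈ box a L
      · rw [key y x hxy.symm hy]
      · simp only [h, image_eq_zero_of_notMem_tsupport fun h' => hx (hgs h'),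
          image_eq_zero_of_notMem_tsupport fun h' => hy (hgs h'), zero_div]
  let H : C(range E, ℂ) := hE'.lift ⟨fun x => h x.1, hh.comp continuous_subtype_val⟩ hfac
  have hH : ∀ x, H (E' x) = h x.1 := fun x =>
    DFunLike.congr_fun (hE'.lift_comp ⟨fun x => h x.1, hh.comp continuous_subtype_val⟩ hfac) x
  let z : Fin d → C(range E, ℂ) := fun j => ⟨fun y => y.1 j, (continuous_apply j).comp continuous_subtype_val⟩
  let S : StarSubalgebra ℂ C(range E, ℂ) := StarAlgebra.adjoin ℂ (range z)
  have hS : S.topologicalClosure = ⊤ := by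
    refine ContinuousMap.starSubalgebra_topologicalClosure_eq_top_of_separatesPoints S ?_
    intro x y hxy
    have : ∃ j, x.1 j ≠ y.1 j := by
      by_contra! hcon
      exact hxy (Subtype.ext (funext hcon))
    obtain ⟨j, hj⟩ := this
    exact ⟨z j, ⟨z j, StarAlgebra.subset_adjoin ℂ _ ⟨j, rfl⟩, rfl⟩, hj⟩
  have hHS : H ∈ closure (S : Set C(range E, ℂ)) := by
    rw [← StarSubalgebra.topologicalClosure_coe, hS]
    trivial
  obtain ⟨q, hq, hqH⟩ := Metric.mem_closure_iff.1 hHS ε hε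
  -- multiplication by an element of the algebra preserves `modeSpan`
  have hmul : ∀ q ∈ S, (∀ v ∈ modeSpan bc a L, ∃ p ∈ modeSpan bc a L,
      ∀ x : closedBox a L, p x.1 = v x.1 * q (E' x)) ∧
      ∀ v ∈ modeSpan bc a L, ∃ p ∈ modeSpan bc a L,
        ∀ x : closedBox a L, p x.1 = v x.1 * star (q (E' x)) := by
    intro q hq
    refine StarAlgebra.adjoin_induction (p := fun q _ => (∀ v ∈ modeSpan bc a L,
      ∃ p ∈ modeSpan bc a L, ∀ x : closedBox a L, p x.1 = v x.1 * q (E' x)) ∧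
      ∀ v ∈ modeSpan bc a L, ∃ p ∈ modeSpan bc a L,
        ∀ x : closedBox a L, p x.1 = v x.1 * star (q (E' x))) ?_ ?_ ?_ ?_ ?_ hq
    · rintro _ ⟨j, rfl⟩
      obtain ⟨c₁, c₂, hc⟩ := exists_fac_mul_gen bc L
      obtain ⟨c₁', c₂', hc'⟩ := exists_fac_mul_conj_gen bc L
      exact ⟨fun v hv => ⟨_, mul_coord_mem_modeSpan hc j hv, fun x => rfl⟩,
        fun v hv => ⟨_, mul_coord_mem_modeSpan hc' j hv, fun x => rfl⟩⟩
    · intro r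
      exact ⟨fun v hv => ⟨r • v, Submodule.smul_mem _ _ hv, fun x => mul_comm _ _⟩,
        fun v hv => ⟨star r • v, Submodule.smul_mem _ _ hv, fun x => mul_comm _ _⟩⟩
    · rintro q r - - ⟨hq, hq'⟩ ⟨hr, hr'⟩
      refine ⟨fun v hv => ?_, fun v hv => ?_⟩
      · obtain ⟨p, hp, e⟩ := hq v hv
        obtain ⟨p', hp', e'⟩ := hr v hv
        exact ⟨p + p', add_mem hp hp', fun x => by
          simp only [Pi.add_apply, e, e', ContinuousMap.add_apply]; ring⟩
      · obtain ⟨p, hp, e⟩ := hq' v hv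
        obtain ⟨p', hp', e'⟩ := hr' v hv
        exact ⟨p + p', add_mem hp hp', fun x => by
          simp only [Pi.add_apply, e, e', ContinuousMap.add_apply, star_add]; ring⟩
    · rintro q r - - ⟨hq, hq'⟩ ⟨hr, hr'⟩
      refine ⟨fun v hv => ?_, fun v hv => ?_⟩
      · obtain ⟨p, hp, e⟩ := hq v hv
        obtain ⟨p', hp', e'⟩ := hr p hp
        exact ⟨p', hp', fun x => by rw [e', e, ContinuousMap.mul_apply]; ring⟩
      · obtain ⟨p, hp, e⟩ := hq' v hv
        obtain ⟨p', hp', e'⟩ := hr' p hp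
        exact ⟨p', hp', fun x => by rw [e', e, ContinuousMap.mul_apply, star_mul]; ring⟩
    · rintro q - ⟨hq, hq'⟩
      refine ⟨fun v hv => ?_, fun v hv => ?_⟩
      · obtain ⟨p, hp, e⟩ := hq' v hv
        exact ⟨p, hp, fun x => e x⟩
      · obtain ⟨p, hp, e⟩ := hq v hv
        exact ⟨p, hp, fun x => by rw [e, ContinuousMap.star_apply, star_star]⟩
  obtain ⟨p, hp, e⟩ := (hmul q hq).1 w hw
  refine ⟨p, hp, fun x hx => ?_⟩
  have hgx : g x = w x * h x := by
    by_cases hx' : x ∈ box a L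
    · exact (mul_div_cancel₀ _ (hw0 x hx')).symm
    · simp only [h, image_eq_zero_of_notMem_tsupport fun h' => hx' (hgs h'), zero_div, mul_zero]
  have e2 := e ⟨x, hx⟩
  have e3 := hH ⟨x, hx⟩
  have e4 : ‖q (E' ⟨x, hx⟩) - H (E' ⟨x, hx⟩)‖ ≤ ε := by
    rw [dist_comm, dist_eq_norm] at hqH
    exact ((q - H).norm_coe_le_norm _).trans hqH.le
  simp only at e2 e3
  rw [e2, hgx, ← e3, ← mul_sub, norm_mul]
  calc _ ≤ 1 * ε := mul_le_mul (hw1 x) e4 (norm_nonneg _) zero_le_one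
    _ = ε := one_mul _

/-- The span of the eigenfunctions is dense: its orthogonal complement is trivial. -/
theorem eq_zero_of_inner_modeSpan (hL : 0 < L) (f : L2 a L)
    (h : ∀ p, ∀ hp : p ∈ modeSpan bc a L,
      ⟪toL2 a L p (contDiff_of_mem_modeSpan hp).continuous, f⟫_ℂ = 0) : f = 0 := by
  refine eq_zero_of_inner_test f fun g hg hgc hgs => ?_
  have hχ : Continuous fun x => (g x : ℂ) := Complex.continuous_ofReal.comp hg.continuous
  have hχs : tsupport (fun x => (g x : ℂ)) ⊆ box a L :=
    (closure_mono (Function.support_comp_subset (g := fun t : ℝ => (t : ℂ)) (by simp) g)).trans hgs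
  choose P hP hPg using fun k : ℕ =>
    exists_modeSpan_near bc hL hχ hχs (show (0 : ℝ) < 1 / ((k : ℝ) + 1) by positivity)
  obtain ⟨C, hC⟩ := (isCompact_closedBox hL).exists_bound_of_continuousOn
    (s := closedBox a L) hχ.continuousOn
  have hlim := tendsto_toL2 (a := a) (L := L)
    (fun k => (contDiff_of_mem_modeSpan (hP k)).continuous) hχ (C := C + 1)
    (fun k x hx => by
      have h1 := hPg k x (box_subset_closedBox hx)
      have h2 := hC x (box_subset_closedBox hx)
      have h3 : 1 / ((k : ℝ) + 1) ≤ 1 := by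
        rw [div_le_one (by positivity)]
        have : (0 : ℝ) ≤ k := k.cast_nonneg
        linarith
      have h4 := norm_sub_norm_le (P k x) (g x : ℂ)
      linarith)
    (fun x hx => by
      rw [tendsto_iff_norm_sub_tendsto_zero]
      exact squeeze_zero (fun _ => norm_nonneg _)
        (fun k => hPg k x (box_subset_closedBox hx)) tendsto_one_div_add_atTop_nhds_zero_nat)
  have h1 : ⟪toL2 a L _ hχ, f⟫_ℂ = 0 :=
    tendsto_nhds_unique (hlim.inner tendsto_const_nhds) (by
      simp only [h _ (hP _)]
      exact tendsto_const_nhds)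
  rw [inner_eq_integral (coeFn_toL2 hχ) (Filter.EventuallyEq.refl _ _)] at h1
  simpa using h1

/-- The span of the eigenfunctions is a core of the Laplacian: every element of the graph of the
Laplacian is a limit of pairs `(p, Δ p)` with `p` in this span. Indeed `1 - Δ` maps the span onto
itself, and controls the norm of the graph. -/
theorem exists_modeSpan_near_laplacianGraph (hL : 0 < L) {q : L2 a L × L2 a L}
    (hq : q ∈ laplacianGraph bc a L) {ε : ℝ} (hε : 0 < ε) :
    ∃ p ∈ modeSpan bc a L, ∃ (h1 : Continuous p) (h2 : Continuous (lap p)),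
      ‖toL2 a L p h1 - q.1‖ ≤ ε ∧ ‖toL2 a L (lap p) h2 - q.2‖ ≤ ε := by
  let D : Submodule ℂ (L2 a L) :=
    { carrier := {f | ∃ p, ∃ hp : p ∈ modeSpan bc a L,
        toL2 a L p (contDiff_of_mem_modeSpan hp).continuous = f}
      zero_mem' := ⟨0, zero_mem _, MemLp.toLp_zero _⟩
      add_mem' := by
        rintro _ _ ⟨p, hp, rfl⟩ ⟨r, hr, rfl⟩
        exact ⟨p + r, add_mem hp hr, toL2_add _ _⟩
      smul_mem' := by
        rintro c _ ⟨p, hp, rfl⟩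
        exact ⟨c • p, Submodule.smul_mem _ _ hp, toL2_smul _ _⟩ }
  have hD : D.topologicalClosure = ⊤ := by
    rw [Submodule.topologicalClosure_eq_top_iff, Submodule.eq_bot_iff]
    intro f hf
    refine eq_zero_of_inner_modeSpan (bc := bc) hL f fun p hp => ?_
    exact (Submodule.mem_orthogonal _ _).1 hf _ ⟨p, hp, rfl⟩
  have hmem : q.1 - q.2 ∈ closure (D : Set (L2 a L)) := by
    rw [← Submodule.topologicalClosure_coe, hD]
    trivial
  obtain ⟨_, ⟨r, hr, rfl⟩, hr2⟩ := Metric.mem_closure_iff.1 hmem (ε / 2) (by positivity)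
  obtain ⟨p, hp, rfl⟩ := exists_sub_lap_eq hr
  have cp := (contDiff_of_mem_modeSpan hp).continuous
  have cl := (contDiff_lap (contDiff_of_mem_modeSpan hp)).continuous
  refine ⟨p, hp, cp, cl, ?_⟩
  have h1 := sub_mem (toL2_mem_laplacianGraph hL hp cp cl) hq
  have h2 := norm_le_of_mem_laplacianGraph h1
  have e : toL2 a L (p - lap p) (contDiff_of_mem_modeSpan hr).continuous =
      toL2 a L p cp - toL2 a L (lap p) cl := (toL2_sub cp cl).symm
  have h3 : ‖(toL2 a L p cp - q.1) - (toL2 a L (lap p) cl - q.2)‖ ≤ ε / 2 := by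
    rw [dist_comm, dist_eq_norm, e] at hr2
    refine le_trans (le_of_eq ?_) hr2.le
    congr 1
    abel
  have h4 : ‖toL2 a L p cp - q.1‖ ≤ ε / 2 := h2.trans h3
  refine ⟨h4.trans (by linarith), ?_⟩
  have h5 : toL2 a L (lap p) cl - q.2 = (toL2 a L p cp - q.1) -
      ((toL2 a L p cp - q.1) - (toL2 a L (lap p) cl - q.2)) := by abel
  rw [h5]
  exact (norm_sub_le _ _).trans (by linarith)

end ModeSpan

/-! ### Continuation of the eigenfunctions by reflections and translations -/

section Reflections

variable {d : ℕ} {a : Rd d} {L : ℝ}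

/-- The sign by which the coordinate is multiplied when the box is moved by `k` side lengths: the
periodic continuation is by translations, the Dirichlet continuation by odd reflections. -/
noncomputable def reflSign (bc : BoundaryCondition) (k : ℤ) : ℝ :=
  match bc with
  | .dirichlet => if Even k then 1 else -1
  | .periodic => 1

theorem reflSign_eq (bc : BoundaryCondition) (k : ℤ) : reflSign bc k = 1 ∨ reflSign bc k = -1 := by
  cases bc
  · simp only [reflSign]
    split_ifs
    · exact Or.inl rfl
    · exact Or.inr rfl
  · exact Or.inl rfl

/-- The one-dimensional form of the invariance of the eigenfunctions under `cellMap`; the sign does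
not depend on the eigenfunction. -/
theorem fac_refl (bc : BoundaryCondition) (hL : 0 < L) (n k : ℤ) (t : ℝ) :
    fac bc L n (reflSign bc k * (t - L / 2) + L * k + L / 2) = reflSign bc k * fac bc L n t := by
  have hL' : (L : ℂ) ≠ 0 := by exact_mod_cast hL.ne'
  cases bc
  · by_cases hk : Even k
    · obtain ⟨l, rfl⟩ := hk
      simp only [fac, reflSign, if_pos (Even.add_self l)]
      have e : (Real.pi * n / L * ((1 * (t - L / 2) + L * ((l + l : ℤ) : ℝ) + L / 2 : ℝ) : ℂ) : ℂ) =
          Real.pi * n / L * t + ((n * l : ℤ) : ℂ) * (2 * Real.pi) := by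
        push_cast
        field_simp
        ring
      rw [e, Complex.sin_add_int_mul_two_pi]
      simp
    · have hk' := hk
      obtain ⟨l, rfl⟩ := Int.not_even_iff_odd.1 hk'
      simp only [fac, reflSign, if_neg hk]
      have e : (Real.pi * n / L *
          ((-1 * (t - L / 2) + L * ((2 * l + 1 : ℤ) : ℝ) + L / 2 : ℝ) : ℂ) : ℂ) =
          -(Real.pi * n / L * t) + ((n * (l + 1) : ℤ) : ℂ) * (2 * Real.pi) := by
        push_cast
        field_simp
        ring
      rw [e, Complex.sin_add_int_mul_two_pi, Complex.sin_neg]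
      push_cast
      ring
  · simp only [fac, reflSign]
    push_cast
    rw [one_mul, one_mul, Complex.exp_eq_exp_iff_exists_int]
    refine ⟨n * k, ?_⟩
    push_cast
    field_simp
    ring

open Classical in
/-- The linear part of `cellMap`. -/
noncomputable def cellLin (bc : BoundaryCondition) (k : Fin d → ℤ) : Rd d ≃ₗᵢ[ℝ] Rd d :=
  LinearIsometryEquiv.piLpCongrRight 2 fun i =>
    if reflSign bc (k i) = 1 then LinearIsometryEquiv.refl ℝ ℝ else LinearIsometryEquiv.neg ℝ

theorem cellLin_apply (bc : BoundaryCondition) (k : Fin d → ℤ) (y : Rd d) (i : Fin d) :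
    cellLin bc k y i = reflSign bc (k i) * y i := by
  rw [cellLin, LinearIsometryEquiv.piLpCongrRight_apply]
  rcases reflSign_eq bc (k i) with h | h
  · simp [h]
  · have h1 : ¬ ((-1 : ℝ) = 1) := by norm_num
    simp [h, h1]

/-- The isometry that maps the box to its translate by `k` side lengths, such that the
eigenfunctions are invariant up to a sign. -/
noncomputable def cellMap (bc : BoundaryCondition) (a : Rd d) (L : ℝ) (k : Fin d → ℤ) :
    Rd d ≃ₜ Rd d :=
  ((Homeomorph.addRight (-a)).trans (cellLin bc k).toHomeomorph).trans
    (Homeomorph.addRight (a + WithLp.toLp 2 fun i => L * (k i : ℝ)))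

theorem cellMap_apply (bc : BoundaryCondition) (k : Fin d → ℤ) (y : Rd d) (i : Fin d) :
    cellMap bc a L k y i = reflSign bc (k i) * (y i - a i) + (a i + L * k i) := by
  change cellLin bc k (y + -a) i + (a i + L * k i) = _
  rw [cellLin_apply]
  simp [sub_eq_add_neg]

theorem measurePreserving_cellMap (bc : BoundaryCondition) (k : Fin d → ℤ) :
    MeasurePreserving (cellMap bc a L k) volume volume :=
  (measurePreserving_add_right volume _).comp
    ((cellLin bc k).measurePreserving.comp (measurePreserving_add_right volume _))

theorem modeSpan_cellMap {bc : BoundaryCondition} (hL : 0 < L) (k : Fin d → ℤ) {p : Rd d → ℂ}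
    (hp : p ∈ modeSpan bc a L) (y : Rd d) :
    p (cellMap bc a L k y) = (∏ i, (reflSign bc (k i) : ℂ)) * p y := by
  refine Submodule.span_induction (p := fun p _ =>
    p (cellMap bc a L k y) = (∏ i, (reflSign bc (k i) : ℂ)) * p y) ?_ ?_ ?_ ?_ hp
  · rintro _ ⟨n, rfl⟩
    rw [mode, prodFun, prodFun, ← Finset.prod_mul_distrib]
    refine Finset.prod_congr rfl fun i _ => ?_
    rw [modeFac, modeFac, ← fac_refl bc hL, cellMap_apply]
    congr 1
    ring
  · simp
  · intro u w _ _ h1 h2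
    simp only [Pi.add_apply, h1, h2, mul_add]
  · intro c u _ h
    simp only [Pi.smul_apply, h, smul_eq_mul]
    ring

theorem norm_modeSpan_cellMap {bc : BoundaryCondition} (hL : 0 < L) (k : Fin d → ℤ) {p : Rd d → ℂ}
    (hp : p ∈ modeSpan bc a L) (y : Rd d) : ‖p (cellMap bc a L k y)‖ = ‖p y‖ := by
  rw [modeSpan_cellMap hL k hp, norm_mul, norm_prod, Finset.prod_eq_one, one_mul]
  intro i _
  rcases reflSign_eq bc (k i) with h | h <;> simp [h]

theorem closedBox_ae_eq_box : closedBox a L =ᵐ[volume] box a L := by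
  let lo : Fin d → ℝ := fun j => a j - L / 2
  let hi : Fin d → ℝ := fun j => a j + L / 2
  have hmp : MeasurePreserving (WithLp.ofLp : Rd d → (Fin d → ℝ)) :=
    PiLp.volume_preserving_ofLp (Fin d)
  have hae : (univ.pi fun j => Ioo (lo j) (hi j)) =ᵐ[volume] Icc lo hi :=
    Measure.univ_pi_Ioo_ae_eq_Icc
  have h := hmp.quasiMeasurePreserving.preimage_ae_eq hae
  have e1 : (WithLp.ofLp : Rd d → (Fin d → ℝ)) ⁻¹' (univ.pi fun j => Ioo (lo j) (hi j)) =
      box a L := by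
    ext y
    simp only [mem_preimage, box, mem_univ_pi, mem_Ioo, lo, hi]
    refine forall_congr' fun j => ?_
    rw [abs_lt]
    constructor <;> rintro ⟨h1, h2⟩ <;> constructor <;> linarith
  have e2 : (WithLp.ofLp : Rd d → (Fin d → ℝ)) ⁻¹' (Icc lo hi) = closedBox a L := by
    ext y
    simp only [mem_preimage, closedBox, mem_Icc, Pi.le_def, lo, hi, ← forall_and]
    refine forall_congr' fun j => ?_
    rw [abs_le]
    constructor <;> rintro ⟨h1, h2⟩ <;> constructor <;> linarith
  rw [e1, e2] at h
  exact h.symm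

/-- The points at distance less than `R` from a point of the box lie in cells whose indices are
bounded in terms of `R / L`. -/
theorem exists_mem_cell (bc : BoundaryCondition) (hL : 0 < L) {x₀ x : Rd d} (hx₀ : x₀ ∈ box a L)
    {N : ℕ} (hx : ‖x - x₀‖ ≤ N * L) :
    ∃ k ∈ Fintype.piFinset fun _ : Fin d => Finset.Icc (-((N : ℤ) + 1)) ((N : ℤ) + 1),
      x ∈ cellMap bc a L k '' closedBox a L := by
  -- reflections are involutions, so the preimage of `x` is given by the same signs
  let k : Fin d → ℤ := fun i => round ((x i - a i) / L)
  have hk : ∀ i, |x i - a i - L * k i| ≤ L / 2 := by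
    intro i
    have h1 := abs_sub_round ((x i - a i) / L)
    have h2 : x i - a i - L * k i = L * ((x i - a i) / L - k i) := by field_simp
    rw [h2, abs_mul, abs_of_pos hL]
    calc L * |(x i - a i) / L - k i| ≤ L * (1 / 2) := mul_le_mul_of_nonneg_left h1 hL.le
      _ = L / 2 := by ring
  refine ⟨k, ?_, WithLp.toLp 2 fun i => a i + reflSign bc (k i) * (x i - a i - L * k i), ?_, ?_⟩
  · rw [Fintype.mem_piFinset]
    intro i
    have h1 := abs_le.1 (hk i)
    have h2 := abs_lt.1 (hx₀ i)
    have h3 : |x i - x₀ i| ≤ N * L := (PiLp.norm_apply_le (x - x₀) i).trans hx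
    have h4 := abs_le.1 h3
    have h5 : (k i : ℝ) ≤ N + 1 := by
      refine le_of_mul_le_mul_left ?_ hL
      linarith
    have h6 : -((N : ℝ) + 1) ≤ k i := by
      refine le_of_mul_le_mul_left ?_ hL
      linarith
    rw [Finset.mem_Icc]
    constructor
    · exact_mod_cast h6
    · exact_mod_cast h5
  · intro i
    change |a i + reflSign bc (k i) * (x i - a i - L * k i) - a i| ≤ L / 2
    rw [add_sub_cancel_left, abs_mul]
    rcases reflSign_eq bc (k i) with h | h <;> simpa [h] using hk i
  · ext i
    rw [cellMap_apply]
    change reflSign bc (k i) * (a i + reflSign bc (k i) * (x i - a i - L * k i) - a i) +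
      (a i + L * k i) = x i
    rcases reflSign_eq bc (k i) with h | h <;> rw [h] <;> ring

/-- The integral over a ball of a nonnegative function that is invariant under the cell maps is
bounded by its integral over the box times the number of cells that the ball can meet. -/
theorem setIntegral_le_of_cellMap_invariant (bc : BoundaryCondition) (hL : 0 < L) {x₀ : Rd d}
    (hx₀ : x₀ ∈ box a L) (N : ℕ) {h : Rd d → ℝ} (hc : Continuous h) (h0 : ∀ x, 0 ≤ h x)
    (hinv : ∀ k y, h (cellMap bc a L k y) = h y) {B : Set (Rd d)} (hB : MeasurableSet B)
    (hBN : ∀ x ∈ B, ‖x - x₀‖ ≤ N * L) :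
    ∫ x in B, h x ≤ (2 * N + 3) ^ d * ∫ x in box a L, h x := by
  let I : Finset (Fin d → ℤ) :=
    Fintype.piFinset fun _ : Fin d => Finset.Icc (-((N : ℤ) + 1)) ((N : ℤ) + 1)
  have hcard : (I.card : ℝ) = (2 * N + 3) ^ d := by
    have h1 : I.card = (2 * N + 3) ^ d := by
      simp only [I, Fintype.card_piFinset_const, Int.card_Icc]
      congr 1
      omega
    rw [h1]
    push_cast
    rfl
  let S : (Fin d → ℤ) → Set (Rd d) := fun k => cellMap bc a L k '' closedBox a L
  have hScomp : ∀ k, IsCompact (S k) := fun k =>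
    (isCompact_closedBox hL).image (cellMap bc a L k).continuous
  have hSm : ∀ k, MeasurableSet (S k) := fun k => (hScomp k).isClosed.measurableSet
  have hSint : ∀ k, ∫ x in S k, h x = ∫ x in box a L, h x := by
    intro k
    rw [(measurePreserving_cellMap bc k).setIntegral_image_emb
      (cellMap bc a L k).measurableEmbedding]
    simp only [hinv]
    exact setIntegral_congr_set closedBox_ae_eq_box
  have hSi : ∀ k, Integrable ((S k).indicator h) := fun k =>
    (integrable_indicator_iff (hSm k)).2 (hc.continuousOn.integrableOn_compact (hScomp k))
  have hsumi : Integrable fun x => ∑ k ∈ I, (S k).indicator h x :=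
    integrable_finsetSum _ fun k _ => hSi k
  have hle : ∀ x, B.indicator h x ≤ ∑ k ∈ I, (S k).indicator h x := by
    intro x
    have hnn : ∀ k ∈ I, 0 ≤ (S k).indicator h x := fun k _ => indicator_nonneg (fun y _ => h0 y) x
    by_cases hx : x ∈ B
    · obtain ⟨k, hk, hxk⟩ := exists_mem_cell bc hL hx₀ (hBN x hx)
      rw [indicator_of_mem hx]
      refine le_trans ?_ (Finset.single_le_sum hnn hk)
      rw [indicator_of_mem hxk]
    · rw [indicator_of_notMem hx]
      exact Finset.sum_nonneg hnn
  rw [← integral_indicator hB]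
  calc ∫ x, B.indicator h x ≤ ∫ x, ∑ k ∈ I, (S k).indicator h x :=
        integral_mono_of_nonneg (Filter.Eventually.of_forall fun x =>
          indicator_nonneg (fun y _ => h0 y) x) hsumi (Filter.Eventually.of_forall hle)
    _ = ∑ k ∈ I, ∫ x, (S k).indicator h x := integral_finsetSum _ fun k _ => hSi k
    _ = ∑ k ∈ I, ∫ x in box a L, h x := Finset.sum_congr rfl fun k _ => by
        rw [integral_indicator (hSm k), hSint]
    _ = (2 * N + 3) ^ d * ∫ x in box a L, h x := by
        rw [Finset.sum_const, nsmul_eq_mul, hcard]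

end Reflections

/-! ### The estimate for linear combinations of eigenfunctions -/

section Transfer

variable {d : ℕ} {a : Rd d} {L : ℝ}

theorem pd_comp_add_right (u : Rd d → ℂ) (c : Rd d) (i : Fin d) :
    pd i (fun y => u (y + c)) = fun y => pd i u (y + c) := by
  funext y
  rw [pd, pd, fderiv_comp_add_right]

theorem lap_comp_add_right (u : Rd d → ℂ) (c : Rd d) (x : Rd d) :
    lap (fun y => u (y + c)) x = lap u (x + c) := by
  rw [lap, lap]
  refine Finset.sum_congr rfl fun i _ => ?_
  rw [pd_comp_add_right, pd_comp_add_right]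

/-- The smooth estimate, for the linear combinations of eigenfunctions on the box: the ball of
radius `8 Q` meets a number of cells that depends on the dimension only. -/
theorem exists_unique_continuation_modeSpan (d : ℕ) : ∃ C : ℝ, 0 < C ∧
    ∀ (bc : BoundaryCondition) (a : Rd d) (L : ℝ), 0 < L →
    ∀ (M : ℕ) (K δ Q : ℝ), 0 ≤ K → 0 < δ → δ ≤ 1 → 1 ≤ Q → Q ≤ d * L →
    (d : ℝ) + 2 ≤ M → 1536 * K ^ 2 * Q ^ 4 ≤ M ^ 3 →
    ∀ x₀ ∈ box a L, ∀ p ∈ modeSpan bc a L, ∀ T : Set (Rd d), MeasurableSet T →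
    (∀ x ∈ T, δ ≤ ‖x - x₀‖ ∧ ‖x - x₀‖ ≤ Q) →
    ∫ x in T, ‖p x‖ ^ 2 ≤ C * ((8 * Q ^ 2 / δ ^ 2) ^ (2 * (M + 1)) *
      ((∫ x in Metric.ball x₀ δ, ‖p x‖ ^ 2) +
        δ ^ 2 * ∫ x in box a L, (max 0 (‖lap p x‖ - K * ‖p x‖)) ^ 2) +
      Real.exp (-M) * ∫ x in box a L, ‖p x‖ ^ 2) := by
  obtain ⟨C, hC, hmain⟩ := exists_unique_continuation d
  have hN : (1 : ℝ) ≤ (2 * ((8 * d : ℕ) : ℝ) + 3) ^ d := by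
    refine one_le_pow₀ ?_
    have : (0 : ℝ) ≤ ((8 * d : ℕ) : ℝ) := Nat.cast_nonneg _
    linarith
  refine ⟨C * (2 * ((8 * d : ℕ) : ℝ) + 3) ^ d, by positivity, ?_⟩
  intro bc a L hL M K δ Q hK hδ hδ1 hQ hQL hM hM3 x₀ hx₀ p hp T hT hTδ
  have cp := contDiff_of_mem_modeSpan hp
  have cl := contDiff_lap cp
  set g : Rd d → ℝ := fun x => max 0 (‖lap p x‖ - K * ‖p x‖) with hg
  have cg : Continuous g :=
    continuous_const.max (cl.continuous.norm.sub (continuous_const.mul cp.continuous.norm))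
  have tr : ∀ (f : Rd d → ℝ) (s : Set (Rd d)),
      ∫ x in (fun x => x + x₀) ⁻¹' s, f (x + x₀) = ∫ x in s, f x := fun f s =>
    (measurePreserving_add_right volume x₀).setIntegral_preimage_emb
      (Homeomorph.addRight x₀).measurableEmbedding f s
  have hpos : ∀ {x : Rd d} {r : ℝ}, 0 ≤ r → (sq x < r ^ 2 ↔ ‖x‖ < r) := fun {x r} hr => by
    rw [sq_eq_norm]
    exact pow_lt_pow_iff_left₀ (norm_nonneg _) hr two_ne_zero
  have s1 : {x : Rd d | sq x < δ ^ 2} = (fun x => x + x₀) ⁻¹' Metric.ball x₀ δ := by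
    ext x
    change sq x < δ ^ 2 ↔ x + x₀ ∈ Metric.ball x₀ δ
    rw [hpos hδ.le, Metric.mem_ball, dist_eq_norm, add_sub_cancel_right]
  have s2 : {x : Rd d | sq x < 64 * Q ^ 2} =
      (fun x => x + x₀) ⁻¹' Metric.ball x₀ (8 * Q) := by
    ext x
    change sq x < 64 * Q ^ 2 ↔ x + x₀ ∈ Metric.ball x₀ (8 * Q)
    rw [show 64 * Q ^ 2 = (8 * Q) ^ 2 by ring, hpos (by linarith), Metric.mem_ball, dist_eq_norm,
      add_sub_cancel_right]
  have key := hmain M K δ Q hK hδ hδ1 hQ hM hM3 (fun x => p (x + x₀)) (fun x => g (x + x₀))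
    (cp.comp (contDiff_id.add contDiff_const)) (cg.comp (by fun_prop)) (fun x => by
      rw [lap_comp_add_right]
      have := le_max_right 0 (‖lap p (x + x₀)‖ - K * ‖p (x + x₀)‖)
      simp only [hg]
      linarith) ((fun x => x + x₀) ⁻¹' T) (hT.preimage (by fun_prop)) (fun x hx => by
      have := hTδ _ hx
      rw [add_sub_cancel_right] at this
      rw [sq_eq_norm]
      exact ⟨pow_le_pow_left₀ hδ.le this.1 2, pow_le_pow_left₀ (norm_nonneg _) this.2 2⟩)
  rw [s1, s2, tr (fun x => ‖p x‖ ^ 2), tr (fun x => ‖p x‖ ^ 2), tr (fun x => g x ^ 2),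
    tr (fun x => ‖p x‖ ^ 2)] at key
  have hball : ∀ x ∈ Metric.ball x₀ (8 * Q), ‖x - x₀‖ ≤ ((8 * d : ℕ) : ℝ) * L := by
    intro x hx
    rw [Metric.mem_ball, dist_eq_norm] at hx
    push_cast
    linarith
  have i1 := setIntegral_le_of_cellMap_invariant bc hL hx₀ (8 * d) (h := fun x => ‖p x‖ ^ 2)
    (cp.continuous.norm.pow 2) (fun x => by positivity)
    (fun k y => by simp only [norm_modeSpan_cellMap hL k hp]) Metric.isOpen_ball.measurableSet hball
  have i2 := setIntegral_le_of_cellMap_invariant bc hL hx₀ (8 * d) (h := fun x => g x ^ 2)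
    (cg.pow 2) (fun x => by positivity)
    (fun k y => by simp only [hg, norm_modeSpan_cellMap hL k hp,
      norm_modeSpan_cellMap hL k (lap_mem_modeSpan hp)]) Metric.isOpen_ball.measurableSet hball
  set R : ℝ := (2 * ((8 * d : ℕ) : ℝ) + 3) ^ d
  have hB0 : 0 ≤ ∫ x in Metric.ball x₀ δ, ‖p x‖ ^ 2 := integral_nonneg fun _ => by positivity
  have hD : 0 ≤ (8 * Q ^ 2 / δ ^ 2) ^ (2 * (M + 1)) := by positivity
  refine key.trans ?_
  rw [mul_assoc C R]
  refine mul_le_mul_of_nonneg_left ?_ hC.le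
  have j1 : ∫ x in Metric.ball x₀ δ, ‖p x‖ ^ 2 ≤ R * ∫ x in Metric.ball x₀ δ, ‖p x‖ ^ 2 :=
    le_mul_of_one_le_left hB0 hN
  have j2 := mul_le_mul_of_nonneg_left (add_le_add j1
    (mul_le_mul_of_nonneg_left i2 (sq_nonneg δ))) hD
  have j3 := mul_le_mul_of_nonneg_left i1 (Real.exp_pos (-(M : ℝ))).le
  calc _ ≤ _ := add_le_add j2 j3
    _ = _ := by ring

/-! ### Passage to the domain of the Laplacian -/

theorem localNorm_le_norm (f : L2 a L) (A : Set (Rd d)) : localNorm f A ≤ ‖f‖ := by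
  rw [localNorm, Lp.norm_def]
  exact ENNReal.toReal_mono (Lp.eLpNorm_lt_top f).ne (eLpNorm_indicator_le _)

theorem localNorm_sub_le (f g : L2 a L) {A : Set (Rd d)} (hA : MeasurableSet A) :
    |localNorm f A - localNorm g A| ≤ ‖f - g‖ := by
  have hm : ∀ f : L2 a L, MemLp (A.indicator f) 2 (boxMeasure a L) := fun f =>
    (Lp.memLp f).indicator hA
  have h : ∀ f : L2 a L, localNorm f A = ‖(hm f).toLp _‖ := fun f => by
    rw [localNorm, Lp.norm_toLp]
  rw [h f, h g]
  refine (abs_norm_sub_norm_le _ _).trans ?_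
  rw [← MemLp.toLp_sub, Lp.norm_toLp, Lp.norm_def]
  refine ENNReal.toReal_mono (Lp.eLpNorm_lt_top _).ne ?_
  refine eLpNorm_mono_ae ?_
  filter_upwards [Lp.coeFn_sub f g] with x hx
  rw [hx, Pi.sub_apply, Pi.sub_apply]
  by_cases hxA : x ∈ A
  · simp [hxA]
  · simp [hxA]

theorem continuous_localNorm {A : Set (Rd d)} (hA : MeasurableSet A) :
    Continuous fun f : L2 a L => localNorm f A := by
  refine LipschitzWith.continuous (K := 1) (LipschitzWith.of_dist_le_mul fun f g => ?_)
  rw [Real.dist_eq, dist_eq_norm, NNReal.coe_one, one_mul]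
  exact localNorm_sub_le f g hA

theorem localNorm_toL2_sq {p : Rd d → ℂ} (hp : Continuous p) {A : Set (Rd d)}
    (hA : MeasurableSet A) (hAb : A ⊆ box a L) :
    localNorm (toL2 a L p hp) A ^ 2 = ∫ x in A, ‖p x‖ ^ 2 := by
  have hm : MemLp (A.indicator (toL2 a L p hp)) 2 (boxMeasure a L) := (Lp.memLp _).indicator hA
  have h : localNorm (toL2 a L p hp) A = ‖hm.toLp _‖ := by
    rw [localNorm, Lp.norm_toLp]
  rw [h, norm_sq_eq_integral]
  have e : ∫ x in box a L, ‖(hm.toLp _ : L2 a L) x‖ ^ 2 =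
      ∫ x in box a L, A.indicator (fun x => ‖p x‖ ^ 2) x := by
    refine integral_congr_ae ?_
    filter_upwards [hm.coeFn_toLp, coeFn_toL2 hp] with x h1 h2
    rw [h1]
    by_cases hx : x ∈ A
    · simp [hx, h2]
    · simp [hx]
  rw [e, setIntegral_indicator hA, inter_eq_self_of_subset_right hAb]

theorem norm_potential_le (V : Lp ℝ ∞ (boxMeasure a L)) (f : L2 a L) :
    ‖potential V f‖ ≤ ‖V‖ * ‖f‖ :=
  Lp.norm_smul_le V f

theorem ae_norm_le_of_norm_le {V : Lp ℝ ∞ (boxMeasure a L)} {K : ℝ} (hV : ‖V‖ ≤ K) :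
    ∀ᵐ x ∂(boxMeasure a L), ‖V x‖ ≤ K := by
  filter_upwards [ae_le_eLpNormEssSup (f := V) (μ := boxMeasure a L)] with x hx
  refine le_trans ?_ hV
  rw [Lp.norm_def, eLpNorm_exponent_top, ← toReal_enorm]
  refine ENNReal.toReal_mono ?_ hx
  rw [← eLpNorm_exponent_top]
  exact (Lp.eLpNorm_lt_top V).ne

/-- The defect of the inequality `|Δp| ≤ K |p|` is bounded by `Hp`, for every potential that is
bounded by `K`. The defect does not involve the potential, so it is defined on the whole space and
has the symmetries of `p`. -/
theorem setIntegral_max_le {V : Lp ℝ ∞ (boxMeasure a L)} {K : ℝ} (hV : ‖V‖ ≤ K)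
    {p : Rd d → ℂ} (h1 : Continuous p) (h2 : Continuous (lap p)) :
    ∫ x in box a L, (max 0 (‖lap p x‖ - K * ‖p x‖)) ^ 2 ≤
      ‖-toL2 a L (lap p) h2 + potential V (toL2 a L p h1)‖ ^ 2 := by
  rw [norm_sq_eq_integral]
  refine integral_mono_of_nonneg (Filter.Eventually.of_forall fun x => by positivity)
    ((Lp.memLp _).norm.integrable_sq) ?_
  filter_upwards [ae_norm_le_of_norm_le hV, coeFn_toL2 h1, coeFn_toL2 h2,
    Lp.coeFn_add (-toL2 a L (lap p) h2) (potential V (toL2 a L p h1)),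
    Lp.coeFn_neg (toL2 a L (lap p) h2),
    Lp.coeFn_lpSMul (r := 2) V (toL2 a L p h1)] with x e1 e2 e3 e4 e5 e6
  have e6' : (potential V (toL2 a L p h1) : L2 a L) x = V x • p x := by
    rw [← e2]
    exact e6
  rw [e4, Pi.add_apply, e5, Pi.neg_apply, e3, e6']
  refine pow_le_pow_left₀ (le_max_left _ _) (max_le (norm_nonneg _) ?_) 2
  have h3 : ‖V x • p x‖ ≤ K * ‖p x‖ := by
    rw [norm_smul]
    exact mul_le_mul_of_nonneg_right e1 (norm_nonneg _)
  have h4 := norm_sub_norm_le (lap p x) (V x • p x)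
  have h5 : ‖-lap p x + V x • p x‖ = ‖lap p x - V x • p x‖ := by
    rw [← norm_neg]
    congr 1
    abel
  rw [h5]
  linarith

theorem continuous_potential (V : Lp ℝ ∞ (boxMeasure a L)) : Continuous (potential V) :=
  ((potential V).mkContinuous ‖V‖ (norm_potential_le V)).continuous

/-- The estimate with the free parameter `M`, for the graph of the Laplacian. -/
theorem exists_unique_continuation_laplacianGraph (d : ℕ) : ∃ C : ℝ, 0 < C ∧
    ∀ (bc : BoundaryCondition) (a : Rd d) (L : ℝ), 0 < L →
    ∀ (M : ℕ) (K δ Q : ℝ) (V : Lp ℝ ∞ (boxMeasure a L)), ‖V‖ ≤ K →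
    0 < δ → δ ≤ 1 → 1 ≤ Q → Q ≤ d * L → (d : ℝ) + 2 ≤ M → 1536 * K ^ 2 * Q ^ 4 ≤ M ^ 3 →
    ∀ x₀ ∈ box a L, Metric.ball x₀ δ ⊆ box a L → ∀ T : Set (Rd d), MeasurableSet T →
    T ⊆ box a L → (∀ x ∈ T, δ ≤ ‖x - x₀‖ ∧ ‖x - x₀‖ ≤ Q) →
    ∀ q ∈ laplacianGraph bc a L,
    localNorm q.1 T ^ 2 ≤ C * ((8 * Q ^ 2 / δ ^ 2) ^ (2 * (M + 1)) *
      (localNorm q.1 (Metric.ball x₀ δ) ^ 2 + δ ^ 2 * ‖-q.2 + potential V q.1‖ ^ 2) +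
      Real.exp (-M) * ‖q.1‖ ^ 2) := by
  obtain ⟨C, hC, hmain⟩ := exists_unique_continuation_modeSpan d
  refine ⟨C, hC, ?_⟩
  intro bc a L hL M K δ Q V hV hδ hδ1 hQ hQL hM hM3 x₀ hx₀ hball T hT hTb hTδ q hq
  have hBm : MeasurableSet (Metric.ball x₀ δ) := Metric.isOpen_ball.measurableSet
  have hcl : IsClosed {q : L2 a L × L2 a L | localNorm q.1 T ^ 2 ≤
      C * ((8 * Q ^ 2 / δ ^ 2) ^ (2 * (M + 1)) *
        (localNorm q.1 (Metric.ball x₀ δ) ^ 2 + δ ^ 2 * ‖-q.2 + potential V q.1‖ ^ 2) +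
        Real.exp (-M) * ‖q.1‖ ^ 2)} := by
    have c1 : Continuous fun q : L2 a L × L2 a L => localNorm q.1 T :=
      (continuous_localNorm hT).comp continuous_fst
    have c2 : Continuous fun q : L2 a L × L2 a L => localNorm q.1 (Metric.ball x₀ δ) :=
      (continuous_localNorm hBm).comp continuous_fst
    have c3 : Continuous fun q : L2 a L × L2 a L => potential V q.1 :=
      (continuous_potential V).comp continuous_fst
    exact isClosed_le (by fun_prop) (by fun_prop)
  refine closure_minimal (s := {q | ∃ p ∈ modeSpan bc a L, ∃ (h1 : Continuous p)
    (h2 : Continuous (lap p)), (toL2 a L p h1, toL2 a L (lap p) h2) = q}) ?_ hcl ?_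
  · rintro _ ⟨p, hp, h1, h2, rfl⟩
    have key := hmain bc a L hL M K δ Q ((norm_nonneg V).trans hV) hδ hδ1 hQ hQL hM hM3 x₀ hx₀ p hp
      T hT hTδ
    change localNorm (toL2 a L p h1) T ^ 2 ≤ C * ((8 * Q ^ 2 / δ ^ 2) ^ (2 * (M + 1)) *
        (localNorm (toL2 a L p h1) (Metric.ball x₀ δ) ^ 2 +
          δ ^ 2 * ‖-toL2 a L (lap p) h2 + potential V (toL2 a L p h1)‖ ^ 2) +
        Real.exp (-M) * ‖toL2 a L p h1‖ ^ 2)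
    rw [localNorm_toL2_sq h1 hT hTb, localNorm_toL2_sq h1 hBm hball, norm_toL2_sq]
    refine key.trans ?_
    gcongr
    exact setIntegral_max_le hV h1 h2
  · rw [Metric.mem_closure_iff]
    intro ε hε
    obtain ⟨p, hp, h1, h2, e1, e2⟩ :=
      exists_modeSpan_near_laplacianGraph hL hq (half_pos hε)
    refine ⟨_, ⟨p, hp, h1, h2, rfl⟩, ?_⟩
    rw [dist_comm, Prod.dist_eq, dist_eq_norm, dist_eq_norm]
    exact max_lt (e1.trans_lt (half_lt_self hε)) (e2.trans_lt (half_lt_self hε))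

/-- The choice of the parameter: `M` absorbs the last term of the estimate in its left-hand side. In
the applications `X`, `Y` and `S` are `‖ψ_Θ‖`, `‖ψ‖` and the right-hand side. All constants are then
bounded by powers of `Q / δ ≥ 24`. -/
theorem rpow_mul_sq_le_of_forall {d : ℕ} {C : ℝ} (hC : 0 < C) {K δ Q X Y S : ℝ} (hK : 0 ≤ K)
    (hδ : 0 < δ) (hδ1 : δ ≤ 1 / 24) (hQ : 1 ≤ Q) (hX : 0 < X) (hXY : X ≤ Y) (hS : 0 ≤ S)
    (h : ∀ M : ℕ, (d : ℝ) + 2 ≤ M → 1536 * K ^ 2 * Q ^ 4 ≤ M ^ 3 →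
      X ^ 2 ≤ C * ((8 * Q ^ 2 / δ ^ 2) ^ (2 * (M + 1)) * S + Real.exp (-M) * Y ^ 2)) :
    (δ / Q) ^ ((6 * d + 100 + 7 * max 0 (Real.log (2 * C))) * (1 + K ^ (2 / 3 : ℝ)) *
      (Q ^ (4 / 3 : ℝ) + Real.log (Y / X))) * X ^ 2 ≤ S := by
  set c := max 0 (Real.log (2 * C)) with hc
  set k := K ^ (2 / 3 : ℝ) with hk
  set q := Q ^ (4 / 3 : ℝ) with hq
  set l := Real.log (Y / X) with hl
  have hc0 : 0 ≤ c := le_max_left _ _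
  have hk0 : 0 ≤ k := Real.rpow_nonneg hK _
  have hq1 : 1 ≤ q := Real.one_le_rpow hQ (by norm_num)
  have hl0 : 0 ≤ l := Real.log_nonneg ((one_le_div hX).2 hXY)
  have hk3 : k ^ 3 = K ^ 2 := by
    rw [hk, ← Real.rpow_natCast, ← Real.rpow_mul hK, ← Real.rpow_natCast]
    norm_num
  have hq3 : q ^ 3 = Q ^ 4 := by
    rw [hq, ← Real.rpow_natCast, ← Real.rpow_mul (by linarith), ← Real.rpow_natCast]
    norm_num
  -- `12 ^ 3 = 1728 ≥ 1536`
  set M := ⌈(d : ℝ) + 2 + c + 12 * (k * q) + 2 * l⌉₊ with hM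
  have hkq : 0 ≤ k * q := mul_nonneg hk0 (by linarith)
  have hd : (0 : ℝ) ≤ d := d.cast_nonneg
  have hM1 : (d : ℝ) + 2 + c + 12 * (k * q) + 2 * l ≤ M := Nat.le_ceil _
  have hM2 : (M : ℝ) < (d : ℝ) + 2 + c + 12 * (k * q) + 2 * l + 1 :=
    Nat.ceil_lt_add_one (by positivity)
  have key := h M (by linarith) (by
    have h1 : 12 * (k * q) ≤ M := by linarith
    have h2 := pow_le_pow_left₀ (by positivity) h1 3
    have h3 : (12 * (k * q)) ^ 3 = 1728 * (K ^ 2 * Q ^ 4) := by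
      rw [← hk3, ← hq3]; ring
    have h4 : 0 ≤ K ^ 2 * Q ^ 4 := by positivity
    linarith)
  -- the last term is at most half of the left-hand side
  have habs : C * (Real.exp (-M) * Y ^ 2) ≤ X ^ 2 / 2 := by
    have h1 : Real.exp (-M) ≤ Real.exp (-(Real.log (2 * C) + 2 * l)) := by
      refine Real.exp_le_exp.2 ?_
      have := le_max_right 0 (Real.log (2 * C))
      linarith
    have h2 : Real.exp (-(Real.log (2 * C) + 2 * l)) = (2 * C)⁻¹ * (X / Y) ^ 2 := by
      rw [neg_add, Real.exp_add, Real.exp_neg, Real.exp_log (by positivity),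
        show -(2 * l) = 2 * -l by ring, hl, ← Real.log_inv, inv_div, two_mul (Real.log _), Real.exp_add,
        Real.exp_log (div_pos hX (by linarith)), pow_two]
    have hY : 0 < Y := hX.trans_le hXY
    calc C * (Real.exp (-M) * Y ^ 2) ≤ C * ((2 * C)⁻¹ * (X / Y) ^ 2 * Y ^ 2) := by
          rw [← h2]
          gcongr
      _ = X ^ 2 / 2 := by field_simp
  set ρ := Q / δ with hρ
  have hρ24 : 24 ≤ ρ := by
    rw [hρ, le_div_iff₀ hδ]
    linarith
  have hρ0 : 0 < ρ := by linarith
  have hD : 8 * Q ^ 2 / δ ^ 2 ≤ ρ ^ 3 := by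
    have e : 8 * Q ^ 2 / δ ^ 2 = 8 * ρ ^ 2 := by
      rw [hρ]; field_simp
    rw [e, pow_succ ρ 2, mul_comm]
    gcongr
    linarith
  have hCρ : 2 * C ≤ ρ ^ c := by
    have h1 : Real.exp c ≤ ρ ^ c := by
      rw [Real.rpow_def_of_pos hρ0, Real.exp_le_exp]
      refine le_mul_of_one_le_left hc0 ?_
      rw [Real.le_log_iff_exp_le hρ0]
      linarith [Real.exp_one_lt_d9]
    calc 2 * C = Real.exp (Real.log (2 * C)) := (Real.exp_log (by positivity)).symm
      _ ≤ Real.exp c := Real.exp_le_exp.2 (le_max_right _ _)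
      _ ≤ ρ ^ c := h1
  have hmain : X ^ 2 ≤ ρ ^ (c + 6 * (M + 1)) * S := by
    have h1 : X ^ 2 ≤ 2 * C * (8 * Q ^ 2 / δ ^ 2) ^ (2 * (M + 1)) * S := by
      rw [mul_add] at key
      linarith
    have h2 : (8 * Q ^ 2 / δ ^ 2) ^ (2 * (M + 1)) ≤ ρ ^ (6 * ((M : ℝ) + 1)) := by
      calc _ ≤ (ρ ^ 3) ^ (2 * (M + 1)) := pow_le_pow_left₀ (by positivity) hD _
        _ = ρ ^ (6 * ((M : ℝ) + 1)) := by
          rw [← pow_mul, ← Real.rpow_natCast]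
          congr 1
          push_cast
          ring
    calc X ^ 2 ≤ _ := h1
      _ ≤ ρ ^ c * ρ ^ (6 * ((M : ℝ) + 1)) * S := by gcongr
      _ = _ := by rw [← Real.rpow_add hρ0]
  set e := (6 * d + 100 + 7 * c) * (1 + k) * (q + l) with he
  have hexp : c + 6 * ((M : ℝ) + 1) ≤ e := by
    have h1 : 1 + k * q + l ≤ (1 + k) * (q + l) := by
      have := mul_nonneg hk0 hl0
      linarith
    have h2 : (6 * d + 100 + 7 * c) * (1 + k * q + l) ≤ e := by
      rw [he, mul_assoc]
      exact mul_le_mul_of_nonneg_left h1 (by positivity)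
    have h3 : 0 ≤ (6 * d + 7 * c) * (k * q + l) := by positivity
    linarith
  have hfin : (δ / Q) ^ e = (ρ ^ e)⁻¹ := by
    rw [← Real.inv_rpow hρ0.le, hρ, inv_div]
  rw [hfin, inv_mul_le_iff₀ (Real.rpow_pos_of_pos hρ0 _)]
  refine hmain.trans ?_
  gcongr
  linarith

end Transfer

end BoxSchrodinger

theorem corollary3p6 (d : ℕ) :
    ∃ m : ℝ, 0 < m ∧
      ∀ (bc : BoundaryCondition) (a : Rd d) (L : ℝ), 0 < L →
      ∀ (K : ℝ) (V : Lp ℝ ∞ (boxMeasure a L)), ‖V‖ ≤ K →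
      ∀ (ψ : (laplacian bc a L).domain) (Θ : Set (Rd d)),
        NullMeasurableSet Θ volume → Θ ⊆ box a L →
        0 < localNorm (ψ : L2 a L) Θ →
      ∀ x₀ ∈ box a L \ closure Θ, 1 ≤ supDist x₀ Θ →
      ∀ δ : ℝ, 0 < δ → δ ≤ min (Metric.infDist x₀ Θ) (1 / 24) →
        Metric.ball x₀ δ ⊆ box a L →
        (δ / supDist x₀ Θ) ^
            (m * (1 + K ^ (2 / 3 : ℝ)) *
              (supDist x₀ Θ ^ (4 / 3 : ℝ) +
                Real.log (‖(ψ : L2 a L)‖ /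
                  localNorm (ψ : L2 a L) Θ))) *
            localNorm (ψ : L2 a L) Θ ^ 2
          ≤ localNorm (ψ : L2 a L) (Metric.ball x₀ δ) ^ 2 +
            δ ^ 2 * ‖schrodinger bc a L V ψ‖ ^ 2 := by
  obtain ⟨C, hC, hmain⟩ := exists_unique_continuation_laplacianGraph d
  refine ⟨6 * d + 100 + 7 * max 0 (Real.log (2 * C)), by positivity, ?_⟩
  intro bc a L hL K V hV ψ Θ hΘ hΘb hψ x₀ hx₀ hQ δ hδ hδ1 hball
  -- the measurable subset `T` of `Θ` differs from it by a null set, and keeps the distance bounds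
  obtain ⟨T, hTΘ, hT, hTae⟩ := hΘ.exists_measurable_subset_ae_eq
  have hnorm : localNorm (ψ : L2 a L) Θ = localNorm (ψ : L2 a L) T := by
    rw [localNorm, localNorm]
    congr 1
    exact eLpNorm_congr_ae
      (indicator_ae_eq_of_ae_eq_set (ae_restrict_of_ae hTae.symm : Θ =ᵐ[boxMeasure a L] T))
  have hdist : ∀ y ∈ Θ, ‖y - x₀‖ ≤ d * L := by
    intro y hy
    have h1 : ∀ i, |y i - x₀ i| ≤ L := by
      intro i
      have h2 := abs_lt.1 (hΘb hy i)
      have h3 := abs_lt.1 (hx₀.1 i)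
      rw [abs_le]
      constructor <;> linarith
    have h2 : ‖y - x₀‖ ^ 2 ≤ (d * L) ^ 2 := by
      rw [EuclideanSpace.norm_sq_eq]
      calc ∑ i, ‖(y - x₀) i‖ ^ 2 ≤ ∑ _i : Fin d, L ^ 2 :=
            Finset.sum_le_sum fun i _ => pow_le_pow_left₀ (norm_nonneg _) (h1 i) 2
        _ = d * L ^ 2 := by simp
        _ ≤ (d * L) ^ 2 := by
          have : (d : ℝ) ≤ d ^ 2 := by exact_mod_cast Nat.le_self_pow two_ne_zero d
          rw [mul_pow]
          gcongr
    exact le_of_sq_le_sq h2 (by positivity)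
  have hbdd : BddAbove ((fun y => ‖y - x₀‖) '' Θ) := by
    refine ⟨d * L, ?_⟩
    rintro _ ⟨y, hy, rfl⟩
    exact hdist y hy
  have hQL : supDist x₀ Θ ≤ d * L := by
    refine Real.sSup_le ?_ (by positivity)
    rintro _ ⟨y, hy, rfl⟩
    exact hdist y hy
  have hTδ : ∀ x ∈ T, δ ≤ ‖x - x₀‖ ∧ ‖x - x₀‖ ≤ supDist x₀ Θ := by
    intro x hx
    refine ⟨?_, le_csSup hbdd ⟨x, hTΘ hx, rfl⟩⟩
    have h1 := Metric.infDist_le_dist_of_mem (x := x₀) (hTΘ hx)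
    rw [dist_comm, dist_eq_norm] at h1
    exact (hδ1.trans (min_le_left _ _)).trans h1
  have hδ24 : δ ≤ 1 / 24 := hδ1.trans (min_le_right _ _)
  have hgraph : ((ψ : L2 a L), laplacian bc a L ψ) ∈ laplacianGraph bc a L := by
    rw [← laplacian_graph bc hL]
    exact LinearPMap.mem_graph _ ψ
  have hH : schrodinger bc a L V ψ = -laplacian bc a L ψ + potential V (ψ : L2 a L) := rfl
  rw [hH, hnorm]
  rw [hnorm] at hψ
  generalize laplacian bc a L ψ = f at hgraph ⊢
  have key : ∀ M : ℕ, (d : ℝ) + 2 ≤ M → 1536 * K ^ 2 * supDist x₀ Θ ^ 4 ≤ M ^ 3 →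
      localNorm (ψ : L2 a L) T ^ 2 ≤ C * ((8 * supDist x₀ Θ ^ 2 / δ ^ 2) ^ (2 * (M + 1)) *
        (localNorm (ψ : L2 a L) (Metric.ball x₀ δ) ^ 2 +
          δ ^ 2 * ‖-f + potential V (ψ : L2 a L)‖ ^ 2) +
        Real.exp (-M) * ‖(ψ : L2 a L)‖ ^ 2) := fun M hM hM3 =>
    hmain bc a L hL M K δ _ V hV hδ (by linarith) hQ hQL hM hM3 x₀ hx₀.1 hball T hT
      (hTΘ.trans hΘb) hTδ (ψ, f) hgraph
  exact rpow_mul_sq_le_of_forall hC ((norm_nonneg V).trans hV) hδ hδ24 hQ hψ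
    (localNorm_le_norm _ _) (by positivity) key
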